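/- **Theorem 7.3.** Let $P_1,\dots,P_n$ be independent random variables and $\mathcal A=\{A_1,\dots,A_m\}$ events determined by them. Let $\mathrm{vbl}(A)$ be the smallest set of variables determining $A$, and let the dependency graph join $A_i$ and $A_k$ ($i\neq k$) iff $\mathrm{vbl}(A_i)\cap\mathrm{vbl}(A_k)\neq\emptyset$. For $\alpha>0$ put $$\Lambda(\alpha)=\begin{cases}0 & \alpha\le 1,\\ e\ln(\alpha)/\alpha & 1<\alpha<e,\\ 1 & \alpha\ge e.\end{cases}$$ *Algorithms.* A randomized algorithm is a fixed program of a random access machine on natural numbers with unit-cost addition, truncated subtraction, comparison, direct and indirect addressing, and uniform random integers. It gets $n$, $m$ and $\lfloor 1/p\rfloor$ as input, and maintains an assignment to $P_1,\dots,P_n$, started arbitrarily. It may, for unit cost, look up whether $P_j\in\mathrm{vbl}(A_i)$ and replace the value of $P_j$ by a fresh independent sample from its distribution; and it may, for a cost of at most $1+\tau$, call a verification procedure that tests whether $A_i$ holds under the current assignment. The system is *efficiently verifiable* if $\tau\le\mathrm{poly}(n,m)$. The algorithm's output is the assignment when it halts. *Claim.* For every $\alpha>0$ there are a randomized algorithm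 (depending only on $\alpha$) and a function $\eta$ (depending only on $\alpha$) with $\eta(p)\to0$ as $p\to0^+$ such that the following holds for every $p>0$ and every efficiently verifiable system as above in which (a) $\Pr[A_i]\le p$ for all $i$, and (b) the maximum degree of the dependency graph is at most $\alpha\left(\frac1{ep}-1\right)$. The algorithm has expected running time $\mathrm{poly}(n,m)$ (so it halts almost surely), where the polynomial depends only on $\alpha$ and on the polynomial bounding $\tau$; and the expected number of events $A_i$ that hold under its output is at most $(1+\eta(p))\,\Lambda(\alpha)\cdot mp$. -/

import Mathlib

open MeasureTheory
open scoped ENNReal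

noncomputable section

namespace MTBeyond

universe u

/-! ## Events determined by independent variables -/

section Events

variable {n m : ℕ} {Ω : Fin n → Type u}

/-- The event `B` is determined by the variables with index in `S`. -/
def DeterminedBy (B : Set (∀ j, Ω j)) (S : Set (Fin n)) : Prop :=
  ∀ σ τ : ∀ j, Ω j, (∀ j ∈ S, σ j = τ j) → (σ ∈ B ↔ τ ∈ B)

/-- The smallest set of variables that determines `B`
(see `determinedBy_vbl` and `vbl_subset`). -/
def vbl (B : Set (∀ j, Ω j)) : Set (Fin n) :=
  ⋂₀ {S | DeterminedBy B S}

theorem DeterminedBy.inter {B : Set (∀ j, Ω j)} {S T : Set (Fin n)}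
    (hS : DeterminedBy B S) (hT : DeterminedBy B T) : DeterminedBy B (S ∩ T) := by
  classical
  intro σ τ h
  refine (hS σ (fun j => if j ∈ S then σ j else τ j) ?_).trans (hT _ τ ?_)
  · intro j hj
    simp [hj]
  · intro j hj
    by_cases hjS : j ∈ S
    · simpa [hjS] using h j ⟨hjS, hj⟩
    · simp [hjS]

theorem determinedBy_vbl (B : Set (∀ j, Ω j)) : DeterminedBy B (vbl B) := by
  have hfin : ({S | DeterminedBy B S} : Set (Set (Fin n))).Finite := Set.toFinite _
  have key : ∀ F : Set (Set (Fin n)), F.Finite → (∀ S ∈ F, DeterminedBy B S) →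
      DeterminedBy B (⋂₀ F) := by
    intro F hF
    induction F, hF using Set.Finite.induction_on with
    | empty =>
      intro _ σ τ h
      have : σ = τ := funext fun j => h j (by simp)
      rw [this]
    | insert _ _ ih =>
      intro h
      rw [Set.sInter_insert]
      exact (h _ (Set.mem_insert _ _)).inter (ih fun S hS => h S (Set.mem_insert_of_mem _ hS))
  exact key _ hfin fun S hS => hS

theorem vbl_subset {B : Set (∀ j, Ω j)} {S : Set (Fin n)} (h : DeterminedBy B S) :
    vbl B ⊆ S :=
  Set.sInter_subset_of_mem h

/-- The variable-sharing graph: two different events are adjacent iff they share a variable. -/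
def dependencyGraph (A : Fin m → Set (∀ j, Ω j)) : SimpleGraph (Fin m) where
  Adj i k := i ≠ k ∧ (vbl (A i) ∩ vbl (A k)).Nonempty
  symm := ⟨fun _ _ h => ⟨h.1.symm, by rw [Set.inter_comm]; exact h.2⟩⟩
  loopless := ⟨fun _ h => h.1 rfl⟩

end Events

/-! ## Randomized programs

A program is a finite text in a structured random access language over natural number memory
cells, with unit-cost addition, truncated subtraction, direct and indirect addressing, and uniform
random integers.  There is no unit-cost multiplication.  The problem instance is accessed in a
black-box way, through the table of the sets `vbl`, through tests whether a given event holds under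
the current assignment, and through independent fresh samples of single variables. -/

/-- Basic instructions; all arguments are addresses of memory cells, except the number `k` in
`const`.  `load` reads and `store` writes through the address kept in a cell; `rand x y` puts a
uniform random element of `{0, …, M y - 1}` into cell `x`; `depends x y z` tests whether event
number `M y` depends on variable number `M z`; `verify x y` tests whether event number `M y` holds
now; `resample x` gives variable number `M x` a fresh random value. -/
inductive Instr : Type
  | const (x k : ℕ)
  | copy (x y : ℕ)
  | add (x y z : ℕ)
  | sub (x y z : ℕ)
  | load (x y : ℕ)
  | store (x y : ℕ)
  | rand (x y : ℕ)
  | depends (x y z : ℕ)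
  | verify (x y : ℕ)
  | resample (x : ℕ)

/-- Programs. -/
inductive Cmd : Type
  | basic (c : Instr)
  | seq (c₁ c₂ : Cmd)
  | ite (x : ℕ) (c₁ c₂ : Cmd)
  | loop (x : ℕ) (c : Cmd)

section Semantics

variable {n m : ℕ} {Ω : Fin n → Type u}

/-- A configuration: commands still to be executed, memory, current assignment. -/
structure Config (Ω : Fin n → Type u) where
  todo : List Cmd
  mem : ℕ → ℕ
  asg : ∀ j, Ω j

/-- The fresh randomness available to one step: a uniform real in `[0, 1]` (used for drawing a
uniform random integer) and a sample of all variables (used for resampling one of them). -/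
abbrev Fresh (Ω : Fin n → Type u) : Type u := unitInterval × (∀ j, Ω j)

open Classical in
/-- Effect of a basic instruction on the memory. -/
def Instr.newMem (A : Fin m → Set (∀ j, Ω j)) (r : Fresh Ω) (M : ℕ → ℕ) (σ : ∀ j, Ω j) :
    Instr → (ℕ → ℕ)
  | .const x k => Function.update M x k
  | .copy x y => Function.update M x (M y)
  | .add x y z => Function.update M x (M y + M z)
  | .sub x y z => Function.update M x (M y - M z)
  | .load x y => Function.update M x (M (M y))
  | .store x y => Function.update M (M x) (M y)
  -- a uniform element of `{0, …, M y - 1}`; the `min` matters only if the random real is `1`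
  | .rand x y => Function.update M x (min ⌊(r.1 : ℝ) * (M y : ℝ)⌋₊ (M y - 1))
  | .depends x y z => Function.update M x
      (if ∃ (hi : M y < m) (hj : M z < n), (⟨M z, hj⟩ : Fin n) ∈ vbl (A ⟨M y, hi⟩) then 1 else 0)
  | .verify x y => Function.update M x (if ∃ hi : M y < m, σ ∈ A ⟨M y, hi⟩ then 1 else 0)
  | .resample _ => M

/-- Effect of a basic instruction on the assignment. -/
def Instr.newAsg (r : Fresh Ω) (M : ℕ → ℕ) (σ : ∀ j, Ω j) : Instr → (∀ j, Ω j)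
  | .resample x => if hj : M x < n then Function.update σ ⟨M x, hj⟩ (r.2 ⟨M x, hj⟩) else σ
  | _ => σ

/-- One step; a configuration without remaining commands has halted and does not change. -/
def step (A : Fin m → Set (∀ j, Ω j)) (r : Fresh Ω) : Config Ω → Config Ω
  | ⟨[], M, σ⟩ => ⟨[], M, σ⟩
  | ⟨.basic c :: K, M, σ⟩ => ⟨K, c.newMem A r M σ, c.newAsg r M σ⟩
  | ⟨.seq c₁ c₂ :: K, M, σ⟩ => ⟨c₁ :: c₂ :: K, M, σ⟩
  | ⟨.ite x c₁ c₂ :: K, M, σ⟩ => ⟨(if M x ≠ 0 then c₁ else c₂) :: K, M, σ⟩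
  | ⟨.loop x c :: K, M, σ⟩ => ⟨if M x ≠ 0 then c :: .loop x c :: K else K, M, σ⟩

/-- Time charged for the next step, when one call of the verification procedure takes time `τ`. -/
def stepCost (τ : ℕ) : Config Ω → ℕ
  | ⟨[], _, _⟩ => 0
  | ⟨.basic (.verify _ _) :: _, _, _⟩ => 1 + τ
  | ⟨_ :: _, _, _⟩ => 1

/-- Initial memory: the inputs `n`, `m`, `q` in the cells `0`, `1`, `2`, and `0` elsewhere. -/
def initMem (n m q : ℕ) : ℕ → ℕ
  | 0 => n
  | 1 => m
  | 2 => q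
  | _ => 0

/-- The configuration after `t` steps of the program `c` with input `q`, started from the
assignment `σ₀`; step number `t` uses the fresh randomness `ω t`. -/
def run (c : Cmd) (A : Fin m → Set (∀ j, Ω j)) (q : ℕ) (σ₀ : ∀ j, Ω j) (ω : ℕ → Fresh Ω) :
    ℕ → Config Ω
  | 0 => ⟨[c], initMem n m q, σ₀⟩
  | t + 1 => step A (ω t) (run c A q σ₀ ω t)

/-- Total running time; it is `∞` if the program does not halt. -/
def runTime (c : Cmd) (τ : ℕ) (A : Fin m → Set (∀ j, Ω j)) (q : ℕ) (σ₀ : ∀ j, Ω j)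
    (ω : ℕ → Fresh Ω) : ℝ≥0∞ :=
  ∑' t, (stepCost τ (run c A q σ₀ ω t) : ℝ≥0∞)

/-- The program halts, and the event `A i` holds under the assignment it ends with. -/
def HoldsAtEnd (c : Cmd) (A : Fin m → Set (∀ j, Ω j)) (q : ℕ) (σ₀ : ∀ j, Ω j)
    (ω : ℕ → Fresh Ω) (i : Fin m) : Prop :=
  ∃ t, (run c A q σ₀ ω t).todo = [] ∧ (run c A q σ₀ ω t).asg ∈ A i

variable [∀ j, MeasurableSpace (Ω j)]

/-- The law of the randomness: independent over all steps, the random real uniform and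
independent of the samples, variable `j` distributed as `μ j`, the variables independent. -/
def tapeLaw (μ : ∀ j, Measure (Ω j)) [∀ j, IsProbabilityMeasure (μ j)] :
    Measure (ℕ → Fresh Ω) :=
  Measure.infinitePi fun _ => (volume : Measure unitInterval).prod (Measure.pi μ)

/-- Expected running time. -/
def expectedTime (c : Cmd) (τ : ℕ) (μ : ∀ j, Measure (Ω j)) [∀ j, IsProbabilityMeasure (μ j)]
    (A : Fin m → Set (∀ j, Ω j)) (q : ℕ) (σ₀ : ∀ j, Ω j) : ℝ≥0∞ :=
  ∫⁻ ω, runTime c τ A q σ₀ ω ∂(tapeLaw μ)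

/-- Expected number of events that hold under the output assignment. -/
def expectedViolated (c : Cmd) (μ : ∀ j, Measure (Ω j)) [∀ j, IsProbabilityMeasure (μ j)]
    (A : Fin m → Set (∀ j, Ω j)) (q : ℕ) (σ₀ : ∀ j, Ω j) : ℝ≥0∞ :=
  ∫⁻ ω, (({i | HoldsAtEnd c A q σ₀ ω i} : Set (Fin m)).ncard : ℝ≥0∞) ∂(tapeLaw μ)

end Semantics

/-- The guaranteed fraction: `0` for `α ≤ 1`, `e ln α / α` for `1 < α < e`, `1` for `α ≥ e`. -/
def fraction (α : ℝ) : ℝ :=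
  if α ≤ 1 then 0 else if α < Real.exp 1 then Real.exp 1 * Real.log α / α else 1

end MTBeyond

end

/-! Every event receives a private coin that shows heads with probability q. Moser–Tardos resampling
is run only on the active events, those that hold and whose coin shows heads; a resampled event
redraws its coin along with its variables. Active events have probability at most q p, and the
dependency graph is unchanged because coins are not shared. If closed neighbourhoods have at most d
elements, then y = q/d satisfies q p (1+y)^d ≤ y as soon as e^q d p ≤ 1, and the expected number of
resamplings is at most m y ≤ m. An event that survives has a tails coin. "A_i with tails" has
probability at most (1-q) p, and resampling inflates it by a factor of at most (1+y)^d ≤ e^q, so at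
most m p (1-q) e^q events survive in expectation. The degree hypothesis gives e d p ≤ α when α ≥ 1,
which suggests q = 1 - ln α for 1 < α < e, and then (1-q) e^q = e ln α / α. For α ≤ 1 take q = 1,
for α ≥ e take q = 0.

The resampling process is analysed by a potential instead of witness trees. For an event D with the
scope of A_i, sum over all sequences {i} = J_0, J_1, …, J_h in which each set is an independent
subset of the closed neighbourhood of its predecessor. The summand at x is the expected outcome of
testing and resampling J_h, then J_{h-1}, …, then J_1, and finally testing D. Performing k before
such a sequence gives another sequence after commuting k past the layers that avoid its
neighbourhood, and this map is injective (`map_le_hitSum`). Hence the expected potential does not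
grow when an active k is resampled (`lmarginal_potential_le`), and it drops by at least 1 if k = i
and D = A_i (`one_add_lmarginal_potential_le`). Its integral under the product law is controlled by
`functional_allSum_le`. Summing over i gives `exists_resampling_potential` and
`exists_output_potential`.

A calculus of expected costs (`Wp`, `wp_loop`) carries potentials over to programs. Price 1 per step
with terminal value 0 measures time; price 0 with the number of events that hold as terminal value
measures the output. `wp_algorithm` treats both, and `algorithm_bounds` combines them with the
potentials.

The program must find q by additions only. It takes q = S/(d+1), where S counts the factors 1+1/d
that fit between d and ⌊1/p⌋. Since e^{1/(d+1)} ≤ 1+1/d, this q is admissible (`exp_stepCount_le`).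
Rounding loses O(1/d), and either q = 1 or 1/d = O(p), so the loss vanishes with p (`coinBound_le`).
-/

namespace MTBeyond

/-! ## Sums over layered sequences of independent sets -/

section Layers

variable {ι : Type*} [DecidableEq ι]

/-- The independent sets contained in the closed neighbourhood of `I`, where `Γ i` is the closed
neighbourhood of `i`. -/
def layers (Γ : ι → Finset ι) (I : Finset ι) : Finset (Finset ι) :=
  (I.biUnion Γ).powerset.filter fun J => ∀ a ∈ J, ∀ b ∈ J, a ≠ b → b ∉ Γ a

theorem mem_layers {Γ : ι → Finset ι} {I J : Finset ι} :
    J ∈ layers Γ I ↔ J ⊆ I.biUnion Γ ∧ ∀ a ∈ J, ∀ b ∈ J, a ≠ b → b ∉ Γ a := by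
  simp [layers]

variable {M : Type*} [AddCommMonoid M]

/-- Sum of `R Jₕ (⋯ (R J₁ f))` over all sequences `I = J₀, J₁, …, Jₕ` in which each set is an
independent subset of the closed neighbourhood of its predecessor. -/
def allSum (Γ : ι → Finset ι) (R : Finset ι → M →+ M) : ℕ → Finset ι → M → M
  | 0, _, f => f
  | h + 1, I, f => ∑ J ∈ layers Γ I, allSum Γ R h J (R J f)

/-- The part of `allSum` in which none of `J₁, …, Jₕ` meets `Γ i`. -/
def avoidSum (Γ : ι → Finset ι) (R : Finset ι → M →+ M) (i : ι) : ℕ → Finset ι → M → M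
  | 0, _, f => f
  | h + 1, I, f => ∑ J ∈ layers Γ I with Disjoint J (Γ i), avoidSum Γ R i h J (R J f)

/-- The part of `allSum` in which at least one of `J₁, …, Jₕ` meets `Γ i`. -/
def hitSum (Γ : ι → Finset ι) (R : Finset ι → M →+ M) (i : ι) : ℕ → Finset ι → M → M
  | 0, _, _ => 0
  | h + 1, I, f => ∑ J ∈ layers Γ I, if Disjoint J (Γ i) then hitSum Γ R i h J (R J f)
      else allSum Γ R h J (R J f)

variable {Γ : ι → Finset ι} {R : Finset ι → M →+ M}

theorem avoidSum_add_hitSum (i : ι) (h : ℕ) (I : Finset ι) (f : M) :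
    avoidSum Γ R i h I f + hitSum Γ R i h I f = allSum Γ R h I f := by
  induction h generalizing I f with
  | zero => simp [avoidSum, hitSum, allSum]
  | succ h ih =>
    simp only [avoidSum, hitSum, allSum, Finset.sum_filter, ← Finset.sum_add_distrib]
    refine Finset.sum_congr rfl fun J _ => ?_
    split_ifs <;> simp [ih]

/-- The operator of i commutes past every layer that avoids `Γ i` and so reaches `f`. -/
theorem map_avoidSum {i : ι}
    (hc : ∀ J f, Disjoint J (Γ i) → R {i} (R J f) = R J (R {i} f)) (h : ℕ) (I : Finset ι) (f : M) :
    R {i} (avoidSum Γ R i h I f) = avoidSum Γ R i h I (R {i} f) := by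
  induction h generalizing I f with
  | zero => simp [avoidSum]
  | succ h ih =>
    simp only [avoidSum, map_sum]
    refine Finset.sum_congr rfl fun J hJ => ?_
    rw [ih, hc J f (Finset.mem_filter.1 hJ).2]

/-- Inserting i into I only offers new members from `Γ i` to the next layer, and an avoiding layer
uses none of them. -/
theorem avoidSum_insert (i : ι) (h : ℕ) (I : Finset ι) (f : M) :
    avoidSum Γ R i h (insert i I) f = avoidSum Γ R i h I f := by
  cases h with
  | zero => simp [avoidSum]
  | succ h =>
    simp only [avoidSum]
    refine Finset.sum_congr ?_ fun _ _ => rfl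
    ext J
    simp only [Finset.mem_filter, mem_layers, Finset.biUnion_insert]
    constructor
    · rintro ⟨⟨h1, h2⟩, h3⟩
      refine ⟨⟨fun x hx => ?_, h2⟩, h3⟩
      rcases Finset.mem_union.1 (h1 hx) with hx' | hx'
      · exact absurd hx' (Finset.disjoint_left.1 h3 hx)
      · exact hx'
    · rintro ⟨⟨h1, h2⟩, h3⟩
      exact ⟨⟨h1.trans Finset.subset_union_right, h2⟩, h3⟩

/-- If every operator `R J`, for `J` independent, scales the functional `E` by at most `P ^ |J|`,
where `P (1 + y) ^ d ≤ y`, then `E` of `allSum` is controlled. -/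
theorem functional_allSum_le {E : M →+ ENNReal} {P y : ENNReal} {d : ℕ}
    (hE : ∀ J f, (∀ a ∈ J, ∀ b ∈ J, a ≠ b → b ∉ Γ a) → E (R J f) ≤ P ^ J.card * E f)
    (hd : ∀ i, (Γ i).card ≤ d)
    (hy : P * (1 + y) ^ d ≤ y) (h : ℕ) (I : Finset ι) (f : M) :
    E (allSum Γ R h I f) ≤ E f * (1 + y) ^ (d * I.card) := by
  have h1y : 1 ≤ 1 + y := le_self_add
  induction h generalizing I f with
  | zero => exact le_mul_of_one_le_right zero_le (one_le_pow₀ h1y)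
  | succ h ih =>
    rw [allSum, map_sum]
    calc ∑ J ∈ layers Γ I, E (allSum Γ R h J (R J f))
        ≤ ∑ J ∈ layers Γ I, E f * y ^ J.card := by
          -- Each element of J contributes a factor P from its test and (1+y)^d from the layers
          -- after it, together at most y. Summing y^|J| over all subsets of the neighbourhood then
          -- gives a power of 1+y by the binomial formula.
          refine Finset.sum_le_sum fun J hJ => (ih J _).trans ?_
          calc E (R J f) * (1 + y) ^ (d * J.card)
              ≤ (P ^ J.card * E f) * (1 + y) ^ (d * J.card) :=
                by gcongr; exact hE J f (mem_layers.1 hJ).2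
            _ = E f * (P * (1 + y) ^ d) ^ J.card := by rw [mul_pow, pow_mul]; ring
            _ ≤ E f * y ^ J.card := by gcongr
      _ ≤ ∑ J ∈ (I.biUnion Γ).powerset, E f * y ^ J.card :=
          Finset.sum_le_sum_of_subset (Finset.filter_subset _ _)
      _ = E f * (1 + y) ^ (I.biUnion Γ).card := by
          rw [← Finset.mul_sum, add_comm 1 y, ← Finset.sum_pow_mul_eq_add_pow]
          simp
      _ ≤ E f * (1 + y) ^ (d * I.card) := by
          gcongr
          · rw [mul_comm]
            exact Finset.card_biUnion_le_card_mul _ _ _ fun i _ => hd i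

/-! ### Monotonicity, and absorbing one more resampling into a sequence -/

variable [PartialOrder M] [IsOrderedAddMonoid M]

theorem avoidSum_mono (hR : ∀ J f g, f ≤ g → R J f ≤ R J g) (i : ι) (h : ℕ) (I : Finset ι)
    {f g : M} (hfg : f ≤ g) : avoidSum Γ R i h I f ≤ avoidSum Γ R i h I g := by
  induction h generalizing I f g with
  | zero => simpa [avoidSum]
  | succ h ih => exact Finset.sum_le_sum fun J _ => ih J (hR J _ _ hfg)

/-- A sequence can be prolonged by an empty layer: `∅` is allowed after every set, and its operator
is the identity. -/
theorem avoidSum_le_succ (h0 : ∀ f : M, 0 ≤ f) (hR0 : ∀ f, R ∅ f = f) (i : ι) (h : ℕ)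
    (I : Finset ι) (f : M) : avoidSum Γ R i h I f ≤ avoidSum Γ R i (h + 1) I f := by
  induction h generalizing I f with
  | zero =>
    have he : (∅ : Finset ι) ∈ (layers Γ I).filter (Disjoint · (Γ i)) := by simp [mem_layers]
    refine le_trans ?_ (Finset.single_le_sum (fun J _ => h0 _) he)
    simp [avoidSum, hR0]
  | succ h ih => exact Finset.sum_le_sum fun J _ => ih J _

theorem le_avoidSum (h0 : ∀ f : M, 0 ≤ f) (hR0 : ∀ f, R ∅ f = f) (i : ι) (h : ℕ)
    (I : Finset ι) (f : M) : f ≤ avoidSum Γ R i h I f := by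
  induction h with
  | zero => simp [avoidSum]
  | succ h ih => exact ih.trans (avoidSum_le_succ h0 hR0 i h I f)

theorem allSum_le_succ (h0 : ∀ f : M, 0 ≤ f) (hR0 : ∀ f, R ∅ f = f) (h : ℕ)
    (I : Finset ι) (f : M) : allSum Γ R h I f ≤ allSum Γ R (h + 1) I f := by
  induction h generalizing I f with
  | zero =>
    have he : (∅ : Finset ι) ∈ layers Γ I := by simp [mem_layers]
    refine le_trans ?_ (Finset.single_le_sum (fun J _ => h0 _) he)
    simp [allSum, hR0]
  | succ h ih => exact Finset.sum_le_sum fun J _ => ih J _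

theorem hitSum_le_allSum (h0 : ∀ f : M, 0 ≤ f) (i : ι) (h : ℕ) (I : Finset ι) (f : M) :
    hitSum Γ R i h I f ≤ allSum Γ R h I f := by
  rw [← avoidSum_add_hitSum i]
  exact le_add_of_nonneg_left (h0 _)

/-- Performing `i` first maps the sequences meeting `Γ i` injectively to such sequences. -/
theorem map_le_hitSum (h0 : ∀ f : M, 0 ≤ f) (hR0 : ∀ f, R ∅ f = f)
    (hself : ∀ i, i ∈ Γ i) (hsymm : ∀ i j, i ∈ Γ j → j ∈ Γ i) {i : ι}
    (hc : ∀ J f, Disjoint J (Γ i) → R {i} (R J f) = R (insert i J) f)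
    (hc' : ∀ J f, Disjoint J (Γ i) → R J (R {i} f) = R (insert i J) f)
    (h : ℕ) (I : Finset ι) (f : M) :
    R {i} (hitSum Γ R i h I f) ≤ hitSum Γ R i (h + 1) I f ∧
    (¬ Disjoint I (Γ i) → R {i} (allSum Γ R h I f) ≤ hitSum Γ R i (h + 1) I f) := by
  have hmemI : ∀ I : Finset ι, ¬ Disjoint I (Γ i) → i ∈ I.biUnion Γ := by
    intro I hI
    obtain ⟨j, hj, hji⟩ := Finset.not_disjoint_iff.1 hI
    exact Finset.mem_biUnion.2 ⟨j, hj, hsymm _ _ hji⟩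
  have hcomm : ∀ J f, Disjoint J (Γ i) → R {i} (R J f) = R J (R {i} f) := fun J f hJ =>
    (hc J f hJ).trans (hc' J f hJ).symm
  -- `R {i}` stands outermost, so it is performed before all layers. It moves inwards past J_h,
  -- J_{h-1}, … as long as these avoid `Γ i`, and stops at the first layer J_t that meets `Γ i`. It
  -- is then absorbed into J_{t+1}, which avoids `Γ i` and thus stays independent, and i lies in the
  -- closed neighbourhood of J_t. The second claim also allows t = 0, when I itself meets `Γ i`.
  induction h generalizing I f with
  | zero =>
    refine ⟨by simp only [hitSum, map_zero]; exact h0 _, fun hI => ?_⟩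
    -- No layer is left to absorb i, so i forms a new layer of its own.
    have he : ({i} : Finset ι) ∈ layers Γ I := by
      simp only [mem_layers, Finset.singleton_subset_iff, hmemI I hI, true_and]
      simp only [Finset.mem_singleton]
      rintro a rfl b rfl hab
      exact absurd rfl hab
    refine le_trans ?_ (Finset.single_le_sum (fun J _ => h0 _) he)
    simp [allSum, hself]
  | succ h ih =>
    constructor
    · rw [hitSum, hitSum, map_sum]
      refine Finset.sum_le_sum fun J _ => ?_
      split_ifs with hJ
      · exact (ih J _).1
      · exact ((ih J _).2 hJ).trans (hitSum_le_allSum h0 _ _ _ _)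
    · intro hI
      rw [allSum, hitSum, map_sum]
      -- If J avoids `Γ i`, the sequences with a later hit are handled by induction. In those
      -- without one, i commutes all the way in and joins J.
      have h1 : ∀ J ∈ layers Γ I, R {i} (allSum Γ R h J (R J f)) ≤
          hitSum Γ R i (h + 1) J (R J f) +
            if Disjoint J (Γ i) then avoidSum Γ R i h (insert i J) (R (insert i J) f) else 0 := by
        intro J _
        split_ifs with hJ
        · rw [← avoidSum_add_hitSum i, map_add, map_avoidSum hcomm, hc J f hJ, avoidSum_insert,
            add_comm]
          exact add_le_add_left (ih J _).1 _
        · rw [add_zero]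
          exact (ih J _).2 hJ
      refine (Finset.sum_le_sum h1).trans ?_
      rw [Finset.sum_add_distrib, ← Finset.sum_filter]
      -- The enlarged layers `insert i J` are distinct layers that do meet `Γ i`. Their avoiding
      -- part is exactly what is missing there between `hitSum` and `allSum`.
      have h2 : ∑ J ∈ layers Γ I with Disjoint J (Γ i),
            avoidSum Γ R i h (insert i J) (R (insert i J) f) ≤
          ∑ J ∈ layers Γ I with ¬ Disjoint J (Γ i), avoidSum Γ R i (h + 1) J (R J f) := by
        have hinj : Set.InjOn (insert i) (((layers Γ I).filter (Disjoint · (Γ i)) :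
            Finset (Finset ι)) : Set (Finset ι)) := by
          intro J hJ K hK hJK
          have hn : ∀ J ∈ (layers Γ I).filter (Disjoint · (Γ i)), i ∉ J := fun J hJ hi =>
            Finset.disjoint_left.1 (Finset.mem_filter.1 hJ).2 hi (hself i)
          rw [← Finset.erase_insert (hn J hJ), ← Finset.erase_insert (hn K hK)]
          exact congrArg (fun s : Finset ι => s.erase i) hJK
        refine (Finset.sum_le_sum fun J _ => avoidSum_le_succ h0 hR0 i h _ _).trans ?_
        rw [← Finset.sum_image (f := fun J => avoidSum Γ R i (h + 1) J (R J f)) hinj]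
        refine Finset.sum_le_sum_of_subset_of_nonneg ?_ fun _ _ _ => h0 _
        intro K hK
        obtain ⟨J, hJ, rfl⟩ := Finset.mem_image.1 hK
        obtain ⟨hJ1, hJ2⟩ := Finset.mem_filter.1 hJ
        obtain ⟨hJ3, hJ4⟩ := mem_layers.1 hJ1
        refine Finset.mem_filter.2 ⟨mem_layers.2 ⟨?_, ?_⟩, ?_⟩
        · exact Finset.insert_subset (hmemI I hI) hJ3
        · intro a ha b hb hab
          rcases Finset.mem_insert.1 ha with ha' | ha'
          · rcases Finset.mem_insert.1 hb with hb' | hb'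
            · exact absurd (ha'.trans hb'.symm) hab
            · rw [ha']
              exact Finset.disjoint_left.1 hJ2 hb'
          · rcases Finset.mem_insert.1 hb with hb' | hb'
            · rw [hb']
              exact fun hh => Finset.disjoint_left.1 hJ2 ha' (hsymm _ _ hh)
            · exact hJ4 a ha' b hb' hab
        · exact fun hd => Finset.disjoint_left.1 hd (Finset.mem_insert_self i J) (hself i)
      refine (add_le_add_right h2 _).trans ?_
      rw [Finset.sum_filter, ← Finset.sum_add_distrib]
      refine Finset.sum_le_sum fun J _ => ?_
      by_cases hJ : Disjoint J (Γ i)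
      · simp [hJ]
      · simp only [hJ, not_false_eq_true, if_true, if_false]
        rw [add_comm, avoidSum_add_hitSum]

/-- Sequences with a hit absorb i by `map_le_hitSum`. In the others i reaches `f`, where `hf`
disposes of it, unless I meets `Γ i` and i can join the first layer. -/
theorem map_allSum_le (h0 : ∀ f : M, 0 ≤ f) (hR0 : ∀ f, R ∅ f = f)
    (hR : ∀ J f g, f ≤ g → R J f ≤ R J g)
    (hself : ∀ i, i ∈ Γ i) (hsymm : ∀ i j, i ∈ Γ j → j ∈ Γ i) {i : ι}
    (hc : ∀ J f, Disjoint J (Γ i) → R {i} (R J f) = R (insert i J) f)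
    (hc' : ∀ J f, Disjoint J (Γ i) → R J (R {i} f) = R (insert i J) f)
    (h : ℕ) (I : Finset ι) (f : M) (hf : Disjoint I (Γ i) → R {i} f ≤ f) :
    R {i} (allSum Γ R h I f) ≤ allSum Γ R (h + 1) I f := by
  obtain ⟨h1, h2⟩ := map_le_hitSum h0 hR0 hself hsymm hc hc' h I f
  by_cases hI : Disjoint I (Γ i)
  · rw [← avoidSum_add_hitSum i, ← avoidSum_add_hitSum i (h + 1), map_add,
      map_avoidSum fun J f hJ => (hc J f hJ).trans (hc' J f hJ).symm]
    exact add_le_add ((avoidSum_mono hR i h I (hf hI)).trans (avoidSum_le_succ h0 hR0 i h I f)) h1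
  · exact (h2 hI).trans (hitSum_le_allSum h0 i _ I f)

/-- All images of sequences under i have a hit, so the avoiding sequences remain free; the empty one
among them accounts for the extra `f`. This is the unit by which the potential drops. -/
theorem add_map_allSum_le (h0 : ∀ f : M, 0 ≤ f) (hR0 : ∀ f, R ∅ f = f)
    (hself : ∀ i, i ∈ Γ i) (hsymm : ∀ i j, i ∈ Γ j → j ∈ Γ i) {i : ι}
    (hc : ∀ J f, Disjoint J (Γ i) → R {i} (R J f) = R (insert i J) f)
    (hc' : ∀ J f, Disjoint J (Γ i) → R J (R {i} f) = R (insert i J) f)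
    (h : ℕ) (I : Finset ι) (f : M) (hI : ¬ Disjoint I (Γ i)) :
    f + R {i} (allSum Γ R h I f) ≤ allSum Γ R (h + 1) I f := by
  rw [← avoidSum_add_hitSum i (h + 1)]
  exact add_le_add (le_avoidSum h0 hR0 i _ I f)
    ((map_le_hitSum h0 hR0 hself hsymm hc hc' h I f).2 hI)

end Layers

end MTBeyond

noncomputable section
namespace MTBeyond

/-! ## Potentials for resampling algorithms on a finite product space -/

section Potentials

set_option linter.unusedSectionVars false

universe v

/-- Measurable functions with values in `[0, ∞]`. -/
def measurableFunctions (Z : Type*) [MeasurableSpace Z] : AddSubmonoid (Z → ℝ≥0∞) where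
  carrier := {f | Measurable f}
  zero_mem' := measurable_zero
  add_mem' hf hg := Measurable.add hf hg

theorem measurableFunctions_nonneg {Z : Type*} [MeasurableSpace Z] (f : measurableFunctions Z) :
    0 ≤ f :=
  fun _ => zero_le

/-- The indicator function of a measurable set. -/
def indicatorOne {Z : Type*} [MeasurableSpace Z] {D : Set Z} (hD : MeasurableSet D) :
    measurableFunctions Z :=
  ⟨D.indicator 1, measurable_one.indicator hD⟩

variable {κ : Type*} [DecidableEq κ] {X : κ → Type v} [∀ k, MeasurableSpace (X k)]
  {μ : ∀ k, Measure (X k)}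

theorem lmarginal_indicator {s : Finset κ} {B : Set (∀ k, X k)}
    (hB : ∀ x y, (∀ k ∉ s, x k = y k) → (x ∈ B ↔ y ∈ B)) (f : (∀ k, X k) → ℝ≥0∞) :
    lmarginal μ s (B.indicator f) = B.indicator (lmarginal μ s f) := by
  funext x
  have hx : ∀ y, Function.updateFinset x s y ∈ B ↔ x ∈ B := fun y =>
    hB _ _ fun k hk => by simp [Function.updateFinset, hk]
  by_cases h : x ∈ B <;> simp [lmarginal, Set.indicator, hx, h]

variable [∀ k, IsProbabilityMeasure (μ k)]

theorem lmarginal_of_invariant {s : Finset κ} {f : (∀ k, X k) → ℝ≥0∞}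
    (hf : ∀ x y, (∀ k ∉ s, x k = y k) → f x = f y) : lmarginal μ s f = f := by
  funext x
  have hx : ∀ y, f (Function.updateFinset x s y) = f x := fun y =>
    hf _ _ fun k hk => by simp [Function.updateFinset, hk]
  simp [lmarginal, hx]

theorem lmarginal_mul_left {s : Finset κ} {f g : (∀ k, X k) → ℝ≥0∞} (hg : Measurable g)
    (hf : ∀ x y, (∀ k ∉ s, x k = y k) → f x = f y) (x : ∀ k, X k) :
    lmarginal μ s (fun z => f z * g z) x = f x * lmarginal μ s g x := by
  have hx : ∀ y, f (Function.updateFinset x s y) = f x := fun y =>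
    hf _ _ fun k hk => by simp [Function.updateFinset, hk]
  simp only [lmarginal, hx]
  exact lintegral_const_mul _ (hg.comp measurable_updateFinset)

variable [Fintype κ]

theorem lintegral_lmarginal (s : Finset κ) {f : (∀ k, X k) → ℝ≥0∞} (hf : Measurable f) :
    ∫⁻ x, lmarginal μ s f x ∂Measure.pi μ = ∫⁻ x, f x ∂Measure.pi μ :=
  lintegral_eq_of_lmarginal_eq s (hf.lmarginal μ) hf
    (lmarginal_of_invariant fun _ _ h => lmarginal_congr μ f h)

/-- The indicator does not change when averaged over the complement of `s`, so averaging it over `s`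
amounts to averaging over all coordinates. -/
theorem lmarginal_indicator_one {s : Finset κ} {B : Set (∀ k, X k)} (hm : MeasurableSet B)
    (hB : ∀ x y, (∀ k ∈ s, x k = y k) → (x ∈ B ↔ y ∈ B)) (x : ∀ k, X k) :
    lmarginal μ s (B.indicator 1) x = Measure.pi μ B := by
  have h1 : lmarginal μ sᶜ (B.indicator (1 : (∀ k, X k) → ℝ≥0∞)) = B.indicator 1 := by
    rw [lmarginal_indicator fun x y h => hB x y fun k hk => h k (by simpa using hk)]
    congr 1
    exact lmarginal_of_invariant fun _ _ _ => rfl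
  have hm1 : Measurable (B.indicator (1 : (∀ k, X k) → ℝ≥0∞)) := measurable_one.indicator hm
  rw [← h1, ← lmarginal_union μ _ hm1 disjoint_compl_right, Finset.union_compl, lmarginal_univ,
    lintegral_indicator_one hm]

/-- The test reads only coordinates in `s`, and the averaged function ignores them, so the two are
independent. -/
theorem lintegral_indicator_lmarginal {s : Finset κ} {B : Set (∀ k, X k)} (hm : MeasurableSet B)
    (hB : ∀ x y, (∀ k ∈ s, x k = y k) → (x ∈ B ↔ y ∈ B)) {f : (∀ k, X k) → ℝ≥0∞}
    (hf : Measurable f) :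
    ∫⁻ x, B.indicator (lmarginal μ s f) x ∂Measure.pi μ =
      Measure.pi μ B * ∫⁻ x, f x ∂Measure.pi μ := by
  have hm1 : Measurable (B.indicator (1 : (∀ k, X k) → ℝ≥0∞)) := measurable_one.indicator hm
  rw [← lintegral_lmarginal s ((hf.lmarginal μ).indicator hm), ← lintegral_lmarginal s hf,
    ← lintegral_const_mul _ (hf.lmarginal μ)]
  refine lintegral_congr fun x => ?_
  have : B.indicator (lmarginal μ s f) = fun z => lmarginal μ s f z * B.indicator 1 z := by
    funext z
    by_cases h : z ∈ B <;> simp [h]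
  rw [this, lmarginal_mul_left hm1 (fun _ _ h => lmarginal_congr μ f h),
    lmarginal_indicator_one hm hB, mul_comm]

/-! ### Test-and-resample operators and the potentials built from them -/

variable {ι : Type*} [DecidableEq ι] {A : ι → Set (∀ k, X k)}

/-- The operator that tests whether all events in `J` hold and resamples all their variables. -/
def resampleOp (μ : ∀ k, Measure (X k)) [∀ k, IsProbabilityMeasure (μ k)]
    (hA : ∀ i, MeasurableSet (A i)) (S : ι → Finset κ) (J : Finset ι) :
    measurableFunctions (∀ k, X k) →+ measurableFunctions (∀ k, X k) where
  toFun f := ⟨(⋂ i ∈ J, A i).indicator (lmarginal μ (J.biUnion S) f.1),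
    (f.2.lmarginal μ).indicator (J.measurableSet_biInter fun i _ => hA i)⟩
  map_zero' := by
    ext x
    simp [lmarginal, Set.indicator]
  map_add' f g := by
    ext x
    have : lmarginal μ (J.biUnion S) (f.1 + g.1) x =
        lmarginal μ (J.biUnion S) f.1 x + lmarginal μ (J.biUnion S) g.1 x :=
      lintegral_add_left (Measurable.comp f.2 measurable_updateFinset) _
    by_cases h : x ∈ ⋂ i ∈ J, A i <;> simp [Set.indicator, h, this]

variable {hA : ∀ i, MeasurableSet (A i)} {S : ι → Finset κ}

theorem resampleOp_empty (f : measurableFunctions (∀ k, X k)) : resampleOp μ hA S ∅ f = f := by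
  ext x
  simp [resampleOp]

theorem resampleOp_mono (J : Finset ι) {f g : measurableFunctions (∀ k, X k)} (hfg : f ≤ g) :
    resampleOp μ hA S J f ≤ resampleOp μ hA S J g := by
  intro x
  simp only [resampleOp, AddMonoidHom.coe_mk, ZeroHom.coe_mk]
  exact Set.indicator_le_indicator (lmarginal_mono hfg x)

/-- Since the scopes are disjoint, resampling I does not affect the tests for J, so these can be
pulled out of the average. Both commutation hypotheses of the layer sums come from this identity. -/
theorem resampleOp_resampleOp
    (hS : ∀ i x y, (∀ k ∈ S i, x k = y k) → (x ∈ A i ↔ y ∈ A i)) {I J : Finset ι}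
    (hIJ : ∀ i ∈ I, ∀ j ∈ J, Disjoint (S i) (S j)) (f : measurableFunctions (∀ k, X k)) :
    resampleOp μ hA S I (resampleOp μ hA S J f) = resampleOp μ hA S (I ∪ J) f := by
  have hd : Disjoint (I.biUnion S) (J.biUnion S) := by
    simp only [Finset.disjoint_biUnion_left, Finset.disjoint_biUnion_right]
    exact fun j hj i hi => hIJ i hi j hj
  refine Subtype.ext ?_
  simp only [resampleOp, AddMonoidHom.coe_mk, ZeroHom.coe_mk]
  rw [lmarginal_indicator, ← lmarginal_union μ _ f.2 hd, Set.indicator_indicator,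
    Finset.union_biUnion]
  · congr 1
    ext x
    simp only [Set.mem_inter_iff, Set.mem_iInter, Finset.mem_union]
    exact ⟨fun h i hi => hi.elim (h.1 i) (h.2 i), fun h => ⟨fun i hi => h i (Or.inl hi),
      fun i hi => h i (Or.inr hi)⟩⟩
  · intro x y hxy
    simp only [Set.mem_iInter]
    refine forall₂_congr fun j hj => hS j x y fun k hk => hxy k fun hk' => ?_
    exact Finset.disjoint_right.1 hd (Finset.mem_biUnion.2 ⟨j, hj, hk⟩) hk'

/-- Integration over the whole product space. -/
def totalIntegral (μ : ∀ k, Measure (X k)) [∀ k, IsProbabilityMeasure (μ k)] :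
    measurableFunctions (∀ k, X k) →+ ℝ≥0∞ where
  toFun f := ∫⁻ x, f.1 x ∂Measure.pi μ
  map_zero' := by simp
  map_add' f g := lintegral_add_left f.2 _

variable {Γ : ι → Finset ι}

theorem totalIntegral_resampleOp_le
    (hS : ∀ i x y, (∀ k ∈ S i, x k = y k) → (x ∈ A i ↔ y ∈ A i))
    (hΓ : ∀ i j, j ∉ Γ i → Disjoint (S i) (S j)) {P : ℝ≥0∞} (hP : ∀ i, Measure.pi μ (A i) ≤ P)
    (J : Finset ι) (f : measurableFunctions (∀ k, X k))
    (hJ : ∀ a ∈ J, ∀ b ∈ J, a ≠ b → b ∉ Γ a) :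
    totalIntegral μ (resampleOp μ hA S J f) ≤ P ^ J.card * totalIntegral μ f := by
  induction J using Finset.induction_on with
  | empty => simp [resampleOp_empty]
  | insert i J hi ih =>
    have h1 : resampleOp μ hA S (insert i J) f =
        resampleOp μ hA S {i} (resampleOp μ hA S J f) := by
      rw [resampleOp_resampleOp hS, Finset.insert_eq]
      intro a ha j hj
      rw [Finset.mem_singleton] at ha
      subst ha
      refine hΓ a j (hJ a (Finset.mem_insert_self _ _) j (Finset.mem_insert_of_mem hj) ?_)
      rintro rfl
      exact hi hj
    have h2 : totalIntegral μ (resampleOp μ hA S {i} (resampleOp μ hA S J f)) =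
        Measure.pi μ (A i) * totalIntegral μ (resampleOp μ hA S J f) := by
      have := lintegral_indicator_lmarginal (μ := μ) (hA i) (hS i) (resampleOp μ hA S J f).2
      simpa [totalIntegral, resampleOp] using this
    rw [h1, h2, Finset.card_insert_of_notMem hi, pow_succ', mul_assoc]
    exact mul_le_mul' (hP i) (ih fun a ha b hb => hJ a (Finset.mem_insert_of_mem ha) b
      (Finset.mem_insert_of_mem hb))

/-- The potential that controls how often the event `D`, with the same scope as `A i`, is seen
by an algorithm which resamples the events `A k` that hold. -/
def potential (μ : ∀ k, Measure (X k)) [∀ k, IsProbabilityMeasure (μ k)]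
    (hA : ∀ i, MeasurableSet (A i)) (S : ι → Finset κ) (Γ : ι → Finset ι) (i : ι)
    {D : Set (∀ k, X k)} (hD : MeasurableSet D) (x : ∀ k, X k) : ℝ≥0∞ :=
  ⨆ h, (allSum Γ (resampleOp μ hA S) h {i} (indicatorOne hD)).1 x

variable {D : Set (∀ k, X k)} {hD : MeasurableSet D}

theorem measurable_potential (i : ι) : Measurable (potential μ hA S Γ i hD) :=
  Measurable.iSup fun h => (allSum Γ (resampleOp μ hA S) h {i} _).2

theorem monotone_allSum (I : Finset ι) (f : measurableFunctions (∀ k, X k)) :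
    Monotone fun h => (allSum Γ (resampleOp μ hA S) h I f).1 :=
  monotone_nat_of_le_succ fun h => allSum_le_succ measurableFunctions_nonneg resampleOp_empty h I f

theorem indicator_le_potential (i : ι) (x : ∀ k, X k) :
    D.indicator 1 x ≤ potential μ hA S Γ i hD x :=
  le_iSup (fun h => (allSum Γ (resampleOp μ hA S) h {i} (indicatorOne hD)).1 x) 0

theorem lintegral_potential_le
    (hS : ∀ i x y, (∀ k ∈ S i, x k = y k) → (x ∈ A i ↔ y ∈ A i))
    (hΓ : ∀ i j, j ∉ Γ i → Disjoint (S i) (S j)) {P y : ℝ≥0∞} {d : ℕ}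
    (hP : ∀ i, Measure.pi μ (A i) ≤ P) (hd : ∀ i, (Γ i).card ≤ d) (hy : P * (1 + y) ^ d ≤ y)
    (i : ι) :
    ∫⁻ x, potential μ hA S Γ i hD x ∂Measure.pi μ ≤ Measure.pi μ D * (1 + y) ^ d := by
  unfold potential
  rw [lintegral_iSup (fun h => (allSum Γ (resampleOp μ hA S) h {i} _).2)
    (monotone_allSum _ _)]
  refine iSup_le fun h => ?_
  have := functional_allSum_le (E := totalIntegral μ) (R := resampleOp μ hA S) (Γ := Γ)
    (fun J f hJ => totalIntegral_resampleOp_le hS hΓ hP J f hJ) hd hy h {i}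
    (indicatorOne hD)
  simpa [totalIntegral, indicatorOne, lintegral_indicator_one hD] using this

theorem lmarginal_potential (s : Finset κ) (i : ι) (x : ∀ k, X k) :
    lmarginal μ s (potential μ hA S Γ i hD) x =
      ⨆ h, lmarginal μ s (allSum Γ (resampleOp μ hA S) h {i}
        (indicatorOne hD)).1 x := by
  refine lintegral_iSup (fun h => Measurable.comp (allSum Γ (resampleOp μ hA S) h {i} _).2
    measurable_updateFinset) ?_
  intro a b hab y
  exact monotone_allSum _ _ hab _

theorem resampleOp_singleton_apply {k : ι} {x : ∀ k, X k} (hx : x ∈ A k)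
    (f : measurableFunctions (∀ k, X k)) :
    (resampleOp μ hA S {k} f).1 x = lmarginal μ (S k) f.1 x := by
  simp [resampleOp, hx]

/-- On `A k`, averaging over the scope of k is the operator of k, so `map_allSum_le` applies with
one more layer, and the supremum over h absorbs the shift. If k is not a neighbour of i, resampling
k leaves D untouched, which is the condition on `f` there. -/
theorem lmarginal_potential_le
    (hS : ∀ i x y, (∀ k ∈ S i, x k = y k) → (x ∈ A i ↔ y ∈ A i))
    (hΓ : ∀ i j, j ∉ Γ i → Disjoint (S i) (S j))
    (hself : ∀ i, i ∈ Γ i) (hsymm : ∀ i j, i ∈ Γ j → j ∈ Γ i) {i k : ι}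
    (hDS : ∀ x y, (∀ k ∈ S i, x k = y k) → (x ∈ D ↔ y ∈ D)) {x : ∀ k, X k} (hx : x ∈ A k) :
    lmarginal μ (S k) (potential μ hA S Γ i hD) x ≤ potential μ hA S Γ i hD x := by
  rw [lmarginal_potential]
  refine iSup_le fun h => ?_
  rw [← resampleOp_singleton_apply (hA := hA) (S := S) hx]
  refine le_trans ?_ (le_iSup (fun h => (allSum Γ (resampleOp μ hA S) h {i} (indicatorOne hD)).1 x)
    (h + 1))
  refine map_allSum_le measurableFunctions_nonneg resampleOp_empty (fun J _ _ => resampleOp_mono J)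
    hself hsymm ?_ ?_ h {i} _ ?_ x
  · intro J f hJ
    rw [resampleOp_resampleOp hS, Finset.insert_eq]
    intro a ha j hj
    rw [Finset.mem_singleton] at ha
    subst ha
    exact hΓ _ _ (Finset.disjoint_left.1 hJ hj)
  · intro J f hJ
    rw [resampleOp_resampleOp hS, Finset.insert_eq, Finset.union_comm]
    intro j hj a ha
    rw [Finset.mem_singleton] at ha
    subst ha
    exact (hΓ _ _ (Finset.disjoint_left.1 hJ hj)).symm
  · intro hik z
    simp only [resampleOp, indicatorOne, AddMonoidHom.coe_mk, ZeroHom.coe_mk,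
      Finset.singleton_biUnion]
    rw [lmarginal_of_invariant]
    · exact Set.indicator_le_self _ _ z
    · intro x y hxy
      have hki : Disjoint (S k) (S i) := hΓ k i (Finset.disjoint_singleton_left.1 hik)
      have := hDS x y fun l hl => hxy l fun hl' => Finset.disjoint_left.1 hki hl' hl
      by_cases hxD : x ∈ D
      · simp [hxD, this.1 hxD]
      · have hyD : y ∉ D := fun hy => hxD (this.2 hy)
        simp [hxD, hyD]

theorem one_add_lmarginal_potential_le
    (hS : ∀ i x y, (∀ k ∈ S i, x k = y k) → (x ∈ A i ↔ y ∈ A i))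
    (hΓ : ∀ i j, j ∉ Γ i → Disjoint (S i) (S j))
    (hself : ∀ i, i ∈ Γ i) (hsymm : ∀ i j, i ∈ Γ j → j ∈ Γ i) {k : ι}
    {x : ∀ k, X k} (hx : x ∈ A k) :
    1 + lmarginal μ (S k) (potential μ hA S Γ k (hA k)) x ≤ potential μ hA S Γ k (hA k) x := by
  rw [lmarginal_potential, ENNReal.add_iSup]
  refine iSup_le fun h => ?_
  rw [← resampleOp_singleton_apply (hA := hA) (S := S) hx]
  refine le_trans ?_ (le_iSup (fun h => (allSum Γ (resampleOp μ hA S) h {k} (indicatorOne (hA k))).1 x)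
    (h + 1))
  have := add_map_allSum_le (Γ := Γ) (R := resampleOp μ hA S) (i := k) measurableFunctions_nonneg
    resampleOp_empty hself hsymm ?_ ?_ h {k} (indicatorOne (hA k)) (by simp [hself]) x
  · simpa [indicatorOne, hx] using this
  · intro J f hJ
    rw [resampleOp_resampleOp hS, Finset.insert_eq]
    intro a ha j hj
    rw [Finset.mem_singleton] at ha
    subst ha
    exact hΓ _ _ (Finset.disjoint_left.1 hJ hj)
  · intro J f hJ
    rw [resampleOp_resampleOp hS, Finset.insert_eq, Finset.union_comm]
    intro j hj a ha
    rw [Finset.mem_singleton] at ha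
    subst ha
    exact (hΓ _ _ (Finset.disjoint_left.1 hJ hj)).symm

variable [Fintype ι]

/-- A potential for the number of resampling steps. -/
theorem exists_resampling_potential (hA : ∀ i, MeasurableSet (A i))
    (hS : ∀ i x y, (∀ k ∈ S i, x k = y k) → (x ∈ A i ↔ y ∈ A i))
    (hΓ : ∀ i j, j ∉ Γ i → Disjoint (S i) (S j))
    (hself : ∀ i, i ∈ Γ i) (hsymm : ∀ i j, i ∈ Γ j → j ∈ Γ i) {P y : ℝ≥0∞} {d : ℕ}
    (hP : ∀ i, Measure.pi μ (A i) ≤ P) (hd : ∀ i, (Γ i).card ≤ d) (hy : P * (1 + y) ^ d ≤ y) :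
    ∃ V : (∀ k, X k) → ℝ≥0∞, Measurable V ∧
      (∀ k, ∀ x ∈ A k, 1 + lmarginal μ (S k) V x ≤ V x) ∧
      ∫⁻ x, V x ∂Measure.pi μ ≤ Fintype.card ι * y := by
  refine ⟨fun x => ∑ i, potential μ hA S Γ i (hA i) x,
    Finset.measurable_sum _ fun i _ => measurable_potential i, fun k x hx => ?_, ?_⟩
  · have h1 : lmarginal μ (S k) (fun x => ∑ i, potential μ hA S Γ i (hA i) x) x =
        ∑ i, lmarginal μ (S k) (potential μ hA S Γ i (hA i)) x :=
      lintegral_finsetSum _ fun i _ => (measurable_potential i).comp measurable_updateFinset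
    beta_reduce
    rw [h1, ← Finset.add_sum_erase _ _ (Finset.mem_univ k), ← add_assoc,
      ← Finset.add_sum_erase _ (fun i => potential μ hA S Γ i (hA i) x) (Finset.mem_univ k)]
    exact add_le_add (one_add_lmarginal_potential_le hS hΓ hself hsymm hx)
      (Finset.sum_le_sum fun i _ => lmarginal_potential_le hS hΓ hself hsymm (hS i) hx)
  · rw [lintegral_finsetSum _ fun i _ => measurable_potential i]
    -- Here D is `A i` itself, so its measure is at most P and the bound P (1+y)^d collapses to y.
    calc ∑ i, ∫⁻ x, potential μ hA S Γ i (hA i) x ∂Measure.pi μ ≤ ∑ _i : ι, y := by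
          refine Finset.sum_le_sum fun i _ =>
            (lintegral_potential_le hS hΓ hP hd hy i).trans (le_trans ?_ hy)
          gcongr
          exact hP i
      _ = Fintype.card ι * y := by simp

/-- A potential for the number of the events `B i` that hold in the end. -/
theorem exists_output_potential (hA : ∀ i, MeasurableSet (A i))
    (hS : ∀ i x y, (∀ k ∈ S i, x k = y k) → (x ∈ A i ↔ y ∈ A i))
    (hΓ : ∀ i j, j ∉ Γ i → Disjoint (S i) (S j))
    (hself : ∀ i, i ∈ Γ i) (hsymm : ∀ i j, i ∈ Γ j → j ∈ Γ i) {P y : ℝ≥0∞} {d : ℕ}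
    (hP : ∀ i, Measure.pi μ (A i) ≤ P) (hd : ∀ i, (Γ i).card ≤ d) (hy : P * (1 + y) ^ d ≤ y)
    {B : ι → Set (∀ k, X k)} (hB : ∀ i, MeasurableSet (B i))
    (hBS : ∀ i x y, (∀ k ∈ S i, x k = y k) → (x ∈ B i ↔ y ∈ B i)) {Q : ℝ≥0∞}
    (hQ : ∀ i, Measure.pi μ (B i) ≤ Q) :
    ∃ W : (∀ k, X k) → ℝ≥0∞, Measurable W ∧
      (∀ k, ∀ x ∈ A k, lmarginal μ (S k) W x ≤ W x) ∧
      (∀ x, ∑ i, (B i).indicator 1 x ≤ W x) ∧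
      ∫⁻ x, W x ∂Measure.pi μ ≤ Fintype.card ι * (Q * (1 + y) ^ d) := by
  refine ⟨fun x => ∑ i, potential μ hA S Γ i (hB i) x,
    Finset.measurable_sum _ fun i _ => measurable_potential i, fun k x hx => ?_,
    fun x => Finset.sum_le_sum fun i _ => indicator_le_potential i x, ?_⟩
  · have h1 : lmarginal μ (S k) (fun x => ∑ i, potential μ hA S Γ i (hB i) x) x =
        ∑ i, lmarginal μ (S k) (potential μ hA S Γ i (hB i)) x :=
      lintegral_finsetSum _ fun i _ => (measurable_potential i).comp measurable_updateFinset
    rw [h1]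
    exact Finset.sum_le_sum fun i _ => lmarginal_potential_le hS hΓ hself hsymm (hBS i) hx
  · rw [lintegral_finsetSum _ fun i _ => measurable_potential i]
    calc ∑ i, ∫⁻ x, potential μ hA S Γ i (hB i) x ∂Measure.pi μ
        ≤ ∑ _i : ι, Q * (1 + y) ^ d := by
          refine Finset.sum_le_sum fun i _ => (lintegral_potential_le hS hΓ hP hd hy i).trans ?_
          gcongr
          exact hQ i
      _ = Fintype.card ι * (Q * (1 + y) ^ d) := by simp

end Potentials

end MTBeyond
end

noncomputable section
namespace MTBeyond

/-! ## Measurability of the execution of programs -/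

section Execution

set_option linter.unusedSectionVars false

universe u

/-- An injective coding of instructions. -/
def Instr.code : Instr → List ℕ
  | .const x k => [0, x, k]
  | .copy x y => [1, x, y]
  | .add x y z => [2, x, y, z]
  | .sub x y z => [3, x, y, z]
  | .load x y => [4, x, y]
  | .store x y => [5, x, y]
  | .rand x y => [6, x, y]
  | .depends x y z => [7, x, y, z]
  | .verify x y => [8, x, y]
  | .resample x => [9, x]

theorem Instr.code_injective : Function.Injective Instr.code := by
  intro a b h
  cases a <;> cases b <;> simp_all [Instr.code]

/-- An injective coding of programs. -/
def Cmd.code : Cmd → ℕ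
  | .basic c => Nat.pair 0 (Encodable.encode c.code)
  | .seq c₁ c₂ => Nat.pair 1 (Nat.pair c₁.code c₂.code)
  | .ite x c₁ c₂ => Nat.pair 2 (Nat.pair x (Nat.pair c₁.code c₂.code))
  | .loop x c => Nat.pair 3 (Nat.pair x c.code)

theorem Cmd.code_injective : Function.Injective Cmd.code := by
  intro a
  induction a with
  | basic c =>
    intro b h
    cases b <;> simp [Cmd.code, Nat.pair_eq_pair] at h ⊢
    exact Instr.code_injective h
  | seq c₁ c₂ h₁ h₂ =>
    intro b h
    cases b <;> simp [Cmd.code, Nat.pair_eq_pair] at h ⊢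
    exact ⟨h₁ h.1, h₂ h.2⟩
  | ite x c₁ c₂ h₁ h₂ =>
    intro b h
    cases b <;> simp [Cmd.code, Nat.pair_eq_pair] at h ⊢
    exact ⟨h.1, h₁ h.2.1, h₂ h.2.2⟩
  | loop x c h₁ =>
    intro b h
    cases b <;> simp [Cmd.code, Nat.pair_eq_pair] at h ⊢
    exact ⟨h.1, h₁ h.2⟩

/-- Because there are only countably many to-do lists, they may carry the discrete σ-algebra, and
measurability in a configuration can be checked for one list at a time (`measurable_of_todo`). -/
instance Cmd.countable : Countable Cmd := Cmd.code_injective.countable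

instance Cmd.measurableSpaceList : MeasurableSpace (List Cmd) := ⊤

variable {n m : ℕ} {Ω : Fin n → Type u}

/-- The components of a configuration. -/
def Config.toTriple (c : Config Ω) : List Cmd × (ℕ → ℕ) × (∀ j, Ω j) := (c.todo, c.mem, c.asg)

variable [∀ j, MeasurableSpace (Ω j)]

instance Config.measurableSpace : MeasurableSpace (Config Ω) :=
  MeasurableSpace.comap Config.toTriple inferInstance

theorem measurable_config_mk (K : List Cmd) {Z : Type*} [MeasurableSpace Z]
    {f : Z → ℕ → ℕ} {g : Z → ∀ j, Ω j} (hf : Measurable f) (hg : Measurable g) :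
    Measurable fun z => (⟨K, f z, g z⟩ : Config Ω) :=
  measurable_comap_iff.2 (measurable_const.prodMk (hf.prodMk hg))

theorem measurable_of_todo {Z Y : Type*} [MeasurableSpace Z] [MeasurableSpace Y]
    {f : Config Ω → Z → Y}
    (hf : ∀ K, Measurable fun q : ((ℕ → ℕ) × ∀ j, Ω j) × Z => f ⟨K, q.1.1, q.1.2⟩ q.2) :
    Measurable fun q : Config Ω × Z => f q.1 q.2 := by
  have h1 : Measurable fun q : List Cmd × ((ℕ → ℕ) × ∀ j, Ω j) × Z =>
      f ⟨q.1, q.2.1.1, q.2.1.2⟩ q.2.2 := measurable_from_prod_countable_right hf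
  have h2 : Measurable (Config.toTriple (Ω := Ω)) := comap_measurable _
  exact h1.comp ((measurable_fst.comp (h2.comp measurable_fst)).prodMk
    ((measurable_snd.comp (h2.comp measurable_fst)).prodMk measurable_snd))

theorem measurable_nat_comp {Z Y : Type*} [MeasurableSpace Z] [MeasurableSpace Y]
    {f g : Z → ℕ} (hf : Measurable f) (hg : Measurable g) (F : ℕ → ℕ → Y) :
    Measurable fun z => F (f z) (g z) :=
  (Measurable.of_discrete (f := fun q : ℕ × ℕ => F q.1 q.2)).comp (hf.prodMk hg)

theorem measurable_eval_nat {Z : Type*} [MeasurableSpace Z] {f : Z → ℕ → ℕ} {g : Z → ℕ}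
    (hf : Measurable f) (hg : Measurable g) : Measurable fun z => f z (g z) := by
  have h : Measurable fun q : ℕ × (ℕ → ℕ) => q.2 q.1 :=
    measurable_from_prod_countable_right fun k => measurable_pi_apply k
  exact h.comp (hg.prodMk hf)

theorem measurable_update_nat {Z : Type*} [MeasurableSpace Z] {f : Z → ℕ → ℕ} {g v : Z → ℕ}
    (hf : Measurable f) (hg : Measurable g) (hv : Measurable v) :
    Measurable fun z => Function.update (f z) (g z) (v z) := by
  refine measurable_pi_iff.2 fun k => ?_
  simp only [Function.update_apply]
  exact Measurable.ite (measurableSet_eq_fun measurable_const hg) hv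
    ((measurable_pi_apply k).comp hf)

theorem measurable_newMem {A : Fin m → Set (∀ j, Ω j)} (hA : ∀ i, MeasurableSet (A i))
    (c : Instr) :
    Measurable fun q : ((ℕ → ℕ) × ∀ j, Ω j) × Fresh Ω => c.newMem A q.2 q.1.1 q.1.2 := by
  have hM : Measurable fun q : ((ℕ → ℕ) × ∀ j, Ω j) × Fresh Ω => q.1.1 :=
    measurable_fst.comp measurable_fst
  have hMx : ∀ x, Measurable fun q : ((ℕ → ℕ) × ∀ j, Ω j) × Fresh Ω => q.1.1 x := fun x =>
    (measurable_pi_apply x).comp hM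
  cases c with
  | const x k => exact measurable_update_nat hM measurable_const measurable_const
  | copy x y => exact measurable_update_nat hM measurable_const (hMx y)
  | add x y z => exact measurable_update_nat hM measurable_const ((hMx y).add (hMx z))
  | sub x y z =>
    exact measurable_update_nat hM measurable_const
      (measurable_nat_comp (hMx y) (hMx z) fun a b => a - b)
  | load x y =>
    exact measurable_update_nat hM measurable_const (measurable_eval_nat hM (hMx y))
  | store x y => exact measurable_update_nat hM (hMx x) (hMx y)
  | rand x y =>
    refine measurable_update_nat hM measurable_const ?_
    have h1 : Measurable fun q : ((ℕ → ℕ) × ∀ j, Ω j) × Fresh Ω =>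
        ⌊((q.2.1 : unitInterval) : ℝ) * (q.1.1 y : ℝ)⌋₊ :=
      Nat.measurable_floor.comp ((measurable_subtype_coe.comp
        (measurable_fst.comp measurable_snd)).mul (Measurable.of_discrete.comp (hMx y)))
    exact measurable_nat_comp h1 (hMx y) fun a b => min a (b - 1)
  | depends x y z =>
    classical
    refine measurable_update_nat hM measurable_const ?_
    exact measurable_nat_comp (hMx y) (hMx z) fun a b =>
      if ∃ (hi : a < m) (hj : b < n), (⟨b, hj⟩ : Fin n) ∈ vbl (A ⟨a, hi⟩) then 1 else 0
  | verify x y =>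
    refine measurable_update_nat hM measurable_const ?_
    refine Measurable.ite ?_ measurable_const measurable_const
    have : {q : ((ℕ → ℕ) × ∀ j, Ω j) × Fresh Ω | ∃ hi : q.1.1 y < m, q.1.2 ∈ A ⟨q.1.1 y, hi⟩} =
        ⋃ i : Fin m, {q | q.1.1 y = (i : ℕ)} ∩ {q | q.1.2 ∈ A i} := by
      ext q
      simp only [Set.mem_ofPred_eq, Set.mem_iUnion, Set.mem_inter_iff]
      constructor
      · rintro ⟨hi, h⟩
        exact ⟨⟨_, hi⟩, rfl, h⟩
      · rintro ⟨i, h1, h2⟩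
        have hi : q.1.1 y < m := h1 ▸ i.2
        have h3 : (⟨q.1.1 y, hi⟩ : Fin m) = i := Fin.ext h1
        exact ⟨hi, h3 ▸ h2⟩
    rw [this]
    exact MeasurableSet.iUnion fun i => (measurableSet_eq_fun (hMx y) measurable_const).inter
      ((measurable_snd.comp measurable_fst) (hA i))
  | resample x => exact hM

theorem measurable_newAsg (c : Instr) :
    Measurable fun q : ((ℕ → ℕ) × ∀ j, Ω j) × Fresh Ω => c.newAsg q.2 q.1.1 q.1.2 := by
  have hσ : Measurable fun q : ((ℕ → ℕ) × ∀ j, Ω j) × Fresh Ω => q.1.2 :=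
    measurable_snd.comp measurable_fst
  cases c with
  | resample x =>
    refine measurable_pi_iff.2 fun j => ?_
    have : (fun q : ((ℕ → ℕ) × ∀ j, Ω j) × Fresh Ω => (Instr.resample x).newAsg q.2 q.1.1 q.1.2 j) =
        fun q => if q.1.1 x = (j : ℕ) then q.2.2 j else q.1.2 j := by
      funext q
      by_cases hx : q.1.1 x < n
      · by_cases hj : (⟨q.1.1 x, hx⟩ : Fin n) = j
        · subst hj
          simp [Instr.newAsg, hx]
        · have hj' : q.1.1 x ≠ j := fun h => hj (Fin.ext h)
          simp [Instr.newAsg, hx, Function.update_of_ne (Ne.symm hj), hj']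
      · have hj' : q.1.1 x ≠ j := fun h => hx (h ▸ j.2)
        simp [Instr.newAsg, hx, hj']
    rw [this]
    refine Measurable.ite (measurableSet_eq_fun ?_ measurable_const) ?_ ?_
    · exact (measurable_pi_apply x).comp (measurable_fst.comp measurable_fst)
    · exact (measurable_pi_apply j).comp (measurable_snd.comp measurable_snd)
    · exact (measurable_pi_apply j).comp hσ
  | const x k => exact hσ
  | copy x y => exact hσ
  | add x y z => exact hσ
  | sub x y z => exact hσ
  | load x y => exact hσ
  | store x y => exact hσ
  | rand x y => exact hσ
  | depends x y z => exact hσ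
  | verify x y => exact hσ

theorem measurable_step {A : Fin m → Set (∀ j, Ω j)} (hA : ∀ i, MeasurableSet (A i)) :
    Measurable fun q : Config Ω × Fresh Ω => step A q.2 q.1 := by
  refine measurable_of_todo (f := fun c r => step A r c) fun K => ?_
  have hM : Measurable fun q : ((ℕ → ℕ) × ∀ j, Ω j) × Fresh Ω => q.1.1 :=
    measurable_fst.comp measurable_fst
  have hσ : Measurable fun q : ((ℕ → ℕ) × ∀ j, Ω j) × Fresh Ω => q.1.2 :=
    measurable_snd.comp measurable_fst
  have hx : ∀ x, MeasurableSet {q : ((ℕ → ℕ) × ∀ j, Ω j) × Fresh Ω | q.1.1 x ≠ 0} := fun x =>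
    (measurableSet_eq_fun ((measurable_pi_apply x).comp hM) measurable_const).compl
  match K with
  | [] => exact measurable_config_mk _ hM hσ
  | .basic c :: K => exact measurable_config_mk _ (measurable_newMem hA c) (measurable_newAsg c)
  | .seq c₁ c₂ :: K => exact measurable_config_mk _ hM hσ
  | .ite x c₁ c₂ :: K =>
    have h : (fun q : ((ℕ → ℕ) × ∀ j, Ω j) × Fresh Ω =>
        step A q.2 (⟨.ite x c₁ c₂ :: K, q.1.1, q.1.2⟩ : Config Ω)) =
        fun q => if q.1.1 x ≠ 0 then ⟨c₁ :: K, q.1.1, q.1.2⟩ else ⟨c₂ :: K, q.1.1, q.1.2⟩ := by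
      funext q
      simp only [step]
      split_ifs <;> rfl
    rw [h]
    exact Measurable.ite (hx x) (measurable_config_mk _ hM hσ) (measurable_config_mk _ hM hσ)
  | .loop x c :: K =>
    have h : (fun q : ((ℕ → ℕ) × ∀ j, Ω j) × Fresh Ω =>
        step A q.2 (⟨.loop x c :: K, q.1.1, q.1.2⟩ : Config Ω)) =
        fun q => if q.1.1 x ≠ 0 then ⟨c :: .loop x c :: K, q.1.1, q.1.2⟩
          else ⟨K, q.1.1, q.1.2⟩ := by
      funext q
      simp only [step]
      split_ifs <;> rfl
    rw [h]
    exact Measurable.ite (hx x) (measurable_config_mk _ hM hσ) (measurable_config_mk _ hM hσ)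

/-! ## Expected cost of the first steps -/

/-- The execution started from an arbitrary configuration. -/
def runFrom (A : Fin m → Set (∀ j, Ω j)) (c : Config Ω) (ω : ℕ → Fresh Ω) : ℕ → Config Ω
  | 0 => c
  | t + 1 => step A (ω t) (runFrom A c ω t)

theorem run_eq_runFrom (c : Cmd) (A : Fin m → Set (∀ j, Ω j)) (q : ℕ) (σ₀ : ∀ j, Ω j)
    (ω : ℕ → Fresh Ω) (t : ℕ) :
    run c A q σ₀ ω t = runFrom A ⟨[c], initMem n m q, σ₀⟩ ω t := by
  induction t with
  | zero => rfl
  | succ t ih => rw [run, runFrom, ih]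

theorem runFrom_succ (A : Fin m → Set (∀ j, Ω j)) (c : Config Ω) (ω : ℕ → Fresh Ω) (t : ℕ) :
    runFrom A c ω (t + 1) = runFrom A (step A (ω 0) c) (fun s => ω (s + 1)) t := by
  induction t with
  | zero => rfl
  | succ t ih => rw [runFrom, ih, runFrom]

theorem step_of_todo_nil (A : Fin m → Set (∀ j, Ω j)) (r : Fresh Ω) {c : Config Ω}
    (h : c.todo = []) : step A r c = c := by
  obtain ⟨K, M, σ⟩ := c
  obtain rfl : K = [] := h
  rfl

theorem runFrom_of_todo_nil (A : Fin m → Set (∀ j, Ω j)) (ω : ℕ → Fresh Ω) {c : Config Ω} {s t : ℕ}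
    (hst : s ≤ t) (h : (runFrom A c ω s).todo = []) : runFrom A c ω t = runFrom A c ω s := by
  induction t, hst using Nat.le_induction with
  | base => rfl
  | succ t _ ih => rw [runFrom, ih, step_of_todo_nil A _ h]

theorem measurable_runFrom {A : Fin m → Set (∀ j, Ω j)} (hA : ∀ i, MeasurableSet (A i))
    (c : Config Ω) (t : ℕ) : Measurable fun ω => runFrom A c ω t := by
  induction t with
  | zero => exact measurable_const
  | succ t ih => exact (measurable_step hA).comp (ih.prodMk (measurable_pi_apply t))

/-- `w` for each unfinished step, and `0` after halting. -/
def aliveCost (w : ℝ≥0∞) : Config Ω → ℝ≥0∞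
  | ⟨[], _, _⟩ => 0
  | ⟨_ :: _, _, _⟩ => w

/-- The value of `χ` in a halted configuration. -/
def haltValue (χ : (ℕ → ℕ) → (∀ j, Ω j) → ℝ≥0∞) : Config Ω → ℝ≥0∞
  | ⟨[], M, σ⟩ => χ M σ
  | ⟨_ :: _, _, _⟩ => 0

theorem measurable_aliveCost (w : ℝ≥0∞) : Measurable (aliveCost (Ω := Ω) w) := by
  have h := measurable_of_todo (Ω := Ω) (Z := Unit) (f := fun c _ => aliveCost w c) fun K => by
    cases K <;> exact measurable_const
  exact h.comp (measurable_id.prodMk (measurable_const (a := ())))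

theorem measurable_haltValue {χ : (ℕ → ℕ) → (∀ j, Ω j) → ℝ≥0∞}
    (hχ : Measurable fun q : (ℕ → ℕ) × ∀ j, Ω j => χ q.1 q.2) : Measurable (haltValue χ) := by
  have h := measurable_of_todo (Ω := Ω) (Z := Unit) (f := fun c _ => haltValue χ c) fun K => by
    cases K
    · exact hχ.comp measurable_fst
    · exact measurable_const
  exact h.comp (measurable_id.prodMk (measurable_const (a := ())))

/-- Cost `w` for every step made up to time `h`, plus the value of `χ` if the execution has halted
by then. -/
def partialCost (A : Fin m → Set (∀ j, Ω j)) (w : ℝ≥0∞) (χ : (ℕ → ℕ) → (∀ j, Ω j) → ℝ≥0∞) (h : ℕ)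
    (c : Config Ω) (ω : ℕ → Fresh Ω) : ℝ≥0∞ :=
  (∑ t ∈ Finset.range h, aliveCost w (runFrom A c ω t)) + haltValue χ (runFrom A c ω h)

theorem measurable_partialCost {A : Fin m → Set (∀ j, Ω j)} (hA : ∀ i, MeasurableSet (A i))
    (w : ℝ≥0∞) {χ : (ℕ → ℕ) → (∀ j, Ω j) → ℝ≥0∞}
    (hχ : Measurable fun q : (ℕ → ℕ) × ∀ j, Ω j => χ q.1 q.2) (h : ℕ) (c : Config Ω) :
    Measurable (partialCost A w χ h c) :=
  (Finset.measurable_sum _ fun t _ => (measurable_aliveCost w).comp (measurable_runFrom hA c t)).add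
    ((measurable_haltValue hχ).comp (measurable_runFrom hA c h))

theorem partialCost_nil (A : Fin m → Set (∀ j, Ω j)) (w : ℝ≥0∞)
    (χ : (ℕ → ℕ) → (∀ j, Ω j) → ℝ≥0∞) (h : ℕ) (M : ℕ → ℕ) (σ : ∀ j, Ω j) (ω : ℕ → Fresh Ω) :
    partialCost A w χ h ⟨[], M, σ⟩ ω = χ M σ := by
  have : ∀ t, runFrom A ⟨[], M, σ⟩ ω t = ⟨[], M, σ⟩ := fun t =>
    runFrom_of_todo_nil A ω (Nat.zero_le t) rfl
  simp [partialCost, this, aliveCost, haltValue]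

theorem partialCost_succ (A : Fin m → Set (∀ j, Ω j)) (w : ℝ≥0∞)
    (χ : (ℕ → ℕ) → (∀ j, Ω j) → ℝ≥0∞) (h : ℕ) (c : Config Ω) (ω : ℕ → Fresh Ω) :
    partialCost A w χ (h + 1) c ω =
      aliveCost w c + partialCost A w χ h (step A (ω 0) c) fun s => ω (s + 1) := by
  simp only [partialCost, Finset.sum_range_succ', runFrom_succ]
  simp only [runFrom]
  ring

variable {μ : ∀ j, Measure (Ω j)} [∀ j, IsProbabilityMeasure (μ j)]

/-- The law of the randomness of one step. -/
def freshLaw (μ : ∀ j, Measure (Ω j)) : Measure (Fresh Ω) :=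
  (volume : Measure unitInterval).prod (Measure.pi μ)

instance freshLaw.isProbabilityMeasure : IsProbabilityMeasure (freshLaw μ) := by
  unfold freshLaw
  infer_instance

/-- Prepending an independent sample to a random tape gives a tape with the same law; this lets the
first step of an execution be split off by Fubini. -/
theorem map_cons_infinitePi {Z : Type*} [MeasurableSpace Z] (ν : Measure Z)
    [IsProbabilityMeasure ν] :
    (ν.prod (Measure.infinitePi fun _ : ℕ => ν)).map
      (fun q : Z × (ℕ → Z) => fun t : ℕ => Nat.casesOn t q.1 q.2) =
      Measure.infinitePi fun _ : ℕ => ν := by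
  have hmeas : Measurable
      (fun q : Z × (ℕ → Z) => fun t : ℕ => (Nat.casesOn t q.1 q.2 : Z)) := by
    refine measurable_pi_iff.2 fun t => ?_
    cases t with
    | zero => exact measurable_fst
    | succ t => exact (measurable_pi_apply t).comp measurable_snd
  refine Measure.eq_infinitePi _ fun s B hB => ?_
  rw [Measure.map_apply hmeas (MeasurableSet.pi s.countable_toSet fun i _ => hB i)]
  -- Boxes over an initial segment split into a first side and a shifted box. A box over any finite
  -- set becomes such a box by adding full sides.
  have key : ∀ B : ℕ → Set Z, (∀ i, MeasurableSet (B i)) → ∀ N : ℕ,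
      (ν.prod (Measure.infinitePi fun _ : ℕ => ν))
        ((fun q : Z × (ℕ → Z) => fun t : ℕ => (Nat.casesOn t q.1 q.2 : Z)) ⁻¹'
          ((Finset.range (N + 1) : Finset ℕ) : Set ℕ).pi B) =
        ∏ i ∈ Finset.range (N + 1), ν (B i) := by
    intro B hB N
    have : ((fun q : Z × (ℕ → Z) => fun t : ℕ => (Nat.casesOn t q.1 q.2 : Z)) ⁻¹'
          ((Finset.range (N + 1) : Finset ℕ) : Set ℕ).pi B) =
        B 0 ×ˢ ((Finset.range N : Finset ℕ) : Set ℕ).pi fun i => B (i + 1) := by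
      ext q
      simp only [Set.mem_preimage, Set.mem_pi, Set.mem_prod, Finset.coe_range, Set.mem_Iio]
      constructor
      · intro h
        exact ⟨h 0 (Nat.succ_pos _), fun i hi => h (i + 1) (Nat.succ_lt_succ hi)⟩
      · rintro ⟨h0, h1⟩ i hi
        cases i with
        | zero => exact h0
        | succ i => exact h1 i (Nat.lt_of_succ_lt_succ hi)
    rw [this, Measure.prod_prod, Measure.infinitePi_pi _ fun i _ => hB (i + 1),
      Finset.prod_range_succ' (fun i => ν (B i)), mul_comm]
  classical
  obtain ⟨N, hN⟩ := s.exists_nat_subset_range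
  have hN' : s ⊆ Finset.range (N + 1) := hN.trans (Finset.range_mono (Nat.le_succ N))
  have h1 := key (fun i => if i ∈ s then B i else Set.univ) (fun i => by
    by_cases h : i ∈ s <;> simp [h, hB]) N
  have h2 : ((Finset.range (N + 1) : Finset ℕ) : Set ℕ).pi
      (fun i => if i ∈ s then B i else Set.univ) = (s : Set ℕ).pi B := by
    ext z
    simp only [Set.mem_pi, Finset.mem_coe]
    constructor
    · intro h i hi
      simpa [hi] using h i (hN' hi)
    · intro h i _
      by_cases hi : i ∈ s <;> simp [hi, h]
  rw [h2] at h1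
  rw [h1, ← Finset.prod_subset hN']
  · exact Finset.prod_congr rfl fun i hi => by simp [hi]
  · intro i _ hi
    simp [hi]

/-- Upper bound for the expectation of `partialCost`, by recursion over the steps. -/
def expCost (A : Fin m → Set (∀ j, Ω j)) (μ : ∀ j, Measure (Ω j)) (w : ℝ≥0∞)
    (χ : (ℕ → ℕ) → (∀ j, Ω j) → ℝ≥0∞) : ℕ → Config Ω → ℝ≥0∞
  | _, ⟨[], M, σ⟩ => χ M σ
  | 0, ⟨_ :: _, _, _⟩ => 0
  | h + 1, ⟨c :: K, M, σ⟩ => w + ∫⁻ r, expCost A μ w χ h (step A r ⟨c :: K, M, σ⟩) ∂freshLaw μ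

/-- Induction on the number of steps, with the tape split after its first entry. Only rules valid
for arbitrary integrands are applied to `expCost`, so its measurability is never needed. -/
theorem lintegral_partialCost_le {A : Fin m → Set (∀ j, Ω j)} (hA : ∀ i, MeasurableSet (A i))
    (w : ℝ≥0∞) {χ : (ℕ → ℕ) → (∀ j, Ω j) → ℝ≥0∞}
    (hχ : Measurable fun q : (ℕ → ℕ) × ∀ j, Ω j => χ q.1 q.2) (h : ℕ) (c : Config Ω) :
    ∫⁻ ω, partialCost A w χ h c ω ∂tapeLaw μ ≤ expCost A μ w χ h c := by
  have : IsProbabilityMeasure (tapeLaw μ) := by unfold tapeLaw; infer_instance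
  induction h generalizing c with
  | zero =>
    obtain ⟨K, M, σ⟩ := c
    cases K with
    | nil => simp [partialCost_nil, expCost]
    | cons c K => simp [partialCost, runFrom, haltValue, expCost]
  | succ h ih =>
    obtain ⟨K, M, σ⟩ := c
    cases K with
    | nil => simp [partialCost_nil, expCost]
    | cons c K =>
      have hmeas : Measurable
          (fun q : Fresh Ω × (ℕ → Fresh Ω) => fun t : ℕ => (Nat.casesOn t q.1 q.2 : Fresh Ω)) := by
        refine measurable_pi_iff.2 fun t => ?_
        cases t with
        | zero => exact measurable_fst
        | succ t => exact (measurable_pi_apply t).comp measurable_snd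
      have hmap : ((freshLaw μ).prod (tapeLaw μ)).map
          (fun q : Fresh Ω × (ℕ → Fresh Ω) => fun t : ℕ => (Nat.casesOn t q.1 q.2 : Fresh Ω)) =
          tapeLaw μ := map_cons_infinitePi (freshLaw μ)
      rw [← hmap, lintegral_map (measurable_partialCost hA w hχ _ _) hmeas]
      refine (lintegral_prod_le _).trans ?_
      rw [expCost]
      calc ∫⁻ r, ∫⁻ ω, partialCost A w χ (h + 1) ⟨c :: K, M, σ⟩
              (fun t : ℕ => (Nat.casesOn t r ω : Fresh Ω)) ∂tapeLaw μ ∂freshLaw μ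
          = ∫⁻ r, (w + ∫⁻ ω, partialCost A w χ h (step A r ⟨c :: K, M, σ⟩) ω ∂tapeLaw μ)
              ∂freshLaw μ := by
            refine lintegral_congr fun r => ?_
            simp only [partialCost_succ, aliveCost]
            rw [lintegral_add_left measurable_const]
            simp
        _ ≤ ∫⁻ r, (w + expCost A μ w χ h (step A r ⟨c :: K, M, σ⟩)) ∂freshLaw μ :=
            lintegral_mono fun r => add_le_add_right (ih _) _
        _ = w + ∫⁻ r, expCost A μ w χ h (step A r ⟨c :: K, M, σ⟩) ∂freshLaw μ := by
            rw [lintegral_add_left measurable_const]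
            simp

theorem expCost_le_succ (A : Fin m → Set (∀ j, Ω j)) (w : ℝ≥0∞)
    (χ : (ℕ → ℕ) → (∀ j, Ω j) → ℝ≥0∞) (h : ℕ) (c : Config Ω) :
    expCost A μ w χ h c ≤ expCost A μ w χ (h + 1) c := by
  induction h generalizing c with
  | zero =>
    obtain ⟨K, M, σ⟩ := c
    cases K <;> simp [expCost]
  | succ h ih =>
    obtain ⟨K, M, σ⟩ := c
    cases K with
    | nil => simp [expCost]
    | cons c K =>
      rw [expCost, expCost]
      exact add_le_add_right (lintegral_mono fun r => ih _) _

/-- A bound for the expected running time in terms of the expected number of steps. -/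
theorem expectedTime_le {A : Fin m → Set (∀ j, Ω j)} (hA : ∀ i, MeasurableSet (A i)) (c : Cmd)
    (τ q : ℕ) (σ₀ : ∀ j, Ω j) {v : ℝ≥0∞}
    (hv : ∀ h, expCost A μ 1 (fun _ _ => 0) h ⟨[c], initMem n m q, σ₀⟩ ≤ v) :
    expectedTime c τ μ A q σ₀ ≤ (1 + τ) * v := by
  have hcost : ∀ c' : Config Ω, (stepCost τ c' : ℝ≥0∞) ≤ (1 + τ) * aliveCost 1 c' := by
    rintro ⟨K, M, σ⟩
    match K with
    | [] => simp [stepCost]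
    | .basic (.verify x y) :: K => simp [stepCost, aliveCost]
    | .basic (.const ..) :: K => simp [stepCost, aliveCost]
    | .basic (.copy ..) :: K => simp [stepCost, aliveCost]
    | .basic (.add ..) :: K => simp [stepCost, aliveCost]
    | .basic (.sub ..) :: K => simp [stepCost, aliveCost]
    | .basic (.load ..) :: K => simp [stepCost, aliveCost]
    | .basic (.store ..) :: K => simp [stepCost, aliveCost]
    | .basic (.rand ..) :: K => simp [stepCost, aliveCost]
    | .basic (.depends ..) :: K => simp [stepCost, aliveCost]
    | .basic (.resample ..) :: K => simp [stepCost, aliveCost]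
    | .seq .. :: K => simp [stepCost, aliveCost]
    | .ite .. :: K => simp [stepCost, aliveCost]
    | .loop .. :: K => simp [stepCost, aliveCost]
  set c₀ : Config Ω := ⟨[c], initMem n m q, σ₀⟩
  have hm : ∀ t, Measurable fun ω => aliveCost 1 (runFrom A c₀ ω t) := fun t =>
    (measurable_aliveCost 1).comp (measurable_runFrom hA c₀ t)
  calc expectedTime c τ μ A q σ₀
      ≤ ∫⁻ ω, (1 + τ) * ∑' t, aliveCost 1 (runFrom A c₀ ω t) ∂tapeLaw μ := by
        refine lintegral_mono fun ω => ?_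
        rw [runTime, ← ENNReal.tsum_mul_left]
        exact ENNReal.tsum_le_tsum fun t => by rw [run_eq_runFrom]; exact hcost _
    _ = (1 + τ) * ∑' t, ∫⁻ ω, aliveCost 1 (runFrom A c₀ ω t) ∂tapeLaw μ := by
        rw [lintegral_const_mul _ (Measurable.tsum hm),
          lintegral_tsum fun t => (hm t).aemeasurable]
    _ ≤ (1 + τ) * v := by
        gcongr
        refine ENNReal.tsum_le_of_sum_range_le fun h => ?_
        rw [← lintegral_finsetSum _ fun t _ => hm t]
        refine le_trans ?_ (hv h)
        refine le_trans (lintegral_mono fun ω => ?_)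
          (lintegral_partialCost_le hA 1 (χ := fun _ _ => 0) measurable_const h c₀)
        exact le_self_add

/-- A bound for the expected number of events that hold at the end. -/
theorem expectedViolated_le {A : Fin m → Set (∀ j, Ω j)} (hA : ∀ i, MeasurableSet (A i)) (c : Cmd)
    (q : ℕ) (σ₀ : ∀ j, Ω j) {v : ℝ≥0∞}
    (hv : ∀ h, expCost A μ 0 (fun _ σ => ∑ i, (A i).indicator 1 σ) h
      ⟨[c], initMem n m q, σ₀⟩ ≤ v) :
    expectedViolated c μ A q σ₀ ≤ v := by
  set c₀ : Config Ω := ⟨[c], initMem n m q, σ₀⟩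
  set χ : (ℕ → ℕ) → (∀ j, Ω j) → ℝ≥0∞ := fun _ σ => ∑ i, (A i).indicator 1 σ
  have hχ : Measurable fun q : (ℕ → ℕ) × ∀ j, Ω j => χ q.1 q.2 :=
    (Finset.measurable_sum _ fun i _ => measurable_one.indicator (hA i)).comp measurable_snd
  -- At price 0 the partial cost is 0 before halting and constant afterwards, hence monotone
  -- convergence applies.
  have hmono : Monotone fun h => partialCost A 0 χ h c₀ := by
    refine monotone_nat_of_le_succ fun h ω => ?_
    have h0 : ∀ c : Config Ω, aliveCost 0 c = 0 := by
      rintro ⟨K, M, σ⟩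
      cases K <;> rfl
    simp only [partialCost, h0, Finset.sum_const_zero, zero_add]
    rcases hK : (runFrom A c₀ ω h) with ⟨K, M, σ⟩
    cases K with
    | nil => rw [runFrom_of_todo_nil A ω (Nat.le_succ h) (by rw [hK]), hK]
    | cons => exact zero_le
  calc expectedViolated c μ A q σ₀
      ≤ ∫⁻ ω, ⨆ h, partialCost A 0 χ h c₀ ω ∂tapeLaw μ := by
        refine lintegral_mono fun ω => ?_
        classical
        by_cases hh : ∃ t, (runFrom A c₀ ω t).todo = []
        · obtain ⟨t, ht⟩ := hh
          refine le_trans ?_ (le_iSup (fun h => partialCost A 0 χ h c₀ ω) t)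
          have h1 : {i | HoldsAtEnd c A q σ₀ ω i} ⊆
              ((Finset.univ.filter fun i => (runFrom A c₀ ω t).asg ∈ A i : Finset (Fin m)) :
                Set (Fin m)) := by
            rintro i ⟨s, hs, hi⟩
            rw [run_eq_runFrom] at hs hi
            simp only [Finset.coe_filter, Finset.mem_univ, true_and, Set.mem_ofPred_eq]
            rcases le_total s t with hst | hst
            · rwa [runFrom_of_todo_nil A ω hst hs]
            · rwa [runFrom_of_todo_nil A ω hst ht] at hi
          have h2 := Set.ncard_le_ncard h1 (Finset.finite_toSet _)
          rw [Set.ncard_coe_finset] at h2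
          have h3 : haltValue χ (runFrom A c₀ ω t) =
              ((Finset.univ.filter fun i => (runFrom A c₀ ω t).asg ∈ A i).card : ℝ≥0∞) := by
            rcases hK : (runFrom A c₀ ω t) with ⟨K, M, σ⟩
            rw [hK] at ht
            obtain rfl : K = [] := ht
            simp [haltValue, χ, Set.indicator_apply]
          calc _ ≤ ((Finset.univ.filter fun i => (runFrom A c₀ ω t).asg ∈ A i).card : ℝ≥0∞) := by
                exact_mod_cast h2
            _ ≤ _ := by
                rw [← h3]
                exact le_add_self
        · have h1 : {i | HoldsAtEnd c A q σ₀ ω i} = ∅ := by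
            ext i
            simp only [Set.mem_ofPred_eq, Set.mem_empty_iff_false, iff_false]
            rintro ⟨s, hs, -⟩
            rw [run_eq_runFrom] at hs
            exact hh ⟨s, hs⟩
          rw [h1]
          simp
    _ = ⨆ h, ∫⁻ ω, partialCost A 0 χ h c₀ ω ∂tapeLaw μ :=
        lintegral_iSup (fun h => measurable_partialCost hA 0 hχ h c₀) hmono
    _ ≤ v := iSup_le fun h => (lintegral_partialCost_le hA 0 hχ h c₀).trans (hv h)

end Execution

end MTBeyond
end

noncomputable section
namespace MTBeyond

/-! ## Rules for bounding the expected cost of programs -/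

section Logic

set_option linter.unusedSectionVars false

universe u

variable {n m : ℕ} {Ω : Fin n → Type u} [∀ j, MeasurableSpace (Ω j)]
  {A : Fin m → Set (∀ j, Ω j)} {μ : ∀ j, Measure (Ω j)} [∀ j, IsProbabilityMeasure (μ j)]
  {w : ℝ≥0∞}

/-- If the expected cost of what follows after `c` is at most `φ`, up to a constant, then the
expected cost of `c` and what follows, from the given state, is at most `v`, up to the same
constant. -/
def Wp (A : Fin m → Set (∀ j, Ω j)) (μ : ∀ j, Measure (Ω j)) (w : ℝ≥0∞) (c : Cmd) (M : ℕ → ℕ)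
    (σ : ∀ j, Ω j) (φ : (ℕ → ℕ) → (∀ j, Ω j) → ℝ≥0∞) (v : ℝ≥0∞) : Prop :=
  ∀ (C : ℝ≥0∞) (h : ℕ) (K : List Cmd) (χ : (ℕ → ℕ) → (∀ j, Ω j) → ℝ≥0∞),
    (∀ M' σ', expCost A μ w χ h ⟨K, M', σ'⟩ ≤ φ M' σ' + C) →
      expCost A μ w χ h ⟨c :: K, M, σ⟩ ≤ v + C

variable {c c₁ c₂ : Cmd} {M : ℕ → ℕ} {σ : ∀ j, Ω j} {φ ψ : (ℕ → ℕ) → (∀ j, Ω j) → ℝ≥0∞}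
  {v v' : ℝ≥0∞}

theorem Wp.mono (hc : Wp A μ w c M σ φ v) (hv : v ≤ v') (hφ : ∀ M' σ', ψ M' σ' ≤ φ M' σ') :
    Wp A μ w c M σ ψ v' := fun C h K χ hK =>
  (hc C h K χ fun M' σ' => (hK M' σ').trans (add_le_add_left (hφ M' σ') C)).trans
    (add_le_add_left hv C)

/-- The arbitrary constant `C` in `Wp` serves this rule: a fixed later cost is carried through a
command. -/
theorem Wp.frame (hc : Wp A μ w c M σ φ v) (D : ℝ≥0∞) :
    Wp A μ w c M σ (fun M' σ' => φ M' σ' + D) (v + D) := fun C h K χ hK => by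
  rw [add_assoc]
  exact hc (D + C) h K χ fun M' σ' => (hK M' σ').trans_eq (add_assoc _ _ _)

theorem wp_top (c : Cmd) (M : ℕ → ℕ) (σ : ∀ j, Ω j) : Wp A μ w c M σ φ ⊤ := fun C h K χ _ => by
  simp

theorem expCost_le_of_wp (hc : Wp A μ w c M σ φ v) (h : ℕ) :
    expCost A μ w φ h ⟨[c], M, σ⟩ ≤ v := by
  have := hc 0 h [] φ fun M' σ' => by cases h <;> simp [expCost]
  simpa using this

theorem wp_basic (i : Instr) (M : ℕ → ℕ) (σ : ∀ j, Ω j) :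
    Wp A μ w (.basic i) M σ φ (w + ∫⁻ r, φ (i.newMem A r M σ) (i.newAsg r M σ) ∂freshLaw μ) := by
  intro C h K χ hK
  cases h with
  | zero => simp [expCost]
  | succ h =>
    rw [expCost, add_assoc]
    refine add_le_add_right ?_ w
    calc ∫⁻ r, expCost A μ w χ h (step A r ⟨.basic i :: K, M, σ⟩) ∂freshLaw μ
        ≤ ∫⁻ r, (φ (i.newMem A r M σ) (i.newAsg r M σ) + C) ∂freshLaw μ :=
          lintegral_mono fun r => (expCost_le_succ A w χ h _).trans (hK _ _)
      _ = ∫⁻ r, φ (i.newMem A r M σ) (i.newAsg r M σ) ∂freshLaw μ + C := by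
          rw [lintegral_add_right _ measurable_const]
          simp

/-- Covers commands whose first step uses no randomness and only rewrites the to-do list and memory.
The bound for the continuation passes to smaller step budgets because `expCost` increases with the
budget. -/
theorem wp_const_step {K' : List Cmd → List Cmd} {M' : ℕ → ℕ}
    (hstep : ∀ K (r : Fresh Ω), step A r ⟨c :: K, M, σ⟩ = ⟨K' K, M', σ⟩)
    (h' : ∀ (C : ℝ≥0∞) (h : ℕ) (K : List Cmd) (χ : (ℕ → ℕ) → (∀ j, Ω j) → ℝ≥0∞),
      (∀ h' ≤ h, ∀ M' σ', expCost A μ w χ h' ⟨K, M', σ'⟩ ≤ φ M' σ' + C) →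
      expCost A μ w χ h ⟨K' K, M', σ⟩ ≤ v + C) :
    Wp A μ w c M σ φ (w + v) := by
  intro C h K χ hK
  cases h with
  | zero => simp [expCost]
  | succ h =>
    rw [expCost, add_assoc]
    simp only [hstep, lintegral_const, measure_univ, mul_one]
    refine add_le_add_right (h' C h K χ fun h' hh M' σ' => ?_) w
    refine le_trans ?_ (hK M' σ')
    exact monotone_nat_of_le_succ (f := fun h => expCost A μ w χ h ⟨K, M', σ'⟩)
      (fun h => expCost_le_succ A w χ h _) (hh.trans (Nat.le_succ h))

theorem wp_seq (h₂ : ∀ M' σ', Wp A μ w c₂ M' σ' φ (ψ M' σ')) (h₁ : Wp A μ w c₁ M σ ψ v) :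
    Wp A μ w (.seq c₁ c₂) M σ φ (w + v) :=
  wp_const_step (K' := fun K => c₁ :: c₂ :: K) (fun _ _ => rfl) fun C h K χ hK =>
    h₁ C h _ χ fun M' σ' => h₂ M' σ' C h K χ (hK h le_rfl)

theorem wp_ite {x : ℕ} (h₁ : M x ≠ 0 → Wp A μ w c₁ M σ φ v) (h₂ : M x = 0 → Wp A μ w c₂ M σ φ v) :
    Wp A μ w (.ite x c₁ c₂) M σ φ (w + v) := by
  refine wp_const_step (K' := fun K => (if M x ≠ 0 then c₁ else c₂) :: K) (fun _ _ => rfl)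
    fun C h K χ hK => ?_
  split_ifs with hx
  · exact h₁ hx C h K χ (hK h le_rfl)
  · exact h₂ (not_not.1 hx) C h K χ (hK h le_rfl)

/-- Induction on the step budget h, so termination need not be known: a running program with budget
0 has cost 0. The conditions range over all states; unwanted ones are excused by giving `I` the
value `⊤`. -/
theorem wp_loop {x : ℕ} (I : (ℕ → ℕ) → (∀ j, Ω j) → ℝ≥0∞)
    (h₀ : ∀ M σ, M x = 0 → w + φ M σ ≤ I M σ)
    (h₁ : ∀ M σ, M x ≠ 0 → ∃ v, Wp A μ w c M σ I v ∧ w + v ≤ I M σ) (M : ℕ → ℕ) (σ : ∀ j, Ω j) :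
    Wp A μ w (.loop x c) M σ φ (I M σ) := by
  intro C h K χ hK
  induction h generalizing M σ with
  | zero => simp [expCost]
  | succ h ih =>
    have hK' : ∀ M' σ', expCost A μ w χ h ⟨K, M', σ'⟩ ≤ φ M' σ' + C := fun M' σ' =>
      (expCost_le_succ A w χ h _).trans (hK M' σ')
    rw [expCost]
    by_cases hx : M x = 0
    · have hs : ∀ r : Fresh Ω, step A r ⟨.loop x c :: K, M, σ⟩ = ⟨K, M, σ⟩ := fun r => by
        simp [step, hx]
      simp only [hs, lintegral_const, measure_univ, mul_one]
      calc w + expCost A μ w χ h ⟨K, M, σ⟩ ≤ w + (φ M σ + C) := add_le_add_right (hK' _ _) w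
        _ = (w + φ M σ) + C := (add_assoc _ _ _).symm
        _ ≤ I M σ + C := add_le_add_left (h₀ M σ hx) C
    · have hs : ∀ r : Fresh Ω,
          step A r ⟨.loop x c :: K, M, σ⟩ = ⟨c :: .loop x c :: K, M, σ⟩ := fun r => by
        simp [step, hx]
      simp only [hs, lintegral_const, measure_univ, mul_one]
      obtain ⟨v, hv, hvI⟩ := h₁ M σ hx
      calc w + expCost A μ w χ h ⟨c :: .loop x c :: K, M, σ⟩ ≤ w + (v + C) :=
            add_le_add_right (hv C h _ χ fun M' σ' => ih M' σ' hK') w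
        _ = (w + v) + C := (add_assoc _ _ _).symm
        _ ≤ I M σ + C := add_le_add_left hvI C

/-! ### Deterministic code -/

open Classical in
/-- The command reaches a memory satisfying `Q` without changing the assignment, within `k`
steps. -/
def Runs (A : Fin m → Set (∀ j, Ω j)) (μ : ∀ j, Measure (Ω j)) (w : ℝ≥0∞) (c : Cmd) (M : ℕ → ℕ)
    (σ : ∀ j, Ω j) (k : ℕ) (Q : (ℕ → ℕ) → Prop) : Prop :=
  Wp A μ w c M σ (fun M' σ' => if σ' = σ ∧ Q M' then 0 else ⊤) (k * w)

variable {k k₁ k₂ : ℕ} {Q Q₁ : (ℕ → ℕ) → Prop}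

theorem Runs.wp (hc : Runs A μ w c M σ k Q) (hφ : ∀ M', Q M' → φ M' σ ≤ v) :
    Wp A μ w c M σ φ (v + k * w) := by
  refine (Wp.frame hc v).mono (add_comm _ _).le fun M' σ' => ?_
  split_ifs with h
  · obtain ⟨rfl, h⟩ := h
    simpa using hφ M' h
  · simp

theorem Runs.mono (hc : Runs A μ w c M σ k₁ Q₁) (hk : k₁ ≤ k) (hQ : ∀ M', Q₁ M' → Q M') :
    Runs A μ w c M σ k Q := by
  refine Wp.mono hc (by gcongr) fun M' σ' => ?_
  by_cases h : σ' = σ ∧ Q₁ M'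
  · simp [h.1, hQ _ h.2]
  · simp [h]

theorem runs_seq (h₁ : Runs A μ w c₁ M σ k₁ Q₁)
    (h₂ : ∀ M', Q₁ M' → Runs A μ w c₂ M' σ k₂ Q) :
    Runs A μ w (.seq c₁ c₂) M σ (k₁ + k₂ + 1) Q := by
  classical
  refine (wp_seq (ψ := fun M' σ' => if σ' = σ ∧ Q₁ M' then 0 + k₂ * w else ⊤) ?_
    (h₁.wp (v := k₂ * w) fun M' h => by simp [h])).mono ?_ fun _ _ => le_rfl
  · intro M' σ'
    split_ifs with h
    · obtain ⟨rfl, h⟩ := h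
      simpa [Runs] using h₂ M' h
    · exact wp_top _ _ _
  · push_cast
    ring_nf
    exact le_rfl

/-- Instructions that use no randomness. -/
def Instr.IsDet : Instr → Prop
  | .rand _ _ => False
  | .resample _ => False
  | _ => True

open Classical in
/-- Effect of an instruction without randomness. -/
def Instr.detMem (A : Fin m → Set (∀ j, Ω j)) (M : ℕ → ℕ) (σ : ∀ j, Ω j) : Instr → (ℕ → ℕ)
  | .const x k => Function.update M x k
  | .copy x y => Function.update M x (M y)
  | .add x y z => Function.update M x (M y + M z)
  | .sub x y z => Function.update M x (M y - M z)
  | .load x y => Function.update M x (M (M y))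
  | .store x y => Function.update M (M x) (M y)
  | .rand _ _ => M
  | .depends x y z => Function.update M x
      (if ∃ (hi : M y < m) (hj : M z < n), (⟨M z, hj⟩ : Fin n) ∈ vbl (A ⟨M y, hi⟩) then 1 else 0)
  | .verify x y => Function.update M x (if ∃ hi : M y < m, σ ∈ A ⟨M y, hi⟩ then 1 else 0)
  | .resample _ => M

theorem wp_det {i : Instr} (hi : i.IsDet) :
    Wp A μ w (.basic i) M σ φ (w + φ (i.detMem A M σ) σ) := by
  have h1 : ∀ r : Fresh Ω, i.newMem A r M σ = i.detMem A M σ := fun r => by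
    cases i <;> first | rfl | exact hi.elim
  have h2 : ∀ r : Fresh Ω, i.newAsg r M σ = σ := fun r => by
    cases i <;> first | rfl | exact hi.elim
  refine (wp_basic i M σ).mono ?_ fun _ _ => le_rfl
  simp [h1, h2]

/-- Sequential composition of a list of commands. -/
def Cmd.block : List Cmd → Cmd
  | [] => .basic (.copy 0 0)
  | c :: l => .seq c (Cmd.block l)

theorem wp_block_nil : Wp A μ w (Cmd.block []) M σ φ (φ M σ + w) := by
  have := wp_det (A := A) (μ := μ) (w := w) (M := M) (σ := σ) (φ := φ) (i := .copy 0 0) trivial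
  rw [add_comm, Cmd.block]
  simpa only [Instr.detMem, Function.update_eq_self] using this

theorem wp_block_cons {l : List Cmd} (h₂ : ∀ M' σ', Wp A μ w (Cmd.block l) M' σ' φ (ψ M' σ'))
    (h₁ : Wp A μ w c M σ ψ v) : Wp A μ w (Cmd.block (c :: l)) M σ φ (v + w) :=
  (wp_seq h₂ h₁).mono (add_comm _ _).le fun _ _ => le_rfl

theorem wp_block_det {i : Instr} {l : List Cmd}
    (h : Wp A μ w (Cmd.block l) (i.detMem A M σ) σ φ v) (hi : i.IsDet := by trivial) :
    Wp A μ w (Cmd.block (.basic i :: l)) M σ φ (v + 2 * w) := by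
  classical
  refine (wp_block_cons (ψ := fun M' σ' => if M' = i.detMem A M σ ∧ σ' = σ then v else ⊤) ?_
    (wp_det hi)).mono ?_ fun _ _ => le_rfl
  · intro M' σ'
    split_ifs with h'
    · rw [h'.1, h'.2]
      exact h
    · exact wp_top _ _ _
  · simp only [and_self, if_true]
    rw [two_mul]
    exact le_of_eq (by ring)

theorem runs_block_nil (hQ : Q M) : Runs A μ w (Cmd.block []) M σ 1 Q := by
  refine wp_block_nil.mono ?_ fun _ _ => le_rfl
  simp [hQ]

theorem runs_block_cons {l : List Cmd} (h₁ : Runs A μ w c M σ k₁ Q₁)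
    (h₂ : ∀ M', Q₁ M' → Runs A μ w (Cmd.block l) M' σ k₂ Q) :
    Runs A μ w (Cmd.block (c :: l)) M σ (k₁ + k₂ + 1) Q :=
  runs_seq h₁ h₂

theorem runs_block_det {i : Instr} {l : List Cmd}
    (h : Runs A μ w (Cmd.block l) (i.detMem A M σ) σ k Q) (hi : i.IsDet := by trivial) :
    Runs A μ w (Cmd.block (.basic i :: l)) M σ (k + 2) Q := by
  refine Wp.mono (wp_block_det h hi) ?_ fun _ _ => le_rfl
  push_cast
  ring_nf
  exact le_rfl

theorem runs_ite {x : ℕ} (h₁ : M x ≠ 0 → Runs A μ w c₁ M σ k Q)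
    (h₂ : M x = 0 → Runs A μ w c₂ M σ k Q) : Runs A μ w (.ite x c₁ c₂) M σ (k + 1) Q := by
  refine Wp.mono (wp_ite h₁ h₂) ?_ fun _ _ => le_rfl
  push_cast
  exact le_of_eq (by ring)

/-! ### Counting loops -/

/-- The loop `for i = 0, …, M lim - 1 do c`, with an auxiliary cell `t`. -/
def Cmd.forLoop (i lim t : ℕ) (c : Cmd) : Cmd :=
  .block [.basic (.const i 0), .basic (.sub t lim i),
    .loop t (.block [c, .basic (.const t 1), .basic (.add i i t), .basic (.sub t lim i)])]

-- `θ j` bounds the expected cost to come before round j, apart from overhead, and must ignore the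
-- control cells `i` and `t`. The overhead of a round is 9 steps: the loop test, four unfoldings of
-- `seq`, three instructions and the closing dummy `copy`. The final 8 cover initialization and
-- exit.
open Classical in
theorem wp_forLoop {i lim t N b : ℕ} (hit : i ≠ t) (hli : lim ≠ i) (hlt : lim ≠ t)
    (θ : ℕ → (ℕ → ℕ) → (∀ j, Ω j) → ℝ≥0∞)
    (hframe : ∀ j M M' σ, (∀ x, x ≠ i → x ≠ t → M' x = M x) → θ j M' σ ≤ θ j M σ)
    (hbody : ∀ j < N, ∀ M σ, M i = j → M lim = N →
      Wp A μ w c M σ (fun M' σ' => if M' i = j ∧ M' lim = N then θ (j + 1) M' σ' else ⊤)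
        (θ j M σ + b * w))
    (hM : M lim = N) (hφ : ∀ M' σ', φ M' σ' ≤ θ N M' σ') :
    Wp A μ w (.forLoop i lim t c) M σ φ (θ 0 M σ + (N * (b + 9) + 8 : ℕ) * w) := by
  -- Cell `t` holds N minus the counter, so the loop ends exactly when the counter reaches N.
  set I : (ℕ → ℕ) → (∀ j, Ω j) → ℝ≥0∞ := fun M σ =>
    if M lim = N ∧ M i ≤ N ∧ M t = N - M i then
      θ (M i) M σ + ((N - M i) * (b + 9) + 1 : ℕ) * w else ⊤ with hI
  have hloop : ∀ M' σ', Wp A μ w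
      (.loop t (.block [c, .basic (.const t 1), .basic (.add i i t), .basic (.sub t lim i)]))
      M' σ' φ (I M' σ') := by
    refine wp_loop I ?_ ?_
    · intro M σ h0
      simp only [hI]
      split_ifs with h
      · have hiN : M i = N := by omega
        rw [hiN, Nat.sub_self, Nat.zero_mul, zero_add, Nat.cast_one, one_mul, add_comm]
        exact add_le_add_left (hφ M σ) w
      · simp
    · intro M σ h0
      by_cases h : M lim = N ∧ M i ≤ N ∧ M t = N - M i
      · have hlt' : M i < N := by omega
        set j := M i with hj
        set D : ℝ≥0∞ := ((N - (j + 1)) * (b + 9) + 1 : ℕ) * w with hD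
        refine ⟨θ j M σ + b * w + (D + w + 2 * w + 2 * w + 2 * w) + w, ?_, ?_⟩
        · refine wp_block_cons (ψ := fun M' σ' =>
            (if M' i = j ∧ M' lim = N then θ (j + 1) M' σ' else ⊤) +
              (D + w + 2 * w + 2 * w + 2 * w)) ?_ ((hbody j hlt' M σ rfl h.1).frame _)
          intro M' σ'
          split_ifs with h'
          · rw [← add_assoc, ← add_assoc, ← add_assoc, ← add_assoc]
            refine wp_block_det (wp_block_det (wp_block_det ?_))
            refine wp_block_nil.mono (add_le_add_left ?_ w) fun _ _ => le_rfl
            simp only [hI, Instr.detMem]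
            rw [if_pos]
            · simp only [ne_eq, hit, not_false_eq_true, Function.update_of_ne,
                Function.update_self, h'.1, hD]
              refine add_le_add_left (hframe _ _ _ _ fun x hxi hxt => ?_) _
              simp [hxi, hxt]
            · simp [hit, hli, hlt, h'.1, h'.2]
              omega
          · simpa using wp_top _ _ _
        · simp only [hI]
          rw [if_pos h, hD]
          have hN : N - j = (N - (j + 1)) + 1 := by omega
          rw [← hj, hN]
          push_cast
          exact le_of_eq (by ring)
      · refine ⟨⊤, wp_top _ _ _, ?_⟩
        simp [hI, h]
  refine Wp.mono (wp_block_det (wp_block_det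
    (wp_block_cons (fun _ _ => wp_block_nil) ?_))) (v := (I (Function.update
      (Function.update M i 0) t N) σ + w) + w + 2 * w + 2 * w) ?_ fun _ _ => le_rfl
  · have h1 : (Instr.sub t lim i).detMem A ((Instr.const i 0).detMem A M σ) σ =
        Function.update (Function.update M i 0) t N := by
      simp [Instr.detMem, hli, hM]
    rw [h1]
    exact (hloop _ σ).frame w
  · simp only [hI]
    rw [if_pos]
    · simp only [ne_eq, hit, not_false_eq_true, Function.update_of_ne, Function.update_self,
        Nat.sub_zero]
      calc _ ≤ θ 0 M σ + ((N * (b + 9) + 1 : ℕ) : ℝ≥0∞) * w + w + w + 2 * w + 2 * w := by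
            gcongr
            refine hframe _ _ _ _ fun x hxi hxt => ?_
            simp [hxi, hxt]
        _ ≤ _ := by
            push_cast
            ring_nf
            gcongr
            norm_num
    · simp [hit, hli, hlt, hM]

theorem runs_forLoop {i lim t N b : ℕ} (hit : i ≠ t) (hli : lim ≠ i) (hlt : lim ≠ t)
    (Inv : ℕ → (ℕ → ℕ) → Prop)
    (hframe : ∀ j M M', (∀ x, x ≠ i → x ≠ t → M' x = M x) → Inv j M → Inv j M')
    (hbody : ∀ j < N, ∀ M, M i = j → M lim = N → Inv j M →
      Runs A μ w c M σ b fun M' => M' i = j ∧ M' lim = N ∧ Inv (j + 1) M')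
    (hM : M lim = N) (h0 : Inv 0 M) :
    Runs A μ w (.forLoop i lim t c) M σ (N * (b + 9) + 8) (Inv N) := by
  classical
  refine (wp_forLoop (N := N) (b := b) hit hli hlt
    (fun j M' σ' => if σ' = σ ∧ Inv j M' then 0 else ⊤) ?_ ?_ hM fun M' σ' => le_rfl).mono ?_
    fun M' σ' => le_rfl
  · intro j M M' σ' hx
    by_cases h : σ' = σ ∧ Inv j M
    · simp [h.1, h.2, hframe j M M' hx h.2]
    · simp [h]
  · intro j hj M σ' hi hl
    by_cases h : σ' = σ ∧ Inv j M
    · obtain ⟨rfl, h⟩ := h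
      simp only [h, and_self, if_true]
      refine (hbody j hj M hi hl h).wp (v := 0) ?_
      rintro M' ⟨h1, h2, h3⟩
      simp [h1, h2, h3]
    · simpa [h] using wp_top _ _ _
  · simp [h0]

end Logic

end MTBeyond
end

noncomputable section
namespace MTBeyond

/-! ## Resampling with private coins -/

section Coins

set_option linter.unusedSectionVars false

universe u

variable {n m : ℕ} {Ω : Fin n → Type u}

/-- The given variables, and one more variable for each event, its coin. -/
def ExtSpace (Ω : Fin n → Type u) (m : ℕ) : Fin n ⊕ Fin m → Type u
  | .inl j => Ω j
  | .inr _ => ULift ℕ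

instance ExtSpace.measurableSpace [∀ j, MeasurableSpace (Ω j)] :
    ∀ k, MeasurableSpace (ExtSpace Ω m k)
  | .inl j => inferInstanceAs (MeasurableSpace (Ω j))
  | .inr _ => inferInstanceAs (MeasurableSpace (ULift ℕ))

/-- The value put into a cell by `rand` with the bound `L`. -/
def coinValue (L : ℕ) (r : unitInterval) : ℕ := min ⌊(r : ℝ) * (L : ℝ)⌋₊ (L - 1)

theorem measurable_coinValue (L : ℕ) : Measurable (coinValue L) :=
  (Measurable.of_discrete (f := fun a : ℕ => min a (L - 1))).comp
    (Nat.measurable_floor.comp (measurable_subtype_coe.mul_const _))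

/-- The law of a coin. -/
def coinLaw (L : ℕ) : Measure (ULift.{u} ℕ) :=
  (volume : Measure unitInterval).map fun r => ULift.up (coinValue L r)

theorem measurable_up_coinValue (L : ℕ) :
    Measurable fun r => (ULift.up (coinValue L r) : ULift.{u} ℕ) :=
  measurable_up.comp (measurable_coinValue L)

instance coinLaw.isProbabilityMeasure (L : ℕ) : IsProbabilityMeasure (coinLaw.{u} L) :=
  Measure.isProbabilityMeasure_map (measurable_up_coinValue L).aemeasurable

variable [∀ j, MeasurableSpace (Ω j)]

/-- The laws of the variables and of the coins. -/
def extLaw (μ : ∀ j, Measure (Ω j)) (m L : ℕ) : ∀ k, Measure (ExtSpace Ω m k)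
  | .inl j => μ j
  | .inr _ => coinLaw L

instance extLaw.isProbabilityMeasure {μ : ∀ j, Measure (Ω j)} [∀ j, IsProbabilityMeasure (μ j)]
    {L : ℕ} : ∀ k, IsProbabilityMeasure (extLaw μ m L k)
  | .inl j => inferInstanceAs (IsProbabilityMeasure (μ j))
  | .inr _ => inferInstanceAs (IsProbabilityMeasure (coinLaw L))

/-- The point of the extended space given by the assignment and the coins in the memory. -/
def extState (m : ℕ) (M : ℕ → ℕ) (σ : ∀ j, Ω j) : ∀ k, ExtSpace Ω m k
  | .inl j => σ j
  | .inr i => ULift.up (M (32 + i))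

theorem extState_congr {M M' : ℕ → ℕ} (h : ∀ x, 32 ≤ x → M' x = M x) (σ : ∀ j, Ω j) :
    extState m M' σ = extState m M σ := by
  funext k
  cases k with
  | inl j => rfl
  | inr i => exact congrArg ULift.up (h _ (Nat.le_add_right _ _))

theorem extState_update_asg (M : ℕ → ℕ) (σ : ∀ j, Ω j) (j : Fin n)
    (a : ExtSpace Ω m (.inl j)) :
    extState m M (Function.update σ j a) = Function.update (extState m M σ) (.inl j) a := by
  refine Function.eq_update_iff.2 ⟨Function.update_self (β := Ω) j a σ, fun k hk => ?_⟩
  cases k with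
  | inl j' => exact Function.update_of_ne (β := Ω) (fun e => hk (congrArg Sum.inl e)) a σ
  | inr i => rfl

theorem extState_update_mem (M : ℕ → ℕ) (σ : ∀ j, Ω j) (i : Fin m) (a : ExtSpace Ω m (.inr i)) :
    extState m (Function.update M (32 + i) (ULift.down a)) σ =
      Function.update (extState m M σ) (.inr i) a := by
  refine Function.eq_update_iff.2
    ⟨congrArg ULift.up (Function.update_self (32 + (i : ℕ)) _ M), fun k hk => ?_⟩
  cases k with
  | inl j => rfl
  | inr i' =>
    have h2 : 32 + (i' : ℕ) ≠ 32 + i := fun e => hk (congrArg Sum.inr (Fin.ext (by omega)))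
    exact congrArg ULift.up (Function.update_of_ne h2 _ M)

variable {A : Fin m → Set (∀ j, Ω j)} {μ : ∀ j, Measure (Ω j)} [∀ j, IsProbabilityMeasure (μ j)]
  {w : ℝ≥0∞} {M : ℕ → ℕ} {σ : ∀ j, Ω j} {φ : (ℕ → ℕ) → (∀ j, Ω j) → ℝ≥0∞}

theorem wp_resample {x : ℕ} {j : Fin n} (hj : M x = j) {g : Ω j → ℝ≥0∞} (hg : Measurable g)
    (hφ : ∀ a, φ M (Function.update σ j a) ≤ g a) :
    Wp A μ w (.basic (.resample x)) M σ φ (∫⁻ a, g a ∂μ j + w) := by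
  refine (wp_basic _ M σ).mono ?_ fun _ _ => le_rfl
  rw [add_comm]
  refine add_le_add_left ?_ w
  have h1 : MeasurePreserving (fun r : Fresh Ω => r.2 j) (freshLaw μ) (μ j) :=
    (measurePreserving_eval μ j).comp measurePreserving_snd
  rw [← h1.lintegral_comp hg]
  refine lintegral_mono fun r => ?_
  have h2 : (Instr.resample x).newAsg r M σ = Function.update σ j (r.2 j) := by
    have hx : M x < n := hj ▸ j.2
    have : (⟨M x, hx⟩ : Fin n) = j := Fin.ext hj
    subst this
    simp [Instr.newAsg, hx]
  rw [h2]
  exact hφ _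

theorem wp_rand {x y L : ℕ} (hy : M y = L) {g : ULift.{u} ℕ → ℝ≥0∞}
    (hφ : ∀ a, φ (Function.update M x a) σ ≤ g (ULift.up a)) :
    Wp A μ w (.basic (.rand x y)) M σ φ (∫⁻ a, g a ∂coinLaw L + w) := by
  refine (wp_basic _ M σ).mono ?_ fun _ _ => le_rfl
  rw [add_comm]
  refine add_le_add_left ?_ w
  have hg : Measurable g := by
    have : g = (fun a : ℕ => g (ULift.up a)) ∘ ULift.down := rfl
    rw [this]
    exact Measurable.of_discrete.comp measurable_down
  have h1 : MeasurePreserving (fun r : Fresh Ω => (ULift.up (coinValue L r.1) : ULift.{u} ℕ))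
      (freshLaw μ) (coinLaw L) :=
    MeasurePreserving.comp (g := fun r => (ULift.up (coinValue L r) : ULift.{u} ℕ))
      ⟨measurable_up_coinValue L, rfl⟩ measurePreserving_fst
  rw [← h1.lintegral_comp hg]
  refine lintegral_mono fun r => ?_
  refine le_trans (le_of_eq ?_) (hφ _)
  simp [Instr.newMem, Instr.newAsg, coinValue, hy]

/-! ### The program -/

/-- Draw the coin of the event whose number is in cell `x`. -/
def drawCoin (x : ℕ) : List Cmd :=
  [.basic (.const 9 32), .basic (.add 9 9 x), .basic (.rand 10 3), .basic (.store 9 10)]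

/-- Resample the variables and the coin of the event whose number is in cell `8`. -/
def fixEvent : Cmd :=
  .block (.forLoop 6 0 7 (.block [.basic (.depends 9 8 6), .ite 9 (.basic (.resample 6))
    (.block [])]) :: drawCoin 8)

/-- Draw all variables and coins. -/
def initAll : Cmd :=
  .block [.forLoop 6 0 7 (.basic (.resample 6)), .forLoop 6 1 7 (.block (drawCoin 6))]

/-- Set cell `5` to `1` and put the number of an event into cell `8` if an event holds whose coin
is smaller than cell `4`. -/
def scanEvents : Cmd :=
  .forLoop 6 1 7 (.block [.basic (.const 9 32), .basic (.add 9 9 6), .basic (.load 9 9),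
    .basic (.sub 9 4 9), .basic (.verify 10 6),
    .ite 9 (.ite 10 (.block [.basic (.const 5 1), .basic (.copy 8 6)]) (.block [])) (.block [])])

/-- Resample as long as there are events to resample. -/
def resampleLoop : Cmd :=
  .block [.basic (.const 5 1), .loop 5 (.block [.basic (.const 5 0), scanEvents,
    .ite 5 fixEvent (.block [])])]

/-- The algorithm; `c` has to put the parameters of the coins into the cells `3` and `4`. -/
def algorithm (c : Cmd) : Cmd := .block [c, initAll, resampleLoop]

/-- The memory has the right contents in the cells used by all parts of the program. -/
def GoodMem (n m L S f : ℕ) (M : ℕ → ℕ) : Prop :=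
  M 0 = n ∧ M 1 = m ∧ M 3 = L ∧ M 4 = S ∧ M 5 = f

theorem GoodMem.congr {L S f : ℕ} {M M' : ℕ → ℕ} (h : GoodMem n m L S f M)
    (hM : ∀ x ≤ 5, M' x = M x) : GoodMem n m L S f M' := by
  obtain ⟨h0, h1, h3, h4, h5⟩ := h
  exact ⟨by rw [hM 0 (by norm_num), h0], by rw [hM 1 (by norm_num), h1],
    by rw [hM 3 (by norm_num), h3], by rw [hM 4 (by norm_num), h4], by rw [hM 5 (by norm_num), h5]⟩

open Classical in
/-- `F` evaluated at the extended state, if the memory is as it should be. -/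
def guarded (m L S f : ℕ) (F : (∀ k, ExtSpace Ω m k) → ℝ≥0∞) (P : (ℕ → ℕ) → Prop) (M : ℕ → ℕ)
    (σ : ∀ j, Ω j) : ℝ≥0∞ :=
  if GoodMem n m L S f M ∧ P M then F (extState m M σ) else ⊤

variable {L S f : ℕ} {F : (∀ k, ExtSpace Ω m k) → ℝ≥0∞}

theorem guarded_of {P : (ℕ → ℕ) → Prop} (h : GoodMem n m L S f M) (hP : P M) (σ : ∀ j, Ω j) :
    guarded m L S f F P M σ = F (extState m M σ) := if_pos ⟨h, hP⟩

theorem guarded_le {P : (ℕ → ℕ) → Prop} {v : ℝ≥0∞}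
    (h : GoodMem n m L S f M → P M → v ≤ F (extState m M σ)) :
    v ≤ guarded m L S f F P M σ := by
  unfold guarded
  split_ifs with h'
  · exact h h'.1 h'.2
  · exact le_top

theorem guarded_congr {P : (ℕ → ℕ) → Prop} {M M' : ℕ → ℕ} (hM : ∀ x, x ≠ 6 → x ≠ 7 → M' x = M x)
    (hP : P M → P M') (σ : ∀ j, Ω j) :
    guarded m L S f F P M' σ ≤ guarded m L S f F P M σ := by
  refine guarded_le fun h hp => ?_
  rw [guarded_of (h.congr fun x hx => hM x (by omega) (by omega)) (hP hp),
    extState_congr fun x hx => hM x (by omega) (by omega)]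

theorem wp_drawCoin {x : ℕ} {i : Fin m} (hx : M x = i) (hx9 : x ≠ 9) (hL : M 3 = L)
    {g : ULift.{u} ℕ → ℝ≥0∞}
    (hφ : ∀ (M' : ℕ → ℕ) (a : ULift.{u} ℕ), (∀ y, y ≠ 9 → y ≠ 10 → y < 32 → M' y = M y) →
      extState m M' σ = Function.update (extState m M σ) (.inr i) a →
      φ M' σ ≤ g a) :
    Wp A μ w (.block (drawCoin x)) M σ φ (∫⁻ a, g a ∂coinLaw L + 9 * w) := by
  classical
  set M₁ := Function.update (Function.update M 9 32) 9 (32 + (i : ℕ)) with hM₁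
  refine Wp.mono (v := (∫⁻ a, (g a + 3 * w) ∂coinLaw L) + w + w + 2 * w + 2 * w) ?_ ?_
    fun _ _ => le_rfl
  · refine wp_block_det (wp_block_det ?_)
    have h1 : (Instr.add 9 9 x).detMem A ((Instr.const 9 32).detMem A M σ) σ = M₁ := by
      simp [Instr.detMem, hM₁, hx9, hx]
    rw [h1]
    refine wp_block_cons (ψ := fun M' σ' =>
      if ∃ a, M' = Function.update M₁ 10 a ∧ σ' = σ then φ (Function.update M' (M' 9) (M' 10)) σ
        + 3 * w else ⊤) ?_ (wp_rand (by simp [hM₁, hL]) ?_)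
    · intro M' σ'
      split_ifs with h
      · obtain ⟨a, -, rfl⟩ := h
        refine (wp_block_det wp_block_nil).mono ?_ fun _ _ => le_rfl
        simp only [Instr.detMem]
        exact le_of_eq (by ring)
      · exact wp_top _ _ _
    · intro a
      rw [if_pos ⟨a, rfl, rfl⟩]
      refine add_le_add_left (hφ _ (ULift.up a) ?_ ?_) _
      · intro y h9 h10 h32
        have : y ≠ 32 + (i : ℕ) := by omega
        simp [hM₁, h9, h10, this]
      · have h9 : Function.update M₁ 10 a 9 = 32 + (i : ℕ) := by simp [hM₁]
        rw [h9, Function.update_self]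
        refine (extState_update_mem _ σ i (ULift.up a)).trans ?_
        congr 1
        refine extState_congr (fun y hy => ?_) σ
        have h9' : y ≠ 9 := by omega
        have h10' : y ≠ 10 := by omega
        simp [hM₁, h9', h10']
  · have hg : Measurable g := by
      have : g = (fun a : ℕ => g (ULift.up a)) ∘ ULift.down := rfl
      rw [this]
      exact Measurable.of_discrete.comp measurable_down
    rw [lintegral_add_left hg]
    simp only [lintegral_const, measure_univ, mul_one]
    exact le_of_eq (by ring)

open Classical in
/-- The variables with index at least `j` in the scope of `i`, and the coin of `i`. -/
def scopeFrom (A : Fin m → Set (∀ j, Ω j)) (i : Fin m) (j : ℕ) : Finset (Fin n ⊕ Fin m) :=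
  insert (.inr i) ((Finset.univ.filter fun k : Fin n => j ≤ k ∧ k ∈ vbl (A i)).image .inl)

theorem inl_mem_scopeFrom {i : Fin m} {j : ℕ} {k : Fin n} :
    .inl k ∈ scopeFrom A i j ↔ j ≤ k ∧ k ∈ vbl (A i) := by
  simp [scopeFrom]

theorem inr_mem_scopeFrom {i : Fin m} {j : ℕ} {k : Fin m} :
    .inr k ∈ scopeFrom A i j ↔ k = i := by
  simp [scopeFrom]

theorem scopeFrom_of_mem {i : Fin m} {k : Fin n} (hk : k ∈ vbl (A i)) :
    scopeFrom A i k = insert (.inl k) (scopeFrom A i (k + 1)) := by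
  ext (k' | i')
  · simp only [inl_mem_scopeFrom, Finset.mem_insert, Sum.inl.injEq]
    constructor
    · rintro ⟨h1, h2⟩
      by_cases h : k' = k
      · exact Or.inl h
      · exact Or.inr ⟨by have := Fin.val_ne_of_ne h; omega, h2⟩
    · rintro (rfl | ⟨h1, h2⟩)
      · exact ⟨le_rfl, hk⟩
      · exact ⟨by omega, h2⟩
  · simp [inr_mem_scopeFrom]

theorem scopeFrom_of_notMem {i : Fin m} {k : Fin n} (hk : k ∉ vbl (A i)) :
    scopeFrom A i k = scopeFrom A i (k + 1) := by
  ext (k' | i')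
  · simp only [inl_mem_scopeFrom]
    refine ⟨fun ⟨h1, h2⟩ => ⟨?_, h2⟩, fun ⟨h1, h2⟩ => ⟨by omega, h2⟩⟩
    have : k' ≠ k := fun h => hk (h ▸ h2)
    have := Fin.val_ne_of_ne this
    omega
  · simp [inr_mem_scopeFrom]

theorem scopeFrom_last (i : Fin m) : scopeFrom A i n = {.inr i} := by
  ext (k' | i')
  · simp [inl_mem_scopeFrom, k'.2.not_ge]
  · simp [inr_mem_scopeFrom]

/-- The variables in the scope are redrawn in increasing order, so what remains after index j is the
marginal over `scopeFrom A i j`; `lmarginal_insert` peels off one variable per round. The coin comes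
last. -/
theorem wp_fixEvent (hF : Measurable F) (hM : GoodMem n m L S f M) {i : Fin m} (hi : M 8 = i) :
    Wp A μ w fixEvent M σ (guarded m L S f F fun _ => True)
      (lmarginal (extLaw μ m L) (scopeFrom A i 0) F (extState m M σ) + (n * 15 + 18 : ℕ) * w) := by
  classical
  set ν := extLaw μ m L with hν
  set θ : ℕ → (ℕ → ℕ) → (∀ j, Ω j) → ℝ≥0∞ := fun j =>
    guarded m L S f (lmarginal ν (scopeFrom A i j) F) fun M => M 8 = i with hθ
  have hloop : Wp A μ w (.forLoop 6 0 7 (.block [.basic (.depends 9 8 6),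
      .ite 9 (.basic (.resample 6)) (.block [])])) M σ (θ n)
      (θ 0 M σ + (n * (6 + 9) + 8 : ℕ) * w) := by
    refine wp_forLoop (by norm_num) (by norm_num) (by norm_num) θ ?_ ?_ hM.1 fun _ _ => le_rfl
    · intro j M M' σ hx
      exact guarded_congr hx (fun h => by rw [hx 8 (by norm_num) (by norm_num), h]) σ
    · intro j hj M σ h6 _
      by_cases hg : GoodMem n m L S f M ∧ M 8 = i
      swap
      · refine (wp_top _ _ _).mono ?_ fun _ _ => le_rfl
        simp [hθ, guarded, hg]
      obtain ⟨hg, h8⟩ := hg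
      set k : Fin n := ⟨j, hj⟩ with hk
      refine Wp.mono (v := (w + (lmarginal ν (scopeFrom A i j) F (extState m M σ) + w)) + w + w
        + 2 * w) (wp_block_det (wp_block_cons (fun _ _ => wp_block_nil) (Wp.frame ?_ w)))
        ?_ fun _ _ => le_rfl
      · have hx : (∃ (hi : M 8 < m) (hj : M 6 < n), (⟨M 6, hj⟩ : Fin n) ∈ vbl (A ⟨M 8, hi⟩)) ↔
            k ∈ vbl (A i) := by
          have h1 : M 8 < m := h8 ▸ i.2
          have h2 : M 6 < n := h6 ▸ hj
          have h3 : (⟨M 8, h1⟩ : Fin m) = i := Fin.ext h8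
          have h4 : (⟨M 6, h2⟩ : Fin n) = k := Fin.ext h6
          simp only [h1, h2, exists_true_left, h3, h4]
        set M₁ := (Instr.depends 9 8 6).detMem A M σ with hM₁
        have hM₁x : ∀ x, x ≠ 9 → M₁ x = M x := fun x hx => by
          simp [hM₁, Instr.detMem, hx]
        have hg₁ : GoodMem n m L S f M₁ := hg.congr fun x hx => hM₁x x (by omega)
        have h8₁ : M₁ 8 = i := by rw [hM₁x 8 (by norm_num), h8]
        have he₁ : extState m M₁ σ = extState m M σ :=
          extState_congr (fun x hx => hM₁x x (by omega)) σ
        have h9 : M₁ 9 = if k ∈ vbl (A i) then 1 else 0 := by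
          simp only [hM₁, Instr.detMem, Function.update_self, hx]
        have h60 : M₁ 6 = j ∧ M₁ 0 = n := ⟨by rw [hM₁x 6 (by norm_num), h6], hg₁.1⟩
        refine wp_ite (fun hne => ?_) (fun he => ?_)
        · have hmem : k ∈ vbl (A i) := by
            by_contra h
            rw [h9, if_neg h] at hne
            exact hne rfl
          refine (wp_resample (j := k) (g := fun a => lmarginal ν (scopeFrom A i (j + 1)) F
            (Function.update (extState m M σ) (.inl k) a)) h60.1 ?_ fun a => ?_).mono ?_
            fun _ _ => le_rfl
          · exact (hF.lmarginal ν).comp (measurable_update (extState m M σ) (a := .inl k))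
          · rw [if_pos h60]
            refine (guarded_of hg₁ h8₁ _).trans_le ?_
            refine le_of_eq (congrArg _ ((extState_update_asg M₁ σ k a).trans ?_))
            rw [he₁]
          · refine add_le_add_left ?_ w
            have := lmarginal_insert (μ := ν) F hF (i := .inl k) (s := scopeFrom A i (j + 1))
              (by simp [inl_mem_scopeFrom, hk]) (extState m M σ)
            rw [← scopeFrom_of_mem hmem] at this
            exact this.ge
        · have hmem : k ∉ vbl (A i) := by
            intro h
            rw [h9, if_pos h] at he
            exact one_ne_zero he
          refine wp_block_nil.mono (add_le_add_left ?_ w) fun _ _ => le_rfl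
          rw [if_pos h60]
          refine (guarded_of hg₁ h8₁ _).trans_le ?_
          rw [he₁, ← scopeFrom_of_notMem hmem]
      · rw [hθ]
        beta_reduce
        rw [guarded_of hg h8]
        push_cast
        exact le_of_eq (by ring)
  refine (wp_block_cons (ψ := fun M' σ' => θ n M' σ' + 9 * w) ?_ (hloop.frame (9 * w))).mono ?_
    fun _ _ => le_rfl
  · intro M σ
    by_cases hg : GoodMem n m L S f M ∧ M 8 = i
    swap
    · refine (wp_top _ _ _).mono ?_ fun _ _ => le_rfl
      simp [hθ, guarded, hg]
    obtain ⟨hg, h8⟩ := hg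
    refine (wp_drawCoin (i := i) (g := fun a => F (Function.update (extState m M σ) (.inr i) a))
      h8 (by norm_num) hg.2.2.1 ?_).mono ?_ fun _ _ => le_rfl
    · intro M' a hM' he
      rw [guarded_of (hg.congr fun x hx => hM' x (by omega) (by omega) (by omega)) trivial, he]
    · refine add_le_add_left ?_ _
      rw [hθ]
      beta_reduce
      rw [guarded_of hg h8, scopeFrom_last, lmarginal_singleton]
      exact le_rfl
  · rw [hθ]
    beta_reduce
    rw [guarded_of hM hi]
    push_cast
    exact le_of_eq (by ring)

end Coins

end MTBeyond
end

noncomputable section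
namespace MTBeyond

/-! ### Initialization, search for active events and the main loop -/

section MainLoop

set_option linter.unusedSectionVars false

universe u

variable {n m : ℕ} {Ω : Fin n → Type u} [∀ j, MeasurableSpace (Ω j)]
  {A : Fin m → Set (∀ j, Ω j)} {μ : ∀ j, Measure (Ω j)} [∀ j, IsProbabilityMeasure (μ j)]
  {w : ℝ≥0∞} {M : ℕ → ℕ} {σ : ∀ j, Ω j} {φ : (ℕ → ℕ) → (∀ j, Ω j) → ℝ≥0∞}
  {L S f : ℕ} {F : (∀ k, ExtSpace Ω m k) → ℝ≥0∞}

open Classical in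
/-- All coins, and the variables with index at least `j`. -/
def allFrom (n m j : ℕ) : Finset (Fin n ⊕ Fin m) :=
  Finset.univ.filter fun k => Sum.elim (fun k : Fin n => j ≤ k) (fun _ : Fin m => True) k

open Classical in
/-- The coins with index at least `i`. -/
def coinsFrom (n m i : ℕ) : Finset (Fin n ⊕ Fin m) :=
  Finset.univ.filter fun k => Sum.elim (fun _ : Fin n => False) (fun k : Fin m => i ≤ k) k

theorem allFrom_zero : allFrom n m 0 = Finset.univ := by
  ext (k | k) <;> simp [allFrom]

theorem allFrom_last : allFrom n m n = coinsFrom n m 0 := by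
  ext (k | k) <;> simp [allFrom, coinsFrom]

theorem coinsFrom_last : coinsFrom n m m = ∅ := by
  ext (k | k) <;> simp [coinsFrom]

theorem allFrom_eq (k : Fin n) : allFrom n m k = insert (.inl k) (allFrom n m (k + 1)) := by
  ext (k' | i')
  · simp only [allFrom, Finset.mem_filter, Finset.mem_univ, true_and, Finset.mem_insert,
      Sum.inl.injEq, Sum.elim_inl, Fin.ext_iff]
    omega
  · simp [allFrom]

theorem coinsFrom_eq (i : Fin m) : coinsFrom n m i = insert (.inr i) (coinsFrom n m (i + 1)) := by
  ext (k' | i')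
  · simp [coinsFrom]
  · simp only [coinsFrom, Finset.mem_filter, Finset.mem_univ, true_and, Finset.mem_insert,
      Sum.inr.injEq, Sum.elim_inr, Fin.ext_iff]
    omega

/-- Everything is redrawn, so the starting assignment is forgotten and the marginal becomes the
integral over the product law, where the bounds on the potentials live. -/
theorem wp_initAll (hF : Measurable F) (hM : GoodMem n m L S f M) :
    Wp A μ w initAll M σ (guarded m L S f F fun _ => True)
      (∫⁻ x, F x ∂Measure.pi (extLaw μ m L) + (n * 10 + m * 18 + 19 : ℕ) * w) := by
  classical
  set ν := extLaw μ m L with hν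
  set θ : ℕ → (ℕ → ℕ) → (∀ j, Ω j) → ℝ≥0∞ := fun j =>
    guarded m L S f (lmarginal ν (allFrom n m j) F) fun _ => True with hθ
  set θ' : ℕ → (ℕ → ℕ) → (∀ j, Ω j) → ℝ≥0∞ := fun i =>
    guarded m L S f (lmarginal ν (coinsFrom n m i) F) fun _ => True with hθ'
  have hloop : Wp A μ w (.forLoop 6 0 7 (.basic (.resample 6))) M σ (θ n)
      (θ 0 M σ + (n * (1 + 9) + 8 : ℕ) * w) := by
    refine wp_forLoop (by norm_num) (by norm_num) (by norm_num) θ ?_ ?_ hM.1 fun _ _ => le_rfl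
    · intro j M M' σ hx
      exact guarded_congr hx (fun _ => trivial) σ
    · intro j hj M σ h6 h0
      by_cases hg : GoodMem n m L S f M
      swap
      · refine (wp_top _ _ _).mono ?_ fun _ _ => le_rfl
        simp [hθ, guarded, hg]
      set k : Fin n := ⟨j, hj⟩ with hk
      refine (wp_resample (j := k) (g := fun a => lmarginal ν (allFrom n m (j + 1)) F
        (Function.update (extState m M σ) (.inl k) a)) h6 ?_ fun a => ?_).mono ?_
        fun _ _ => le_rfl
      · exact (hF.lmarginal ν).comp (measurable_update (extState m M σ) (a := .inl k))
      · rw [if_pos ⟨h6, h0⟩]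
        refine (guarded_of hg trivial _).trans_le ?_
        exact le_of_eq (congrArg _ (extState_update_asg M σ k a))
      · rw [Nat.cast_one, one_mul]
        refine add_le_add_left ?_ w
        have := lmarginal_insert (μ := ν) F hF (i := .inl k) (s := allFrom n m (j + 1))
          (by simp [allFrom, hk]) (extState m M σ)
        rw [← allFrom_eq] at this
        exact this.ge.trans_eq (guarded_of hg trivial _).symm
  have hloop' : ∀ M σ, Wp A μ w (.forLoop 6 1 7 (.block (drawCoin 6))) M σ
      (guarded m L S f F fun _ => True) (θ' 0 M σ + (m * (9 + 9) + 8 : ℕ) * w) := by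
    intro M σ
    by_cases hg : GoodMem n m L S f M
    swap
    · refine (wp_top _ _ _).mono ?_ fun _ _ => le_rfl
      simp [hθ', guarded, hg]
    refine wp_forLoop (by norm_num) (by norm_num) (by norm_num) θ' ?_ ?_ hg.2.1 fun M' σ' => ?_
    · intro j M M' σ hx
      exact guarded_congr hx (fun _ => trivial) σ
    · intro j hj M σ h6 h1
      by_cases hg : GoodMem n m L S f M
      swap
      · refine (wp_top _ _ _).mono ?_ fun _ _ => le_rfl
        simp [hθ', guarded, hg]
      set k : Fin m := ⟨j, hj⟩ with hk
      refine (wp_drawCoin (i := k) (g := fun a => lmarginal ν (coinsFrom n m (j + 1)) F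
        (Function.update (extState m M σ) (.inr k) a)) h6 (by norm_num) hg.2.2.1 ?_).mono ?_
        fun _ _ => le_rfl
      · intro M' a hM' he
        rw [if_pos ⟨by rw [hM' 6 (by norm_num) (by norm_num) (by norm_num), h6],
          by rw [hM' 1 (by norm_num) (by norm_num) (by norm_num), h1]⟩]
        refine (guarded_of (hg.congr fun x hx => hM' x (by omega) (by omega) (by omega))
          trivial _).trans_le ?_
        rw [he]
      · refine add_le_add_left ?_ _
        have := lmarginal_insert (μ := ν) F hF (i := .inr k) (s := coinsFrom n m (j + 1))
          (by simp [coinsFrom, hk]) (extState m M σ)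
        rw [← coinsFrom_eq] at this
        exact this.ge.trans_eq (guarded_of hg trivial _).symm
    · rw [hθ']
      beta_reduce
      rw [coinsFrom_last, lmarginal_empty]
  refine (wp_block_cons (ψ := fun M' σ' => θ n M' σ' + (m * 18 + 8 + 2 : ℕ) * w) ?_
    (hloop.frame _)).mono ?_ fun _ _ => le_rfl
  · intro M' σ'
    refine (wp_block_cons (ψ := fun M' σ' => guarded m L S f F (fun _ => True) M' σ' + w)
      (fun _ _ => wp_block_nil) ((hloop' M' σ').frame w)).mono ?_ fun _ _ => le_rfl
    rw [hθ, hθ']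
    beta_reduce
    rw [allFrom_last]
    push_cast
    exact le_of_eq (by ring)
  · rw [hθ]
    beta_reduce
    rw [guarded_of hM trivial, allFrom_zero, lmarginal_univ]
    push_cast
    exact le_of_eq (by ring)

/-- The event `A i` holds and its coin is smaller than `S`. -/
def activeSet (A : Fin m → Set (∀ j, Ω j)) (S : ℕ) (i : Fin m) : Set (∀ k, ExtSpace Ω m k) :=
  {x | ULift.down (x (.inr i)) < S ∧ (fun j => x (.inl j)) ∈ A i}

/-- The scan does not stop at a hit, so cell 8 ends with the last active event. The choice is
immaterial, because the potentials tolerate resampling any active event. -/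
theorem runs_scanEvents (hM : GoodMem n m L S 0 M) :
    Runs A μ w scanEvents M σ (m * 29 + 8) fun M' =>
      extState m M' σ = extState m M σ ∧
      ((GoodMem n m L S 0 M' ∧ ∀ i, extState m M σ ∉ activeSet A S i) ∨
        (GoodMem n m L S 1 M' ∧ ∃ k : Fin m, M' 8 = k ∧ extState m M σ ∈ activeSet A S k)) := by
  classical
  set Inv : ℕ → (ℕ → ℕ) → Prop := fun j M' => (∀ x, 32 ≤ x → M' x = M x) ∧
    ((GoodMem n m L S 0 M' ∧ ∀ i : Fin m, (i : ℕ) < j → extState m M σ ∉ activeSet A S i) ∨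
      (GoodMem n m L S 1 M' ∧ ∃ k : Fin m, M' 8 = k ∧ extState m M σ ∈ activeSet A S k)) with hInv
  refine Runs.mono (runs_forLoop (N := m) (b := 20) (by norm_num) (by norm_num) (by norm_num)
    Inv ?_ ?_ hM.2.1 ?_) le_rfl ?_
  · intro j M₁ M₂ hx h
    obtain ⟨h1, h2⟩ := h
    refine ⟨fun x h32 => by rw [hx x (by omega) (by omega), h1 x h32], ?_⟩
    rcases h2 with ⟨h3, h4⟩ | ⟨h3, h4⟩
    · exact Or.inl ⟨h3.congr fun x h => hx x (by omega) (by omega), h4⟩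
    · exact Or.inr ⟨h3.congr fun x h => hx x (by omega) (by omega),
        by rwa [hx 8 (by norm_num) (by norm_num)]⟩
  · intro j hj M₁ h6 h1 hI
    set k : Fin m := ⟨j, hj⟩ with hk
    refine Runs.mono (k₁ := (7 + 1 + 1) + 2 + 2 + 2 + 2 + 2) (runs_block_det (runs_block_det
      (runs_block_det (runs_block_det (runs_block_det
        (runs_block_cons (k₁ := 7) (k₂ := 1)
        (Q₁ := fun M' => M' 6 = j ∧ M' 1 = m ∧ Inv (j + 1) M') ?_ fun M' h => runs_block_nil h))))))
          (by norm_num) fun _ h => h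
    set M₂ := (Instr.verify 10 6).detMem A ((Instr.sub 9 4 9).detMem A ((Instr.load 9 9).detMem A
      ((Instr.add 9 9 6).detMem A ((Instr.const 9 32).detMem A M₁ σ) σ) σ) σ) σ with hM₂
    have hx : ∀ x, x ≠ 9 → x ≠ 10 → M₂ x = M₁ x := fun x h9 h10 => by
      simp [hM₂, Instr.detMem, h9, h10]
    have h4 : M₁ 4 = S := by rcases hI.2 with h | h <;> exact h.1.2.2.2.1
    have h9 : M₂ 9 = S - M (32 + j) := by
      have := hI.1 (32 + j) (by omega)
      simp [hM₂, Instr.detMem, h6, h4]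
      have h' : 32 + j ≠ 9 := by omega
      rw [Function.update_of_ne h', this]
    have h10 : M₂ 10 = if σ ∈ A k then 1 else 0 := by
      have h6' : (⟨M₁ 6, h6 ▸ hj⟩ : Fin m) = k := Fin.ext h6
      have h6m : M₁ 6 < m := h6 ▸ hj
      simp [hM₂, Instr.detMem, h6m, h6']
    -- The truncated difference of S and the coin is nonzero exactly if the coin is below S.
    have hact : extState m M σ ∈ activeSet A S k ↔ M₂ 9 ≠ 0 ∧ M₂ 10 ≠ 0 := by
      have : extState m M σ ∈ activeSet A S k ↔ M (32 + j) < S ∧ σ ∈ A k := Iff.rfl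
      rw [this, h9, h10]
      by_cases hσ : σ ∈ A k <;> simp [hσ]
      omega
    have h32 : ∀ x, 32 ≤ x → M₂ x = M x := fun x h => by
      rw [hx x (by omega) (by omega), hI.1 x h]
    have hg : ∀ f, GoodMem n m L S f M₁ → GoodMem n m L S f M₂ := fun f h =>
      h.congr fun x h => hx x (by omega) (by omega)
    have hskip : extState m M σ ∉ activeSet A S k → Inv (j + 1) M₂ := by
      intro hn
      refine ⟨h32, ?_⟩
      rcases hI.2 with ⟨h3, h4⟩ | ⟨h3, h4⟩
      · refine Or.inl ⟨hg _ h3, fun i hi => ?_⟩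
        rcases Nat.lt_succ_iff_lt_or_eq.1 hi with h | h
        · exact h4 i h
        · obtain rfl : i = k := Fin.ext h
          exact hn
      · exact Or.inr ⟨hg _ h3, by rwa [hx 8 (by norm_num) (by norm_num)]⟩
    have h61 : M₂ 6 = j ∧ M₂ 1 = m :=
      ⟨by rw [hx 6 (by norm_num) (by norm_num), h6], by rw [hx 1 (by norm_num) (by norm_num), h1]⟩
    refine runs_ite (k := 6) (fun hne => runs_ite (k := 5) (fun hne' => ?_) fun he => ?_)
      fun he => ?_
    · refine runs_block_det (runs_block_det (runs_block_nil ?_))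
      simp only [Instr.detMem]
      refine ⟨by simp [h61.1], by simp [h61.2], fun x h => ?_,
        Or.inr ⟨?_, k, ?_, hact.2 ⟨hne, hne'⟩⟩⟩
      · have h5 : x ≠ 5 := by omega
        have h8 : x ≠ 8 := by omega
        simp [h5, h8, h32 x h]
      · have hg2 : ∃ f, GoodMem n m L S f M₂ := by
          rcases hI.2 with h | h
          · exact ⟨_, hg _ h.1⟩
          · exact ⟨_, hg _ h.1⟩
        obtain ⟨f, g0, g1, g3, g4, -⟩ := hg2
        exact ⟨by simp [g0], by simp [g1], by simp [g3], by simp [g4], by simp⟩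
      · simp [h61.1, hk]
    · exact (runs_block_nil ⟨h61.1, h61.2, hskip fun h => (hact.1 h).2 he⟩).mono (by norm_num)
        fun _ h => h
    · exact (runs_block_nil ⟨h61.1, h61.2, hskip fun h => (hact.1 h).1 he⟩).mono (by norm_num)
        fun _ h => h
  · exact ⟨fun _ _ => rfl, Or.inl ⟨hM, fun i hi => absurd hi (Nat.not_lt_zero _)⟩⟩
  · rintro M' ⟨h1, h2⟩
    refine ⟨extState_congr h1 σ, h2.imp (fun h => ⟨h.1, fun i => h.2 i i.2⟩) fun h => h⟩

/-- Number of steps that suffices for one round of the main loop. -/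
def roundCost (n m : ℕ) : ℕ := n * 15 + m * 29 + 40

/-- By `hstep`, each resampling lowers the potential F in expectation by the price of a whole round.
Only the last round, which finds nothing, is paid from the additive constant. -/
theorem wp_resampleLoop (hF : Measurable F)
    (hstep : ∀ i, ∀ x ∈ activeSet A S i,
      roundCost n m * w + lmarginal (extLaw μ m L) (scopeFrom A i 0) F x ≤ F x)
    (hφ : ∀ M σ, GoodMem n m L S 0 M → (∀ i, extState m M σ ∉ activeSet A S i) →
      φ M σ ≤ F (extState m M σ))
    (hM : GoodMem n m L S f M) :
    Wp A μ w resampleLoop M σ φ (F (extState m M σ) + (roundCost n m + 5 : ℕ) * w) := by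
  classical
  -- With flag 1 the price of the coming round is held in reserve. Flag 0 is admitted only when no
  -- event is active, and only the exit test remains.
  set I : (ℕ → ℕ) → (∀ j, Ω j) → ℝ≥0∞ := fun M σ =>
    if GoodMem n m L S 1 M then F (extState m M σ) + (roundCost n m : ℕ) * w
    else if GoodMem n m L S 0 M ∧ ∀ i, extState m M σ ∉ activeSet A S i then
      F (extState m M σ) + w else ⊤ with hI
  have hI1 : ∀ M σ, GoodMem n m L S 1 M →
      I M σ = F (extState m M σ) + (roundCost n m : ℕ) * w := fun M σ h => if_pos h
  have hI0 : ∀ M σ, GoodMem n m L S 0 M → (∀ i, extState m M σ ∉ activeSet A S i) →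
      I M σ = F (extState m M σ) + w := by
    intro M σ h h'
    have : ¬ GoodMem n m L S 1 M := fun h1 => by
      have := h.2.2.2.2.symm.trans h1.2.2.2.2
      omega
    simp only [hI]
    rw [if_neg this, if_pos ⟨h, h'⟩]
  have hloop : ∀ M σ, Wp A μ w (.loop 5 (.block [.basic (.const 5 0), scanEvents,
      .ite 5 fixEvent (.block [])])) M σ φ (I M σ) := by
    refine wp_loop I ?_ ?_
    · intro M σ h0
      simp only [hI]
      split_ifs with h1 h2
      · exact absurd (h1.2.2.2.2.symm.trans h0) (by norm_num)
      · rw [add_comm]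
        exact add_le_add_left (hφ M σ h2.1 h2.2) w
      · exact le_top
    · intro M σ h0
      by_cases h1 : GoodMem n m L S 1 M
      swap
      · refine ⟨⊤, wp_top _ _ _, ?_⟩
        have h2 : ¬ GoodMem n m L S 0 M := fun h => h0 h.2.2.2.2
        simp [hI, h1, h2]
      set M₁ := (Instr.const 5 0).detMem A M σ with hM₁
      have hx : ∀ x, x ≠ 5 → M₁ x = M x := fun x hx => by simp [hM₁, Instr.detMem, hx]
      have he₁ : extState m M₁ σ = extState m M σ := extState_congr (fun x h => hx x (by omega)) σ
      have hg₁ : GoodMem n m L S 0 M₁ := by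
        obtain ⟨g0, g1, g3, g4, -⟩ := h1
        exact ⟨by rw [hx 0 (by norm_num), g0], by rw [hx 1 (by norm_num), g1],
          by rw [hx 3 (by norm_num), g3], by rw [hx 4 (by norm_num), g4],
          by simp [hM₁, Instr.detMem]⟩
      refine ⟨_, wp_block_det (wp_block_cons (ψ := fun M' σ' =>
        if σ' = σ ∧ extState m M' σ = extState m M₁ σ ∧
          ((GoodMem n m L S 0 M' ∧ ∀ i, extState m M₁ σ ∉ activeSet A S i) ∨
            (GoodMem n m L S 1 M' ∧ ∃ k : Fin m, M' 8 = k ∧ extState m M₁ σ ∈ activeSet A S k))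
        then F (extState m M σ) + (n * 15 + 18 + 3 : ℕ) * w else ⊤) ?_ ((runs_scanEvents hg₁).wp
          (v := F (extState m M σ) + (n * 15 + 18 + 3 : ℕ) * w) ?_)), ?_⟩
      · intro M' σ'
        split_ifs with h
        swap
        · exact wp_top _ _ _
        obtain ⟨rfl, he, h⟩ := h
        rw [he₁] at he
        refine Wp.mono (v := (w + (F (extState m M σ') + (n * 15 + 18 : ℕ) * w + w)) + w)
          (wp_block_cons (ψ := fun M' σ' => I M' σ' + w) (fun _ _ => wp_block_nil)
            (wp_ite (fun hne => ?_) fun he0 => ?_)) ?_ fun _ _ => le_rfl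
        · rcases h with h | ⟨h, k, hk8, hk⟩
          · exact absurd h.1.2.2.2.2 hne
          rw [he₁] at hk
          refine ((wp_fixEvent hF h hk8).frame (roundCost n m * w + w)).mono ?_ fun M'' σ'' => ?_
          · rw [he]
            calc _ = (roundCost n m * w + lmarginal (extLaw μ m L) (scopeFrom A k 0) F
                    (extState m M σ')) + ((n * 15 + 18 : ℕ) : ℝ≥0∞) * w + w := by ring
              _ ≤ _ := by
                gcongr
                exact hstep k _ hk
          · rw [← add_assoc]
            refine add_le_add_left ?_ w
            by_cases hg : GoodMem n m L S 1 M''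
            · rw [hI1 _ _ hg, guarded_of hg trivial]
            · simp [guarded, hg]
        · rcases h with ⟨h, hn⟩ | ⟨h, -⟩
          swap
          · rw [h.2.2.2.2] at he0
            exact absurd he0 one_ne_zero
          rw [he₁, ← he] at hn
          refine wp_block_nil.mono ?_ fun _ _ => le_rfl
          rw [hI0 _ _ h hn, he]
          have h2w : w + w ≤ ((n * 15 + 18 : ℕ) : ℝ≥0∞) * w := by
            rw [← two_mul]
            gcongr
            norm_cast
            omega
          calc _ = F (extState m M σ') + (w + w) + w := by ring
            _ ≤ _ := add_le_add (add_le_add le_rfl h2w) le_rfl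
        · push_cast
          exact le_of_eq (by ring)
      · rintro M' ⟨h2, h3⟩
        rw [if_pos ⟨rfl, h2, h3⟩]
      · rw [hI1 _ _ h1, roundCost]
        calc _ = F (extState m M σ) + ((n * 15 + m * 29 + 33 : ℕ) : ℝ≥0∞) * w := by
              push_cast
              ring
          _ ≤ _ := by
              gcongr
              norm_num
  refine (wp_block_det (wp_block_cons (ψ := fun M' σ' => φ M' σ' + w)
    (fun _ _ => wp_block_nil) ((hloop _ _).frame w))).mono ?_ fun _ _ => le_rfl
  set M₁ := (Instr.const 5 1).detMem A M σ with hM₁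
  have hx : ∀ x, x ≠ 5 → M₁ x = M x := fun x hx => by simp [hM₁, Instr.detMem, hx]
  have hg₁ : GoodMem n m L S 1 M₁ := by
    obtain ⟨g0, g1, g3, g4, -⟩ := hM
    exact ⟨by rw [hx 0 (by norm_num), g0], by rw [hx 1 (by norm_num), g1],
      by rw [hx 3 (by norm_num), g3], by rw [hx 4 (by norm_num), g4],
      by simp [hM₁, Instr.detMem]⟩
  rw [hI1 _ _ hg₁, extState_congr (fun x h => hx x (by omega)) σ]
  calc _ = F (extState m M σ) + ((roundCost n m + 4 : ℕ) : ℝ≥0∞) * w := by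
        push_cast
        ring
    _ ≤ _ := by
        gcongr
        norm_num

/-- Expected cost of the whole algorithm. -/
theorem wp_algorithm {c : Cmd} {k : ℕ} (hF : Measurable F)
    (hstep : ∀ i, ∀ x ∈ activeSet A S i,
      roundCost n m * w + lmarginal (extLaw μ m L) (scopeFrom A i 0) F x ≤ F x)
    (hφ : ∀ M σ, GoodMem n m L S 0 M → (∀ i, extState m M σ ∉ activeSet A S i) →
      φ M σ ≤ F (extState m M σ))
    (hc : Runs A μ w c M σ k fun M' => ∃ f, GoodMem n m L S f M') :
    Wp A μ w (algorithm c) M σ φ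
      (∫⁻ x, F x ∂Measure.pi (extLaw μ m L) + (k + 2 * roundCost n m : ℕ) * w) := by
  classical
  refine (wp_block_cons (ψ := fun M' σ' => if ∃ f, GoodMem n m L S f M' then
    ∫⁻ x, F x ∂Measure.pi (extLaw μ m L) + (n * 10 + m * 18 + 19 + roundCost n m + 5 + 3 : ℕ) * w
    else ⊤) ?_ (hc.wp (v := ∫⁻ x, F x ∂Measure.pi (extLaw μ m L) +
      (n * 10 + m * 18 + 19 + roundCost n m + 5 + 3 : ℕ) * w) ?_)).mono ?_ fun _ _ => le_rfl
  · intro M σ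
    split_ifs with h
    swap
    · exact wp_top _ _ _
    obtain ⟨f, hM⟩ := h
    refine (wp_block_cons (ψ := fun M' σ' => guarded m L S f F (fun _ => True) M' σ' +
      (roundCost n m + 5 + 2 : ℕ) * w) ?_ ((wp_initAll hF hM).frame _)).mono ?_ fun _ _ => le_rfl
    · intro M σ
      by_cases hg : GoodMem n m L S f M
      swap
      · refine (wp_top _ _ _).mono ?_ fun _ _ => le_rfl
        simp [guarded, hg]
      refine (wp_block_cons (ψ := fun M' σ' => φ M' σ' + w)
        (fun _ _ => wp_block_nil) ((wp_resampleLoop hF hstep hφ hg).frame w)).mono ?_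
        fun _ _ => le_rfl
      rw [guarded_of hg trivial]
      push_cast
      exact le_of_eq (by ring)
    · push_cast
      exact le_of_eq (by ring)
  · intro M' h
    rw [if_pos h]
  · calc _ = ∫⁻ x, F x ∂Measure.pi (extLaw μ m L) +
          ((n * 10 + m * 18 + 19 + roundCost n m + 5 + 3 + k + 1 : ℕ) : ℝ≥0∞) * w := by
          push_cast
          ring
      _ ≤ _ := by
          have hk : n * 10 + m * 18 + 19 + roundCost n m + 5 + 3 + k + 1 ≤
            k + 2 * roundCost n m := by
            unfold roundCost
            omega
          gcongr _ + ?_ * w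
          exact_mod_cast hk

end MainLoop

end MTBeyond
end

noncomputable section
namespace MTBeyond

/-! ## Bounds for the algorithm -/

section Bounds

set_option linter.unusedSectionVars false

universe u

variable {n m : ℕ} {Ω : Fin n → Type u}

/-- The cap L - 1 in `coinValue` does not interfere, because S ≤ L - 1. -/
theorem coinValue_lt_iff {L S : ℕ} (hL : 1 ≤ L) (hS : S < L) (r : unitInterval) :
    coinValue L r < S ↔ (r : ℝ) < S / L := by
  have hL' : (0 : ℝ) < L := by exact_mod_cast hL
  have h : coinValue L r < S ↔ ⌊(r : ℝ) * (L : ℝ)⌋₊ < S := by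
    unfold coinValue
    omega
  rw [h, Nat.floor_lt (mul_nonneg r.2.1 hL'.le), lt_div_iff₀ hL']

theorem coinLaw_lt {L S : ℕ} (hL : 1 ≤ L) (hS : S ≤ L) :
    coinLaw.{u} L {a | ULift.down a < S} = ENNReal.ofReal (S / L) ∧
      coinLaw.{u} L {a | S ≤ ULift.down a} = ENNReal.ofReal (1 - S / L) := by
  have hL' : (0 : ℝ) < L := by exact_mod_cast hL
  have h1 : coinLaw.{u} L {a | ULift.down a < S} = volume {r | coinValue L r < S} :=
    Measure.map_apply (measurable_up_coinValue L) (measurable_down (measurableSet_Iio (a := S)))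
  have h2 : coinLaw.{u} L {a | S ≤ ULift.down a} = volume {r | S ≤ coinValue L r} :=
    Measure.map_apply (measurable_up_coinValue L) (measurable_down (measurableSet_Ici (a := S)))
  rw [h1, h2]
  rcases hS.lt_or_eq with hS | rfl
  · have hq : (S : ℝ) / L ∈ unitInterval :=
      ⟨by positivity, (div_le_one hL').2 (by exact_mod_cast hS.le)⟩
    have e1 : {r : unitInterval | coinValue L r < S} = Set.Iio ⟨_, hq⟩ := by
      ext r
      exact coinValue_lt_iff hL hS r
    have e2 : {r : unitInterval | S ≤ coinValue L r} = Set.Ici ⟨_, hq⟩ := by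
      ext r
      exact not_lt.symm.trans ((coinValue_lt_iff hL hS r).not.trans not_lt)
    rw [e1, e2, unitInterval.volume_Iio, unitInterval.volume_Ici]
    exact ⟨rfl, rfl⟩
  -- For S = L the cap matters: it excludes the value L at r = 1.
  · have hlt : ∀ r, coinValue S r < S := fun r => by
      unfold coinValue
      omega
    have e1 : {r : unitInterval | coinValue S r < S} = Set.univ := Set.eq_univ_of_forall hlt
    have e2 : {r : unitInterval | S ≤ coinValue S r} = ∅ :=
      Set.eq_empty_of_forall_notMem fun r h => (hlt r).not_ge h
    rw [e1, e2, div_self hL'.ne']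
    simp

variable [∀ j, MeasurableSpace (Ω j)] {A : Fin m → Set (∀ j, Ω j)}

/-- The event `A i` holds and its coin has a value in `T`. -/
def coinSet (A : Fin m → Set (∀ j, Ω j)) (T : Set ℕ) (i : Fin m) : Set (∀ k, ExtSpace Ω m k) :=
  {x | ULift.down (x (.inr i)) ∈ T ∧ (fun j => x (.inl j)) ∈ A i}

theorem mem_coinSet_congr {T : Set ℕ} {i : Fin m} {x y : ∀ k, ExtSpace Ω m k}
    (h : ∀ k ∈ scopeFrom A i 0, x k = y k) : x ∈ coinSet A T i ↔ y ∈ coinSet A T i :=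
  and_congr (iff_of_eq (congrArg (fun a : ULift.{u} ℕ => ULift.down a ∈ T)
      (h (.inr i) (inr_mem_scopeFrom.2 rfl))))
    (determinedBy_vbl (A i) _ _ fun j hj =>
      h (.inl j) (inl_mem_scopeFrom.2 ⟨Nat.zero_le _, hj⟩))

open Classical in
/-- The closed neighborhoods in the dependency graph. -/
def closedNbhd (A : Fin m → Set (∀ j, Ω j)) (i : Fin m) : Finset (Fin m) :=
  Finset.univ.filter fun k => k = i ∨ (vbl (A i) ∩ vbl (A k)).Nonempty

theorem mem_closedNbhd {i k : Fin m} :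
    k ∈ closedNbhd A i ↔ k = i ∨ (vbl (A i) ∩ vbl (A k)).Nonempty := by
  simp [closedNbhd]

theorem closedNbhd_symm {i k : Fin m} (h : i ∈ closedNbhd A k) : k ∈ closedNbhd A i := by
  rw [mem_closedNbhd] at h ⊢
  rwa [Set.inter_comm, eq_comm]

theorem card_closedNbhd (i : Fin m) :
    (closedNbhd A i).card = ((dependencyGraph A).neighborSet i).ncard + 1 := by
  classical
  have h : (closedNbhd A i : Set (Fin m)) = insert i ((dependencyGraph A).neighborSet i) := by
    ext k
    simp only [Finset.mem_coe, mem_closedNbhd, Set.mem_insert_iff, SimpleGraph.mem_neighborSet,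
      dependencyGraph]
    by_cases hk : k = i
    · simp [hk]
    · simp [hk, Ne.symm hk]
  rw [← Set.ncard_coe_finset, h, Set.ncard_insert_of_notMem (by simp)]

theorem disjoint_scopeFrom {i k : Fin m} (h : k ∉ closedNbhd A i) :
    Disjoint (scopeFrom A i 0) (scopeFrom A k 0) := by
  rw [mem_closedNbhd, not_or] at h
  refine Finset.disjoint_left.2 ?_
  rintro (j | l) h1 h2
  · exact h.2 ⟨j, (inl_mem_scopeFrom.1 h1).2, (inl_mem_scopeFrom.1 h2).2⟩
  · exact h.1 ((inr_mem_scopeFrom.1 h2).symm.trans (inr_mem_scopeFrom.1 h1))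

theorem measurableSet_coinSet (hA : ∀ i, MeasurableSet (A i)) (T : Set ℕ) (i : Fin m) :
    MeasurableSet (coinSet A T i) := by
  refine MeasurableSet.inter ?_ ?_
  · exact (measurable_down.comp (measurable_pi_apply (Sum.inr i : Fin n ⊕ Fin m)))
      (MeasurableSet.of_discrete (s := T))
  · exact (measurable_pi_lambda (fun (x : ∀ k, ExtSpace Ω m k) (j : Fin n) => x (.inl j))
      fun j => measurable_pi_apply (Sum.inl j : Fin n ⊕ Fin m)) (hA i)

variable {μ : ∀ j, Measure (Ω j)} [∀ j, IsProbabilityMeasure (μ j)] {L S : ℕ}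

theorem pi_coinSet (T : Set ℕ) (i : Fin m) :
    Measure.pi (extLaw μ m L) (coinSet A T i) =
      coinLaw.{u} L {a | ULift.down a ∈ T} * Measure.pi μ (A i) := by
  have h1 := measurePreserving_sumPiEquivProdPi (extLaw μ m L)
  have h2 : MeasurePreserving (fun z : ∀ i : Fin m, ExtSpace Ω m (.inr i) => z i)
    (Measure.pi fun i => extLaw μ m L (.inr i)) (coinLaw.{u} L) :=
    measurePreserving_eval (fun i => extLaw μ m L (.inr i)) i
  set E : Set (∀ i : Fin m, ExtSpace Ω m (.inr i)) :=
    {z | (ULift.down (z i : ULift.{u} ℕ)) ∈ T} with hE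
  have e : coinSet A T i = MeasurableEquiv.sumPiEquivProdPi (ExtSpace Ω m) ⁻¹' (A i ×ˢ E) := by
    ext x
    exact and_comm
  have h3 : Measure.pi (fun i => extLaw μ m L (.inr i)) E =
      coinLaw.{u} L {a | ULift.down a ∈ T} :=
    h2.measure_preimage (measurable_down (MeasurableSet.of_discrete (s := T))).nullMeasurableSet
  calc Measure.pi (extLaw μ m L) (coinSet A T i)
      = ((Measure.pi fun j => extLaw μ m L (.inl j)).prod
          (Measure.pi fun i => extLaw μ m L (.inr i))) (A i ×ˢ E) :=
        (congrArg _ e).trans (h1.measure_preimage_equiv _)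
    _ = Measure.pi μ (A i) * Measure.pi (fun i => extLaw μ m L (.inr i)) E :=
        Measure.prod_prod (μ := Measure.pi fun j => extLaw μ m L (.inl j)) (A i) E
    _ = coinLaw.{u} L {a | ULift.down a ∈ T} * Measure.pi μ (A i) := by rw [h3, mul_comm]

theorem one_add_div_pow_le {q : ℝ} (hq : 0 ≤ q) {d : ℕ} :
    (1 + ENNReal.ofReal (q / d)) ^ d ≤ ENNReal.ofReal (Real.exp q) := by
  have h0 : 0 ≤ q / d := by positivity
  rw [← ENNReal.ofReal_one, ← ENNReal.ofReal_add zero_le_one h0,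
    ← ENNReal.ofReal_pow (by positivity)]
  refine ENNReal.ofReal_le_ofReal ?_
  rcases Nat.eq_zero_or_pos d with rfl | hd
  · simpa using Real.one_le_exp hq
  have hd' : (d : ℝ) ≠ 0 := by positivity
  calc (1 + q / d) ^ d ≤ Real.exp (q / d) ^ d := by
        gcongr
        rw [add_comm]
        exact Real.add_one_le_exp _
    _ = Real.exp q := by rw [← Real.exp_nat_mul, mul_div_cancel₀ _ hd']

/-- Expected running time and expected number of violated events for the algorithm with coin
probability `S / L`. -/
theorem algorithm_bounds (hA : ∀ i, MeasurableSet (A i)) {p : ℝ} (hp0 : 0 < p)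
    (hp : ∀ i, Measure.pi μ (A i) ≤ ENNReal.ofReal p) {d : ℕ} (hd1 : 1 ≤ d)
    (hd : ∀ i, (closedNbhd A i).card ≤ d) (hL : 1 ≤ L) (hSL : S ≤ L)
    (hq : 0 < m → S = 0 ∨ Real.exp (S / L) * (d * p) ≤ 1) {c : Cmd} {N k : ℕ} {σ₀ : ∀ j, Ω j}
    (hc : ∀ w, Runs A μ w c (initMem n m N) σ₀ k fun M' => ∃ f, GoodMem n m L S f M') (τ : ℕ) :
    expectedTime (algorithm c) τ μ A N σ₀ ≤
        ((1 + τ) * (m * roundCost n m + (k + 2 * roundCost n m)) : ℕ) ∧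
      expectedViolated (algorithm c) μ A N σ₀ ≤
        ENNReal.ofReal (m * ((1 - S / L) * p * Real.exp (S / L))) := by
  classical
  set q : ℝ := S / L with hq_def
  have hL' : (0 : ℝ) < L := by exact_mod_cast hL
  have hq0 : 0 ≤ q := by positivity
  have hq1 : q ≤ 1 := (div_le_one hL').2 (by exact_mod_cast hSL)
  have hd' : (0 : ℝ) < d := by exact_mod_cast hd1
  have hset : ∀ i, activeSet A S i = coinSet A (Set.Iio S) i := fun _ => rfl
  have hmA : ∀ i, MeasurableSet (activeSet A S i) := measurableSet_coinSet hA (Set.Iio S)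
  have hmB : ∀ i, MeasurableSet (coinSet A (Set.Ici S) i) := measurableSet_coinSet hA _
  have hcong : ∀ i (x y : ∀ k, ExtSpace Ω m k), (∀ k ∈ scopeFrom A i 0, x k = y k) →
      (x ∈ activeSet A S i ↔ y ∈ activeSet A S i) := fun i x y h =>
    mem_coinSet_congr (T := Set.Iio S) h
  have hcongB : ∀ i (x y : ∀ k, ExtSpace Ω m k), (∀ k ∈ scopeFrom A i 0, x k = y k) →
      (x ∈ coinSet A (Set.Ici S) i ↔ y ∈ coinSet A (Set.Ici S) i) := fun i x y h =>
    mem_coinSet_congr h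
  have hΓ : ∀ i j, j ∉ closedNbhd A i → Disjoint (scopeFrom A i 0) (scopeFrom A j 0) :=
    fun _ _ h => disjoint_scopeFrom h
  have hself : ∀ i, i ∈ closedNbhd A i := fun i => mem_closedNbhd.2 (Or.inl rfl)
  have hsymm : ∀ i j, i ∈ closedNbhd A j → j ∈ closedNbhd A i := fun _ _ => closedNbhd_symm
  have hPA : ∀ i, Measure.pi (extLaw μ m L) (activeSet A S i) ≤ ENNReal.ofReal (q * p) :=
    fun i => by
      rw [hset, pi_coinSet, ENNReal.ofReal_mul hq0]
      exact mul_le_mul' (coinLaw_lt hL hSL).1.le (hp i)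
  have hPB : ∀ i, Measure.pi (extLaw μ m L) (coinSet A (Set.Ici S) i) ≤
      ENNReal.ofReal ((1 - q) * p) := fun i => by
    rw [pi_coinSet, ENNReal.ofReal_mul (by linarith)]
    exact mul_le_mul' (coinLaw_lt hL hSL).2.le (hp i)
  -- With y = q/d, q p (1+y)^d ≤ q p e^q, and this is at most q/d because e^q d p ≤ 1. For q = 0
  -- both sides vanish.
  have hy : 0 < m → ENNReal.ofReal (q * p) * (1 + ENNReal.ofReal (q / d)) ^ d ≤
      ENNReal.ofReal (q / d) := fun hm => by
    rcases hq hm with h | h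
    · simp [hq_def, h]
    · refine (mul_le_mul' le_rfl (one_add_div_pow_le hq0)).trans ?_
      rw [← ENNReal.ofReal_mul (by positivity)]
      refine ENNReal.ofReal_le_ofReal ?_
      rw [le_div_iff₀ hd']
      calc q * p * Real.exp q * d = q * (Real.exp q * (d * p)) := by ring
        _ ≤ q * 1 := by gcongr
        _ = q := mul_one q
  -- Without events nothing is known about q, and P = y = 0 will do.
  obtain ⟨P, y, hP, hPy, hy1, hyq⟩ : ∃ P y : ℝ≥0∞,
      (∀ i, Measure.pi (extLaw μ m L) (activeSet A S i) ≤ P) ∧ P * (1 + y) ^ d ≤ y ∧ y ≤ 1 ∧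
        (1 + y) ^ d ≤ ENNReal.ofReal (Real.exp q) := by
    rcases Nat.eq_zero_or_pos m with rfl | hm
    · exact ⟨0, 0, fun i => i.elim0, by simp, by simp, by simpa using Real.one_le_exp hq0⟩
    · refine ⟨_, _, hPA, hy hm, ?_, one_add_div_pow_le hq0⟩
      rw [← ENNReal.ofReal_one]
      refine ENNReal.ofReal_le_ofReal ((div_le_one hd').2 (hq1.trans ?_))
      exact_mod_cast hd1
  constructor
  · obtain ⟨V, hV, hstep, hint⟩ := exists_resampling_potential hmA hcong hΓ hself hsymm hP hd hPy
    -- V drops by 1 per resampling, so V scaled by the round cost pays for all rounds at price 1.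
    refine (expectedTime_le hA (algorithm c) τ N σ₀ fun h => expCost_le_of_wp
      (wp_algorithm (F := fun x => roundCost n m * V x) (hV.const_mul _) (fun i x hx => ?_)
        (fun _ _ _ _ => bot_le) (hc 1)) h).trans ?_
    · have h1 : lmarginal (extLaw μ m L) (scopeFrom A i 0) (fun x => roundCost n m * V x) x =
          roundCost n m * lmarginal (extLaw μ m L) (scopeFrom A i 0) V x :=
        lintegral_const_mul _ (hV.comp measurable_updateFinset)
      rw [h1, ← mul_add]
      exact mul_le_mul' le_rfl (hstep i x hx)
    · rw [lintegral_const_mul _ hV]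
      push_cast
      rw [Fintype.card_fin] at hint
      refine mul_le_mul' le_rfl (add_le_add ?_ (by rw [mul_one]))
      calc (roundCost n m : ℝ≥0∞) * ∫⁻ x, V x ∂Measure.pi (extLaw μ m L)
          ≤ roundCost n m * (m * 1) := mul_le_mul' le_rfl (hint.trans (mul_le_mul' le_rfl hy1))
        _ = m * roundCost n m := by rw [mul_one, mul_comm]
  · obtain ⟨W, hW, hstep, hB, hint⟩ :=
      exists_output_potential hmA hcong hΓ hself hsymm hP hd hPy hmB hcongB hPB
    refine (expectedViolated_le hA (algorithm c) N σ₀ fun h => expCost_le_of_wp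
      (wp_algorithm hW (fun i x hx => ?_) (fun M σ _ hM => ?_) (hc 0)) h).trans ?_
    · simpa using hstep i x hx
    -- After halting no event is active, so an event that holds has a coin of at least S and is
    -- counted by W.
    · refine le_trans (Finset.sum_le_sum fun i _ => ?_) (hB _)
      by_cases hi : σ ∈ A i
      · have : extState m M σ ∈ coinSet A (Set.Ici S) i :=
          ⟨not_lt.1 fun hlt => hM i ⟨hlt, hi⟩, hi⟩
        simp [this, hi]
      · simp [hi]
    · rw [mul_zero, add_zero, ENNReal.ofReal_mul (by positivity), ENNReal.ofReal_natCast,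
        ENNReal.ofReal_mul (mul_nonneg (by linarith) hp0.le)]
      rw [Fintype.card_fin] at hint
      exact hint.trans (by gcongr)

end Bounds

end MTBeyond
end

noncomputable section
namespace MTBeyond

/-! ## Computing the parameters of the coins -/

section Parameters

set_option linter.unusedSectionVars false

universe u

variable {n m : ℕ} {Ω : Fin n → Type u} [∀ j, MeasurableSpace (Ω j)]
  {A : Fin m → Set (∀ j, Ω j)} {μ : ∀ j, Measure (Ω j)} [∀ j, IsProbabilityMeasure (μ j)]
  {w : ℝ≥0∞} {M : ℕ → ℕ} {σ : ∀ j, Ω j}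

/-- Outside of the cells `lo, …, hi` the two memories agree. -/
def AgreeOff (lo hi : ℕ) (M M' : ℕ → ℕ) : Prop := ∀ x, x < lo ∨ hi < x → M' x = M x

/-- Cell `10` becomes `1` if cells `14` and `11` are equal or contain the numbers of two events
with a common variable, and `0` otherwise. -/
def adjacencyTest : Cmd :=
  .block [.basic (.sub 8 14 11), .basic (.sub 9 11 14), .basic (.add 8 8 9), .basic (.const 10 1),
    .basic (.sub 10 10 8), .forLoop 6 0 7 (.block [.basic (.depends 8 14 6),
      .basic (.depends 9 11 6), .ite 8 (.ite 9 (.block [.basic (.const 10 1)]) (.block []))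
        (.block [])])]

theorem depends_iff {a b : ℕ} {i : Fin m} {j : Fin n} (ha : a = i) (hb : b = j) :
    (∃ (hi : a < m) (hj : b < n), (⟨b, hj⟩ : Fin n) ∈ vbl (A ⟨a, hi⟩)) ↔ j ∈ vbl (A i) := by
  subst ha hb
  simp

open Classical in
theorem runs_adjacencyTest {i k : Fin m} (h0 : M 0 = n) (hi : M 14 = i) (hk : M 11 = k) :
    Runs A μ w adjacencyTest M σ (n * 20 + 20) fun M' =>
      AgreeOff 6 10 M M' ∧ M' 10 = if k ∈ closedNbhd A i then 1 else 0 := by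
  set M₁ := (Instr.sub 10 10 8).detMem A ((Instr.const 10 1).detMem A ((Instr.add 8 8 9).detMem A
    ((Instr.sub 9 11 14).detMem A ((Instr.sub 8 14 11).detMem A M σ) σ) σ) σ) σ with hM₁
  have hoff₁ : AgreeOff 6 10 M M₁ := fun x hx => by
    have h8 : x ≠ 8 := by omega
    have h9 : x ≠ 9 := by omega
    have h10 : x ≠ 10 := by omega
    simp [hM₁, Instr.detMem, h8, h9, h10]
  have hflag : M₁ 10 = if k = i then 1 else 0 := by
    -- The two truncated differences add up to |i - k|, so the flag starts as the equality test.
    have : M₁ 10 = 1 - (((i : ℕ) - k) + (k - i)) := by simp [hM₁, Instr.detMem, hi, hk]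
    rw [this]
    split_ifs with h
    · simp [h]
    · have := Fin.val_ne_of_ne h
      omega
  set Inv : ℕ → (ℕ → ℕ) → Prop := fun j M' => AgreeOff 6 10 M M' ∧
    M' 10 = if k = i ∨ ∃ l : Fin n, (l : ℕ) < j ∧ l ∈ vbl (A i) ∩ vbl (A k) then 1 else 0
    with hInv
  refine Runs.mono (runs_block_det (runs_block_det (runs_block_det (runs_block_det (runs_block_det
    (runs_block_cons (runs_forLoop (N := n) (b := 11) (by norm_num) (by norm_num) (by norm_num)
      Inv ?_ ?_ ?_ ?_) fun M' h => runs_block_nil h)))))) (by omega) ?_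
  · rintro j M M' hx ⟨h1, h2⟩
    refine ⟨fun x h => by rw [hx x (by omega) (by omega), h1 x h], ?_⟩
    rw [hx 10 (by norm_num) (by norm_num), h2]
  · rintro j hj M₂ h6 hl ⟨hoff, hf⟩
    set l : Fin n := ⟨j, hj⟩ with hl_def
    have hi₂ : M₂ 14 = i := by rw [hoff 14 (by norm_num), hi]
    have hk₂ : M₂ 11 = k := by rw [hoff 11 (by norm_num), hk]
    refine Runs.mono (runs_block_det (runs_block_det (runs_block_cons (k₁ := 5)
      (Q₁ := fun M' => M' 6 = j ∧ M' 0 = n ∧ Inv (j + 1) M') ?_ fun M' h => runs_block_nil h)))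
      (by norm_num) fun _ h => h
    set M₃ := (Instr.depends 9 11 6).detMem A ((Instr.depends 8 14 6).detMem A M₂ σ) σ with hM₃
    have h8 : M₃ 8 = if l ∈ vbl (A i) then 1 else 0 := by
      have := depends_iff (A := A) hi₂ (j := l) h6
      simp only [hM₃, Instr.detMem, Function.update_self, ne_eq,
        Nat.reduceEqDiff, not_false_eq_true, Function.update_of_ne, this]
    have h9 : M₃ 9 = if l ∈ vbl (A k) then 1 else 0 := by
      have := depends_iff (A := A) hk₂ (j := l) h6
      simp only [hM₃, Instr.detMem, Function.update_self, ne_eq,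
        Nat.reduceEqDiff, not_false_eq_true, Function.update_of_ne, this]
    have hx : ∀ x, x ≠ 8 → x ≠ 9 → M₃ x = M₂ x := fun x h8 h9 => by
      simp [hM₃, Instr.detMem, h8, h9]
    have hoff₃ : AgreeOff 6 10 M M₃ := fun x h => by
      rw [hx x (by omega) (by omega), hoff x h]
    have h60 : M₃ 6 = j ∧ M₃ 0 = n :=
      ⟨by rw [hx 6 (by norm_num) (by norm_num), h6], by rw [hx 0 (by norm_num) (by norm_num), hl]⟩
    have hskip : l ∉ vbl (A i) ∩ vbl (A k) → Inv (j + 1) M₃ := by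
      intro hn
      refine ⟨hoff₃, ?_⟩
      rw [hx 10 (by norm_num) (by norm_num), hf]
      refine if_congr (or_congr Iff.rfl ⟨fun ⟨l', h1, h2⟩ => ⟨l', by omega, h2⟩,
        fun ⟨l', h1, h2⟩ => ⟨l', ?_, h2⟩⟩) rfl rfl
      rcases Nat.lt_succ_iff_lt_or_eq.1 h1 with h | h
      · exact h
      · obtain rfl : l' = l := Fin.ext h
        exact absurd h2 hn
    refine runs_ite (k := 4) (fun hne => runs_ite (k := 3) (fun hne' => ?_) fun he => ?_)
      fun he => ?_
    · refine runs_block_det (runs_block_nil ?_)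
      have hmem : l ∈ vbl (A i) ∩ vbl (A k) := by
        refine ⟨?_, ?_⟩
        · by_contra h
          exact hne (by rw [h8, if_neg h])
        · by_contra h
          exact hne' (by rw [h9, if_neg h])
      simp only [Instr.detMem]
      refine ⟨by simp [h60.1], by simp [h60.2], fun x h => ?_, ?_⟩
      · have h10 : x ≠ 10 := by omega
        simp [h10, hoff₃ x h]
      · rw [if_pos (Or.inr ⟨l, by simp [hl_def], hmem⟩)]
        simp
    · refine (runs_block_nil ⟨h60.1, h60.2, hskip fun h => ?_⟩).mono (by norm_num) fun _ h => h
      rw [h9, if_pos h.2] at he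
      exact one_ne_zero he
    · refine (runs_block_nil ⟨h60.1, h60.2, hskip fun h => ?_⟩).mono (by norm_num) fun _ h => h
      rw [h8, if_pos h.1] at he
      exact one_ne_zero he
  · exact (hoff₁ 0 (by norm_num)).trans h0
  · exact ⟨hoff₁, hflag.trans (by simp)⟩
  · rintro M' ⟨h1, h2⟩
    refine ⟨h1, h2.trans (if_congr ?_ rfl rfl)⟩
    rw [mem_closedNbhd]
    exact or_congr Iff.rfl ⟨fun ⟨l, _, h⟩ => ⟨l, h⟩, fun ⟨l, h⟩ => ⟨l, l.2, h⟩⟩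

/-- Cell `13` becomes the size of the closed neighborhood of the event in cell `14`. -/
def degreeCount : Cmd :=
  .block [.basic (.const 13 0), .forLoop 11 1 12 (.block [adjacencyTest, .basic (.add 13 13 10)])]

theorem runs_degreeCount {i : Fin m} (h0 : M 0 = n) (h1 : M 1 = m) (hi : M 14 = i) :
    Runs A μ w degreeCount M σ (m * (n * 20 + 33) + 12) fun M' =>
      AgreeOff 6 13 M M' ∧ M' 13 = (closedNbhd A i).card := by
  classical
  set Inv : ℕ → (ℕ → ℕ) → Prop := fun j M' => AgreeOff 6 13 M M' ∧
    M' 13 = ((closedNbhd A i).filter fun k : Fin m => (k : ℕ) < j).card with hInv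
  refine Runs.mono (runs_block_det (runs_block_cons (runs_forLoop (N := m) (b := n * 20 + 24)
      (by norm_num) (by norm_num) (by norm_num)
      Inv ?_ ?_ ?_ ?_) fun M' h => runs_block_nil h)) (by ring_nf; omega) ?_
  · rintro j M M' hx ⟨h1, h2⟩
    refine ⟨fun x h => by rw [hx x (by omega) (by omega), h1 x h], ?_⟩
    rw [hx 13 (by norm_num) (by norm_num), h2]
  · rintro j hj M₂ h6 hl ⟨hoff, hf⟩
    set k : Fin m := ⟨j, hj⟩ with hk
    refine Runs.mono (runs_block_cons (runs_adjacencyTest (i := i) (k := k)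
      ((hoff 0 (by norm_num)).trans h0) ((hoff 14 (by norm_num)).trans hi) h6)
      fun M₃ h => runs_block_det (runs_block_nil
        (Q := fun M' => M' 11 = j ∧ M' 1 = m ∧ Inv (j + 1) M') ?_)) (by omega) fun _ h => h
    obtain ⟨hoff₃, h10⟩ := h
    simp only [Instr.detMem]
    refine ⟨by simp [hoff₃ 11, h6], by simp [hoff₃ 1, hl], fun x hx => ?_, ?_⟩
    · have h13 : x ≠ 13 := by omega
      rw [Function.update_of_ne h13, hoff₃ x (by omega), hoff x hx]
    · rw [Function.update_self, hoff₃ 13 (by norm_num), hf, h10]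
      have hsplit : ((closedNbhd A i).filter fun k' : Fin m => (k' : ℕ) < j + 1) =
          ((closedNbhd A i).filter fun k' : Fin m => (k' : ℕ) < j) ∪
            ((closedNbhd A i).filter fun k' : Fin m => k' = k) := by
        ext k'
        simp only [Finset.mem_union, Finset.mem_filter, ← and_or_left]
        exact and_congr_right fun _ => Nat.lt_succ_iff_lt_or_eq.trans (or_congr Iff.rfl
          (Fin.ext_iff (b := k)).symm)
      have hdisj : Disjoint ((closedNbhd A i).filter fun k' : Fin m => (k' : ℕ) < j)
          ((closedNbhd A i).filter fun k' : Fin m => k' = k) := by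
        refine Finset.disjoint_left.2 fun k' h1 h2 => ?_
        simp only [Finset.mem_filter, Fin.ext_iff, hk] at h1 h2
        omega
      rw [hsplit, Finset.card_union_of_disjoint hdisj, Finset.filter_eq']
      split_ifs <;> simp
  · simp [Instr.detMem, h1]
  · refine ⟨fun x hx => ?_, by simp [Instr.detMem]⟩
    have h13 : x ≠ 13 := by omega
    simp [Instr.detMem, h13]
  · rintro M' ⟨h1, h2⟩
    exact ⟨h1, h2.trans (congrArg Finset.card (Finset.filter_true_of_mem fun k _ => k.2))⟩

/-- Cell `16` becomes the maximal size of a closed neighborhood. -/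
def maxDegree : Cmd :=
  .forLoop 14 1 15 (.block [degreeCount, .basic (.sub 13 13 16), .basic (.add 16 16 13)])

theorem runs_maxDegree (h0 : M 0 = n) (h1 : M 1 = m) (h16 : M 16 = 0) :
    Runs A μ w maxDegree M σ (m * (m * (n * 20 + 33) + 27) + 8) fun M' =>
      AgreeOff 6 16 M M' ∧ M' 16 = Finset.univ.sup fun i => (closedNbhd A i).card := by
  classical
  set Inv : ℕ → (ℕ → ℕ) → Prop := fun j M' => AgreeOff 6 16 M M' ∧
    M' 16 = (Finset.univ.filter fun i : Fin m => (i : ℕ) < j).sup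
      fun i => (closedNbhd A i).card with hInv
  refine Runs.mono (runs_forLoop (N := m) (b := m * (n * 20 + 33) + 18)
      (by norm_num) (by norm_num) (by norm_num) Inv ?_ ?_ h1 ?_) (by ring_nf; omega) ?_
  · rintro j M M' hx ⟨h1, h2⟩
    refine ⟨fun x h => by rw [hx x (by omega) (by omega), h1 x h], ?_⟩
    rw [hx 16 (by norm_num) (by norm_num), h2]
  · rintro j hj M₂ h6 hl ⟨hoff, hf⟩
    set k : Fin m := ⟨j, hj⟩ with hk
    refine Runs.mono (runs_block_cons (runs_degreeCount (i := k)
      ((hoff 0 (by norm_num)).trans h0) hl h6)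
      fun M₃ h => runs_block_det (runs_block_det (runs_block_nil
        (Q := fun M' => M' 14 = j ∧ M' 1 = m ∧ Inv (j + 1) M') ?_))) (by omega) fun _ h => h
    obtain ⟨hoff₃, h13⟩ := h
    simp only [Instr.detMem]
    refine ⟨by simp [hoff₃ 14, h6], by simp [hoff₃ 1, hl], fun x hx => ?_, ?_⟩
    · have h13 : x ≠ 13 := by omega
      have h16 : x ≠ 16 := by omega
      rw [Function.update_of_ne h16, Function.update_of_ne h13, hoff₃ x (by omega), hoff x hx]
    · have hsplit : (Finset.univ.filter fun k' : Fin m => (k' : ℕ) < j + 1) =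
          insert k (Finset.univ.filter fun k' : Fin m => (k' : ℕ) < j) := by
        ext k'
        simp only [Finset.mem_insert, Finset.mem_filter, Finset.mem_univ, true_and, Fin.ext_iff, hk]
        omega
      rw [hsplit, Finset.sup_insert, ← hf]
      simp only [Function.update_self, ne_eq, Nat.reduceEqDiff,
        not_false_eq_true, Function.update_of_ne, hoff₃ 16 (Or.inr (by norm_num)), h13]
      -- Adding the truncated difference b - a to a gives the maximum of a and b.
      change _ = max _ _
      omega
  · exact ⟨fun _ _ => rfl, by simpa using h16⟩
  · rintro M' ⟨h1, h2⟩
    refine ⟨h1, h2.trans (congrArg (fun s => Finset.sup s _)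
      (Finset.filter_true_of_mem fun k _ => k.2))⟩

/-- Cell `20` is multiplied by `d + 1` and cell `21` by `d`, where `d` is the content of
cell `16`. -/
def geometricStep : Cmd :=
  .block [.basic (.copy 8 20), .basic (.copy 9 21), .basic (.const 21 0),
    .forLoop 6 16 7 (.block [.basic (.add 20 20 8), .basic (.add 21 21 9)])]

/-- Multiplication is repeated addition of a saved copy. Cell 20 keeps its old value at the start,
which makes its factor d + 1; cell 21 is cleared, which makes its factor d. -/
theorem runs_geometricStep {d : ℕ} (hd : M 16 = d) :
    Runs A μ w geometricStep M σ (d * 14 + 16) fun M' =>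
      (∀ x, x < 6 ∨ 9 < x → x ≠ 20 → x ≠ 21 → M' x = M x) ∧
      M' 20 = M 20 * (d + 1) ∧ M' 21 = M 21 * d := by
  set Inv : ℕ → (ℕ → ℕ) → Prop := fun j M' =>
    (∀ x, x < 6 ∨ 9 < x → x ≠ 20 → x ≠ 21 → M' x = M x) ∧ M' 8 = M 20 ∧ M' 9 = M 21 ∧
      M' 20 = M 20 * (j + 1) ∧ M' 21 = M 21 * j with hInv
  refine Runs.mono (runs_block_det (runs_block_det (runs_block_det (runs_block_cons
    (runs_forLoop (N := d) (b := 5) (by norm_num) (by norm_num) (by norm_num)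
      Inv ?_ ?_ ?_ ?_) fun M' h => runs_block_nil h)))) (by omega) ?_
  · rintro j M M' hx ⟨h1, h2, h3, h4, h5⟩
    refine ⟨fun x h h20 h21 => by rw [hx x (by omega) (by omega), h1 x h h20 h21], ?_, ?_, ?_, ?_⟩
    · rw [hx 8 (by norm_num) (by norm_num), h2]
    · rw [hx 9 (by norm_num) (by norm_num), h3]
    · rw [hx 20 (by norm_num) (by norm_num), h4]
    · rw [hx 21 (by norm_num) (by norm_num), h5]
  · rintro j hj M₂ h6 hl ⟨h1, h2, h3, h4, h5⟩
    refine runs_block_det (runs_block_det (runs_block_nil ?_))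
    simp only [Instr.detMem]
    refine ⟨by simp [h6], by simp [hl], fun x hx h20 h21 => ?_, by simp [h2], by simp [h3], ?_, ?_⟩
    · rw [Function.update_of_ne h21, Function.update_of_ne h20, h1 x hx h20 h21]
    · simp [h2, h4]
      ring
    · simp [h3, h5]
      ring
  · simp [Instr.detMem, hd]
  · simp only [Instr.detMem]
    refine ⟨fun x hx h20 h21 => ?_, by simp, by simp, by simp, by simp⟩
    have h8 : x ≠ 8 := by omega
    have h9 : x ≠ 9 := by omega
    simp [h8, h9, h21]
  · rintro M' ⟨h1, -, -, h4, h5⟩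
    exact ⟨h1, h4, h5⟩

/-- The largest number of steps `s ≤ k` with `d (1 + 1/d) ^ s ≤ N`. -/
def stepCount (d N k : ℕ) : ℕ :=
  ((Finset.range k).filter fun s => d * (d + 1) ^ (s + 1) ≤ N * d ^ (s + 1)).card

/-- Cell `3` becomes `d + 1` and cell `4` becomes `stepCount d N (d + 1)`, for the contents `d`
and `N` of the cells `16` and `2`. -/
def coinParameters : Cmd :=
  .block [.basic (.const 17 1), .basic (.add 3 16 17), .basic (.const 4 0), .basic (.copy 20 16),
    .basic (.copy 21 2), .forLoop 18 3 19 (.block [geometricStep, .basic (.sub 8 20 21),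
      .basic (.const 9 1), .basic (.sub 9 9 8), .basic (.add 4 4 9)])]

theorem runs_coinParameters {d N : ℕ} (h2 : M 2 = N) (hd : M 16 = d) :
    Runs A μ w coinParameters M σ ((d + 1) * (d * 14 + 35) + 20) fun M' =>
      M' 0 = M 0 ∧ M' 1 = M 1 ∧ M' 3 = d + 1 ∧ M' 4 = stepCount d N (d + 1) := by
  set Inv : ℕ → (ℕ → ℕ) → Prop := fun j M' =>
    M' 0 = M 0 ∧ M' 1 = M 1 ∧ M' 3 = d + 1 ∧ M' 16 = d ∧ M' 20 = d * (d + 1) ^ j ∧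
      M' 21 = N * d ^ j ∧ M' 4 = stepCount d N j with hInv
  refine Runs.mono (runs_block_det (runs_block_det (runs_block_det (runs_block_det
    (runs_block_det (runs_block_cons
    (runs_forLoop (N := d + 1) (b := d * 14 + 26) (by norm_num) (by norm_num) (by norm_num)
      Inv ?_ ?_ ?_ ?_) fun M' h => runs_block_nil h)))))) (by ring_nf; omega) ?_
  · rintro j M M' hx ⟨h0, h1, h3, h16, h20, h21, h4⟩
    refine ⟨?_, ?_, ?_, ?_, ?_, ?_, ?_⟩
    · rw [hx 0 (by norm_num) (by norm_num), h0]
    · rw [hx 1 (by norm_num) (by norm_num), h1]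
    · rw [hx 3 (by norm_num) (by norm_num), h3]
    · rw [hx 16 (by norm_num) (by norm_num), h16]
    · rw [hx 20 (by norm_num) (by norm_num), h20]
    · rw [hx 21 (by norm_num) (by norm_num), h21]
    · rw [hx 4 (by norm_num) (by norm_num), h4]
  · rintro j hj M₂ h18 hl ⟨h0, h1, h3, h16, h20, h21, h4⟩
    refine Runs.mono (runs_block_cons (runs_geometricStep h16) fun M₃ h => runs_block_det
      (runs_block_det (runs_block_det (runs_block_det (runs_block_nil
        (Q := fun M' => M' 18 = j ∧ M' 3 = d + 1 ∧ Inv (j + 1) M') ?_))))) (by omega)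
      fun _ h => h
    obtain ⟨hoff, h20', h21'⟩ := h
    simp only [Instr.detMem]
    refine ⟨by simp [hoff 18, h18], by simp [hoff 3, hl], by simp [hoff 0, h0],
      by simp [hoff 1, h1],
      by simp [hoff 3, h3], by simp [hoff 16, h16], ?_, ?_, ?_⟩
    · simp [h20', h20]
      ring
    · simp [h21', h21]
      ring
    -- In truncated arithmetic 1 - (a - b) is the indicator of a ≤ b. Round j compares after the
    -- multiplication, hence the exponent s + 1 in `stepCount`.
    · simp only [Function.update_self, ne_eq, Nat.reduceEqDiff,
        not_false_eq_true, Function.update_of_ne, hoff 4 (Or.inl (by norm_num)) (by norm_num)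
        (by norm_num), h20', h21', h20, h21, h4]
      unfold stepCount
      rw [Finset.range_add_one, Finset.filter_insert, mul_assoc, mul_assoc, ← pow_succ, ← pow_succ]
      split_ifs with h
      · rw [Finset.card_insert_of_notMem (by simp)]
        omega
      · omega
  · simp [Instr.detMem, hd]
  · simp only [Instr.detMem]
    exact ⟨by simp, by simp, by simp [hd], by simp [hd], by simp [hd], by simp [h2],
      by simp [stepCount]⟩
  · rintro M' ⟨h0, h1, h3, -, -, -, h4⟩
    exact ⟨h0, h1, h3, h4⟩

/-- Number of steps that suffices for the computation of the parameters. -/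
def parameterCost (n m : ℕ) : ℕ :=
  m * (m * (n * 20 + 33) + 27) + ((m + 1) * (m * 14 + 35)) + 40

theorem runs_parameters (N : ℕ) :
    Runs A μ w (.block [maxDegree, coinParameters]) (initMem n m N) σ (parameterCost n m)
      fun M' => ∃ f, GoodMem n m ((Finset.univ.sup fun i => (closedNbhd A i).card) + 1)
        (stepCount (Finset.univ.sup fun i => (closedNbhd A i).card) N
          ((Finset.univ.sup fun i => (closedNbhd A i).card) + 1)) f M' := by
  set d := Finset.univ.sup fun i => (closedNbhd A i).card with hd
  have hdm : d ≤ m := Finset.sup_le fun i _ => (Finset.card_le_univ _).trans (by simp)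
  refine Runs.mono (runs_block_cons (runs_maxDegree rfl rfl rfl) fun M₁ h => runs_block_cons
    (runs_coinParameters (N := N) (d := d) ((h.1 2 (by norm_num)).trans rfl) h.2)
    fun M₂ h' => runs_block_nil ⟨M₂ 5, ?_⟩) ?_ fun _ h => h
  · have : (d + 1) * (d * 14 + 35) ≤ (m + 1) * (m * 14 + 35) := by gcongr
    unfold parameterCost
    omega
  · obtain ⟨h0, h1, h3, h4⟩ := h'
    exact ⟨h0.trans (h.1 0 (by norm_num)), h1.trans (h.1 1 (by norm_num)), h3, h4, rfl⟩

theorem runs_constParameters (N s : ℕ) :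
    Runs A μ w (.block [.basic (.const 3 1), .basic (.const 4 s)]) (initMem n m N) σ
      (parameterCost n m) fun M' => ∃ f, GoodMem n m 1 s f M' := by
  refine Runs.mono (runs_block_det (runs_block_det (runs_block_nil ⟨0, ?_⟩)))
    (by unfold parameterCost; omega) fun _ h => h
  simp [GoodMem, Instr.detMem, initMem]

end Parameters

end MTBeyond
end

noncomputable section
namespace MTBeyond

/-! ## Numerical estimates -/

section Numerics

set_option linter.unusedSectionVars false

universe u

theorem stepCount_le (d N k : ℕ) : stepCount d N k ≤ k :=
  (Finset.card_filter_le _ _).trans (Finset.card_range k).le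

theorem le_pow_of_stepCount {d N k : ℕ} (hd : 1 ≤ d) (hS : stepCount d N k ≠ 0) :
    (d : ℝ) * (1 + 1 / d) ^ stepCount d N k ≤ N := by
  have hd' : (0 : ℝ) < d := by exact_mod_cast hd
  -- By pigeonhole, the `stepCount d N k` exponents that pass cannot all lie below `stepCount d N k
  -- - 1`.
  obtain ⟨s, hs, hle⟩ : ∃ s, d * (d + 1) ^ (s + 1) ≤ N * d ^ (s + 1) ∧ stepCount d N k ≤ s + 1 := by
    by_contra! h
    have hsub : ((Finset.range k).filter fun s => d * (d + 1) ^ (s + 1) ≤ N * d ^ (s + 1)) ⊆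
        Finset.range (stepCount d N k - 1) := fun s hs => by
      have := h s (Finset.mem_filter.1 hs).2
      rw [Finset.mem_range]
      omega
    have := Finset.card_le_card hsub
    rw [Finset.card_range] at this
    change stepCount d N k ≤ _ at this
    omega
  have hs' : (d : ℝ) * (d + 1) ^ (s + 1) ≤ N * d ^ (s + 1) := by exact_mod_cast hs
  calc (d : ℝ) * (1 + 1 / d) ^ stepCount d N k ≤ d * (1 + 1 / d) ^ (s + 1) := by
        gcongr
        simp
    _ = d * (d + 1) ^ (s + 1) / d ^ (s + 1) := by
        rw [mul_div_assoc, ← div_pow, add_div, div_self hd'.ne']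
    _ ≤ N := (div_le_iff₀ (by positivity)).2 hs'

/-- The coin denominator is d + 1 rather than d because e^{1/(d+1)} ≤ 1 + 1/d, whereas e^{1/d} is
too large. With N p ≤ 1 this gives the criterion e^q d p ≤ 1. -/
theorem exp_stepCount_le {d N : ℕ} (hd : 1 ≤ d) (hS : stepCount d N (d + 1) ≠ 0) :
    Real.exp (stepCount d N (d + 1) / (d + 1 : ℕ)) * d ≤ N := by
  have hd' : (0 : ℝ) < d := by exact_mod_cast hd
  refine le_trans ?_ (le_pow_of_stepCount hd hS)
  rw [mul_comm]
  gcongr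
  have h1 : Real.exp (1 / (d + 1 : ℕ)) ≤ 1 + 1 / d := by
    have h2 := Real.add_one_le_exp (-(1 / ((d + 1 : ℕ) : ℝ)))
    rw [Real.exp_neg] at h2
    -- The reciprocal form of e^{1/(d+1)} ≤ 1 + 1/d is the tangent bound for exp at -1/(d+1).
    have h3 : -(1 / ((d + 1 : ℕ) : ℝ)) + 1 = (1 + 1 / (d : ℝ))⁻¹ := by
      push_cast
      field_simp
      ring
    rw [h3] at h2
    exact (inv_le_inv₀ (by positivity) (Real.exp_pos _)).1 h2
  calc Real.exp (stepCount d N (d + 1) / (d + 1 : ℕ))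
      = Real.exp (1 / (d + 1 : ℕ)) ^ stepCount d N (d + 1) := by
        rw [← Real.exp_nat_mul, mul_one_div]
    _ ≤ _ := by gcongr

/-- The converse estimate: by pigeonhole some exponent s ≤ `stepCount d N k` fails the test, and 1 +
1/d ≤ e^{1/d} turns this failure into a bound on N. -/
theorem lt_of_stepCount_lt {d N k : ℕ} (hd : 1 ≤ d) (hS : stepCount d N k < k) :
    (N : ℝ) < d * Real.exp ((stepCount d N k + 1) / d) := by
  have hd' : (0 : ℝ) < d := by exact_mod_cast hd
  obtain ⟨s, hs, hle⟩ : ∃ s, N * d ^ (s + 1) < d * (d + 1) ^ (s + 1) ∧ s ≤ stepCount d N k := by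
    by_contra! h
    have hsub : Finset.range (stepCount d N k + 1) ⊆
        (Finset.range k).filter fun s => d * (d + 1) ^ (s + 1) ≤ N * d ^ (s + 1) := fun s hs => by
      rw [Finset.mem_range] at hs
      refine Finset.mem_filter.2 ⟨Finset.mem_range.2 (by omega), ?_⟩
      by_contra! h'
      have := h s h'
      omega
    have := Finset.card_le_card hsub
    rw [Finset.card_range] at this
    change _ ≤ stepCount d N k at this
    omega
  have hs' : (N : ℝ) * d ^ (s + 1) < d * (d + 1) ^ (s + 1) := by exact_mod_cast hs
  calc (N : ℝ) < d * (d + 1) ^ (s + 1) / d ^ (s + 1) := (lt_div_iff₀ (by positivity)).2 hs'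
    _ = d * (1 + 1 / d) ^ (s + 1) := by
        rw [mul_div_assoc, ← div_pow, add_div, div_self hd'.ne']
    _ ≤ d * Real.exp (1 / d) ^ (s + 1) := by
        gcongr
        rw [add_comm]
        exact Real.add_one_le_exp _
    _ = d * Real.exp ((s + 1) / d) := by
        rw [← Real.exp_nat_mul]
        push_cast
        rw [mul_one_div]
    _ ≤ _ := by gcongr

/-- Upper bound for the reciprocal of the degree. -/
def degreeError (p : ℝ) : ℝ := Real.exp 2 * p / (1 - p)

/-- Lower bound for the coin probability. -/
def coinBound (α p : ℝ) : ℝ :=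
  max 0 (Real.log (max 0 (Real.exp 1 / α - degreeError p)) - 2 * degreeError p)

/-- The fraction of `m p` guaranteed for the coin probability `q`. -/
def coinFraction (q : ℝ) : ℝ := (1 - q) * Real.exp q

/-- The derivative is -q e^q. The proof needs only the tangent bound e^{x-y} ≥ 1 + x - y, since
(1-x)(1+x-y) = 1 - y + x(y-x). -/
theorem coinFraction_antitone : AntitoneOn coinFraction (Set.Ici 0) := by
  intro x hx y _ hxy
  have hx : 0 ≤ x := hx
  have h1 := Real.add_one_le_exp (x - y)
  have h2 : Real.exp x = Real.exp (x - y) * Real.exp y := by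
    rw [← Real.exp_add, sub_add_cancel]
  have hy := Real.exp_pos y
  unfold coinFraction
  rw [h2, ← mul_assoc]
  refine mul_le_mul_of_nonneg_right ?_ hy.le
  rcases le_or_gt x 1 with hx1 | hx1
  · nlinarith [mul_le_mul_of_nonneg_left h1 (sub_nonneg.2 hx1)]
  · have h3 : Real.exp (x - y) ≤ 1 := Real.exp_le_one_iff.2 (by linarith)
    nlinarith

theorem coinBound_le_one {α p : ℝ} (hα : 1 ≤ α) (hδ : 0 ≤ degreeError p) : coinBound α p ≤ 1 := by
  refine max_le zero_le_one ?_
  have h1 : max 0 (Real.exp 1 / α - degreeError p) ≤ Real.exp 1 := by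
    refine max_le (Real.exp_pos 1).le ?_
    have : Real.exp 1 / α ≤ Real.exp 1 := div_le_self (Real.exp_pos 1).le hα
    linarith
  rcases (le_max_left 0 (Real.exp 1 / α - degreeError p)).eq_or_lt with h | h
  · rw [← h, Real.log_zero]
    linarith
  · have := Real.log_le_log h h1
    rw [Real.log_exp] at this
    linarith

/-- If S = d + 1, the coin probability is 1 and nothing is lost. Otherwise S is limited by N, which
forces d to be at least of order 1/p, and the rounding errors are multiples of 1/d. -/
theorem coinBound_le {α p : ℝ} (hα : 1 ≤ α) (hp0 : 0 < p) (hp1 : p < 1) {d : ℕ} (hd : 1 ≤ d)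
    (hdp : Real.exp 1 * (d * p) ≤ α) :
    coinBound α p ≤ stepCount d ⌊1 / p⌋₊ (d + 1) / (d + 1 : ℕ) := by
  set N := ⌊1 / p⌋₊ with hN
  set S := stepCount d N (d + 1) with hS
  have hd' : (1 : ℝ) ≤ d := by exact_mod_cast hd
  have hα0 : 0 < α := by linarith
  have hδ0 : 0 ≤ degreeError p :=
    div_nonneg (mul_nonneg (Real.exp_pos 2).le hp0.le) (by linarith)
  rcases (stepCount_le d N (d + 1)).eq_or_lt with h | h
  · rw [hS, h, div_self (by positivity)]
    exact coinBound_le_one hα hδ0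
  have hlt := lt_of_stepCount_lt hd h
  rw [← hS] at hlt
  have hNp : 1 / p - 1 < N := by
    have := Nat.lt_floor_add_one (1 / p)
    rw [← hN] at this
    linarith
  have hSd : (S : ℝ) ≤ d := by
    have : S ≤ d := Nat.lt_succ_iff.1 h
    exact_mod_cast this
  -- As S ≤ d and d ≥ 1, (S+1)/d ≤ 2. So 1/p - 1 < N < d e², which is where the constant e² in
  -- `degreeError` comes from.
  have hdelta : 1 / (d : ℝ) ≤ degreeError p := by
    have h2 : 1 / p - 1 < d * Real.exp 2 := by
      refine hNp.trans (hlt.trans_le ?_)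
      gcongr
      rw [div_le_iff₀ (by linarith)]
      linarith
    unfold degreeError
    rw [div_le_div_iff₀ (by linarith) (by linarith)]
    have h3 : (1 / p - 1) * p = 1 - p := by field_simp
    nlinarith [mul_lt_mul_of_pos_right h2 hp0]
  refine max_le (by positivity) ?_
  rcases le_or_gt (Real.exp 1 / α - degreeError p) 0 with hneg | hpos
  -- The default value log 0 = 0 leaves a nonpositive bound.
  · rw [max_eq_left hneg, Real.log_zero]
    have : (0 : ℝ) ≤ S / (d + 1 : ℕ) := by positivity
    linarith
  rw [max_eq_right hpos.le]
  set ℓ := Real.log (Real.exp 1 / α - degreeError p) with hℓ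
  have hℓ1 : ℓ ≤ 1 := by
    have h1 : Real.exp 1 / α - degreeError p ≤ Real.exp 1 := by
      have : Real.exp 1 / α ≤ Real.exp 1 := div_le_self (Real.exp_pos 1).le hα
      linarith
    have := Real.log_le_log hpos h1
    rwa [Real.log_exp] at this
  -- From e d p ≤ α one gets e/α - 1/d ≤ (1/p - 1)/d < e^{(S+1)/d}.
  have hℓS : ℓ * d ≤ S + 1 := by
    rw [← le_div_iff₀ (by linarith), hℓ, Real.log_le_iff_le_exp hpos]
    have h1 : Real.exp 1 / α ≤ 1 / p / d := by
      rw [div_div, div_le_div_iff₀ hα0 (by positivity)]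
      linarith
    have h2 : (1 / p - 1) / d < Real.exp ((S + 1) / d) := by
      rw [div_lt_iff₀ (by linarith)]
      linarith
    rw [sub_div] at h2
    linarith
  -- Writing δ for `degreeError p`, (ℓ - 2δ)(d+1) = ℓd + ℓ - 2δ(d+1) ≤ (S+1) + 1 - 2 = S.
  have h3 : 2 * degreeError p * (d + 1) ≥ 2 := by
    have : 1 ≤ degreeError p * d := by
      rwa [div_le_iff₀ (by linarith)] at hdelta
    nlinarith
  rw [le_div_iff₀ (by positivity)]
  push_cast
  nlinarith

theorem fraction_eq_coinFraction {α : ℝ} (h1 : 1 < α) (he : α < Real.exp 1) :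
    fraction α = coinFraction (1 - Real.log α) := by
  have h0 : 0 < α := by linarith
  rw [fraction, if_neg h1.not_ge, if_pos he, coinFraction, Real.exp_sub, Real.exp_log h0]
  ring

theorem fraction_pos {α : ℝ} (h1 : 1 < α) : 0 < fraction α := by
  rw [fraction, if_neg h1.not_ge]
  have := Real.log_pos h1
  split_ifs <;> positivity

/-- All functions involved are continuous at p = 0, where `degreeError` vanishes and `coinBound`
equals the ideal value 1 - ln α. -/
theorem tendsto_coinFraction {α : ℝ} (h1 : 1 < α) (he : α < Real.exp 1) :
    Filter.Tendsto (fun p => coinFraction (coinBound α p) / fraction α - 1)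
      (nhdsWithin 0 (Set.Ioi 0)) (nhds 0) := by
  have h0 : 0 < α := by linarith
  have hδ0 : degreeError 0 = 0 := by simp [degreeError]
  have hpos : 0 < Real.exp 1 / α := div_pos (Real.exp_pos 1) h0
  have hδ : ContinuousAt degreeError 0 := by
    unfold degreeError
    exact (continuousAt_const.mul continuousAt_id).div (continuousAt_const.sub continuousAt_id)
      (by simp)
  have hq0 : coinBound α 0 = 1 - Real.log α := by
    have hlog : Real.log α ≤ 1 := by
      have := Real.log_le_log h0 he.le
      rwa [Real.log_exp] at this
    rw [coinBound, hδ0, sub_zero, max_eq_right hpos.le, mul_zero, sub_zero,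
      Real.log_div (Real.exp_pos 1).ne' h0.ne', Real.log_exp, max_eq_right (by linarith)]
  have hq : ContinuousAt (coinBound α) 0 := by
    unfold coinBound
    refine continuousAt_const.max ((ContinuousAt.log ?_ ?_).sub (continuousAt_const.mul hδ))
    · exact continuousAt_const.max (continuousAt_const.sub hδ)
    · rw [hδ0, sub_zero, max_eq_right hpos.le]
      exact hpos.ne'
  have hf : ContinuousAt (fun p => coinFraction (coinBound α p) / fraction α - 1) 0 := by
    unfold coinFraction
    exact (((continuousAt_const.sub hq).mul hq.rexp).div_const _).sub continuousAt_const
  have := hf.tendsto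
  rw [hq0, ← fraction_eq_coinFraction h1 he, div_self (fraction_pos h1).ne', sub_self] at this
  exact this.mono_left nhdsWithin_le_nhds

theorem time_le {n m τ a k : ℕ} (hτ : τ ≤ a * (n + m + 1) ^ k) :
    (1 + τ) * (m * roundCost n m + (parameterCost n m + 2 * roundCost n m)) ≤
      (a + 1) * 300 * (n + m + 1) ^ (k + 3) := by
  set x := n + m + 1 with hx
  have hx1 : 1 ≤ x := by omega
  have hm : m ≤ x := by omega
  have hn : n ≤ x := by omega
  have h2 : x ^ 2 ≤ x ^ 3 := Nat.pow_le_pow_right hx1 (by norm_num)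
  have h1 : x ≤ x ^ 3 := Nat.le_self_pow (by norm_num) x
  have h0 : 1 ≤ x ^ 3 := Nat.one_le_pow _ _ hx1
  have hr : roundCost n m ≤ 40 * x := by
    unfold roundCost
    omega
  have hp : parameterCost n m ≤ 170 * x ^ 3 := by
    unfold parameterCost
    have e1 : m * (m * (n * 20 + 33) + 27) ≤ x * (x * (x * 20 + 33) + 27) := by gcongr
    have e2 : (m + 1) * (m * 14 + 35) ≤ x * (x * 14 + 35) := by
      gcongr
      omega
    ring_nf at e1 e2 ⊢
    nlinarith
  have hmr : m * roundCost n m ≤ x * (40 * x) := by gcongr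
  have hτ' : 1 + τ ≤ (a + 1) * x ^ k := by
    have := Nat.one_le_pow k x hx1
    nlinarith
  calc (1 + τ) * (m * roundCost n m + (parameterCost n m + 2 * roundCost n m))
      ≤ ((a + 1) * x ^ k) * (300 * x ^ 3) := by
        gcongr
        nlinarith
    _ = _ := by ring

variable {n m : ℕ} {Ω : Fin n → Type u} [∀ j, MeasurableSpace (Ω j)] {A : Fin m → Set (∀ j, Ω j)}

/-- A closed neighbourhood has one element more than the degree, and (α(1/(ep) - 1) + 1) e p = α +
(1-α) e p. Since degrees are nonnegative, e p ≤ 1; so the right side is at most 1 if α ≤ 1 and at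
most α if α ≥ 1. -/
theorem degree_bounds {α p : ℝ} (hp0 : 0 < p) (hα : 0 < α) (hm : 0 < m)
    (hdeg : ∀ i, (((dependencyGraph A).neighborSet i).ncard : ℝ) ≤
      α * (1 / (Real.exp 1 * p) - 1)) :
    1 ≤ (Finset.univ.sup fun i => (closedNbhd A i).card) ∧ Real.exp 1 * p ≤ 1 ∧
      Real.exp 1 * (((Finset.univ.sup fun i => (closedNbhd A i).card) : ℕ) * p) ≤
        α + (1 - α) * (Real.exp 1 * p) := by
  have : Nonempty (Fin m) := ⟨⟨0, hm⟩⟩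
  obtain ⟨i, -, hi⟩ := Finset.exists_mem_eq_sup Finset.univ Finset.univ_nonempty
    fun i => (closedNbhd A i).card
  rw [hi, card_closedNbhd]
  have hep : 0 < Real.exp 1 * p := mul_pos (Real.exp_pos 1) hp0
  have h := hdeg i
  have hle : Real.exp 1 * p ≤ 1 := by
    have h1 : 0 ≤ 1 / (Real.exp 1 * p) - 1 :=
      nonneg_of_mul_nonneg_right ((Nat.cast_nonneg _).trans h) hα
    have h2 : 1 ≤ 1 / (Real.exp 1 * p) := by linarith
    rwa [le_div_iff₀ hep, one_mul] at h2
  refine ⟨by omega, hle, ?_⟩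
  push_cast
  have h3 := mul_le_mul_of_nonneg_right h hep.le
  have h4 : α * (1 / (Real.exp 1 * p) - 1) * (Real.exp 1 * p) = α - α * (Real.exp 1 * p) := by
    field_simp
  rw [h4] at h3
  linarith

end Numerics

end MTBeyond
end

/-! ### The theorem: choice of the coin in the three ranges of α -/

open MTBeyond

theorem theorem7p3 (α : ℝ) (hα : 0 < α) :
    ∃ (c : MTBeyond.Cmd) (η : ℝ → ℝ),
      Filter.Tendsto η (nhdsWithin 0 (Set.Ioi 0)) (nhds 0) ∧
      ∀ a k : ℕ, ∃ C K : ℕ,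
        ∀ (n m : ℕ) (Ω : Fin n → Type*) [∀ j, MeasurableSpace (Ω j)]
          (μ : ∀ j, MeasureTheory.Measure (Ω j))
          [∀ j, MeasureTheory.IsProbabilityMeasure (μ j)]
          (A : Fin m → Set (∀ j, Ω j)) (p : ℝ) (τ : ℕ) (σ₀ : ∀ j, Ω j),
          (∀ i, MeasurableSet (A i)) →
          0 < p →
          (∀ i, MeasureTheory.Measure.pi μ (A i) ≤ ENNReal.ofReal p) →
          (∀ i, (((MTBeyond.dependencyGraph A).neighborSet i).ncard : ℝ) ≤
            α * (1 / (Real.exp 1 * p) - 1)) →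
          τ ≤ a * (n + m + 1) ^ k →
          MTBeyond.expectedTime c τ μ A ⌊1 / p⌋₊ σ₀ ≤
              ((C * (n + m + 1) ^ K : ℕ) : ENNReal) ∧
            MTBeyond.expectedViolated c μ A ⌊1 / p⌋₊ σ₀ ≤
              ENNReal.ofReal ((1 + η p) * MTBeyond.fraction α * m * p) := by
  -- The maximum with 1 keeps d positive when there are no events.
  have hcard : ∀ {n m : ℕ} {Ω : Fin n → Type _} (A : Fin m → Set (∀ j, Ω j)) (i : Fin m),
      (closedNbhd A i).card ≤ max 1 (Finset.univ.sup fun i => (closedNbhd A i).card) :=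
    fun A i => (Finset.le_sup (f := fun i => (closedNbhd A i).card) (Finset.mem_univ i)).trans
      (le_max_right _ _)
  rcases le_or_gt α 1 with h1 | h1
  -- Every coin shows heads (q = 1), so this is plain Moser–Tardos and the bound (1-q) e^q is 0.
  · refine ⟨algorithm (.block [.basic (.const 3 1), .basic (.const 4 1)]), fun _ => 0,
      tendsto_const_nhds, fun a k => ⟨(a + 1) * 300, k + 3, ?_⟩⟩
    intro n m Ω _ μ _ A p τ σ₀ hA hp0 hp hdeg hτ
    have hq : 0 < m → (1 : ℕ) = 0 ∨ Real.exp ((1 : ℕ) / (1 : ℕ)) *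
        ((max 1 (Finset.univ.sup fun i => (closedNbhd A i).card) : ℕ) * p) ≤ 1 := fun hm => by
      obtain ⟨hd, hep, h⟩ := degree_bounds hp0 hα hm hdeg
      rw [max_eq_right hd]
      refine Or.inr ?_
      simp only [Nat.cast_one, div_one]
      nlinarith
    obtain ⟨ht, hv⟩ := algorithm_bounds hA hp0 hp (le_max_left 1 _) (hcard A) le_rfl le_rfl hq
      (N := ⌊1 / p⌋₊) (σ₀ := σ₀) (fun w => runs_constParameters (w := w) ⌊1 / p⌋₊ 1) τ
    refine ⟨ht.trans (by exact_mod_cast time_le hτ), hv.trans ?_⟩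
    simp
  rcases lt_or_ge α (Real.exp 1) with he | he
  -- The function η is chosen such that (1 + η(p)) Λ(α) is exactly `coinFraction (coinBound α p)`.
  · refine ⟨algorithm (.block [maxDegree, coinParameters]), _, tendsto_coinFraction h1 he,
      fun a k => ⟨(a + 1) * 300, k + 3, ?_⟩⟩
    intro n m Ω _ μ _ A p τ σ₀ hA hp0 hp hdeg hτ
    set d := Finset.univ.sup fun i => (closedNbhd A i).card with hd_def
    have hq : 0 < m → stepCount d ⌊1 / p⌋₊ (d + 1) = 0 ∨
        Real.exp (stepCount d ⌊1 / p⌋₊ (d + 1) / (d + 1 : ℕ)) * ((max 1 d : ℕ) * p) ≤ 1 :=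
      fun hm => by
        obtain ⟨hd, hep, h⟩ := degree_bounds hp0 hα hm hdeg
        rw [max_eq_right hd]
        refine or_iff_not_imp_left.2 fun hS => ?_
        have h2 := exp_stepCount_le hd hS
        have h3 : (⌊1 / p⌋₊ : ℝ) * p ≤ 1 := by
          rw [← le_div_iff₀ hp0]
          exact Nat.floor_le (by positivity)
        calc _ = _ * p := by rw [← mul_assoc]
          _ ≤ _ := mul_le_mul_of_nonneg_right h2 hp0.le
          _ ≤ 1 := h3
    obtain ⟨ht, hv⟩ := algorithm_bounds hA hp0 hp (le_max_left 1 _) (hcard A)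
      (Nat.le_add_left 1 d) (stepCount_le d ⌊1 / p⌋₊ (d + 1)) hq (N := ⌊1 / p⌋₊)
      (σ₀ := σ₀) (fun w => runs_parameters (w := w) ⌊1 / p⌋₊) τ
    refine ⟨ht.trans (by exact_mod_cast time_le hτ), hv.trans ?_⟩
    rcases Nat.eq_zero_or_pos m with rfl | hm
    · simp
    obtain ⟨hd, hep, h⟩ := degree_bounds hp0 hα hm hdeg
    rw [← hd_def] at hd h
    have hep0 : 0 < Real.exp 1 * p := mul_pos (Real.exp_pos 1) hp0
    have hp1 : p < 1 := by
      have := Real.add_one_lt_exp one_ne_zero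
      nlinarith
    have hq := coinBound_le h1.le hp0 hp1 hd (h.trans (by nlinarith))
    have hf := coinFraction_antitone (a := coinBound α p) (Set.mem_Ici.2 (le_max_left _ _))
      (Set.mem_Ici.2 ((le_max_left _ _).trans hq)) hq
    rw [add_sub_cancel, div_mul_cancel₀ _ (fraction_pos h1).ne']
    refine ENNReal.ofReal_le_ofReal ?_
    rw [coinFraction] at hf
    calc _ = _ * ((m : ℝ) * p) := by ring
      _ ≤ _ := mul_le_mul_of_nonneg_right hf (by positivity)
      _ = _ := by ring
  -- No coin shows heads (q = 0), so the output is the fresh initial sample, which already meets the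
  -- bound m p.
  · refine ⟨algorithm (.block [.basic (.const 3 1), .basic (.const 4 0)]), fun _ => 0,
      tendsto_const_nhds, fun a k => ⟨(a + 1) * 300, k + 3, ?_⟩⟩
    intro n m Ω _ μ _ A p τ σ₀ hA hp0 hp hdeg hτ
    obtain ⟨ht, hv⟩ := algorithm_bounds (S := 0) hA hp0 hp (le_max_left 1 _) (hcard A) le_rfl
      (Nat.zero_le 1) (fun _ => Or.inl rfl) (N := ⌊1 / p⌋₊) (σ₀ := σ₀)
      (fun w => runs_constParameters (w := w) ⌊1 / p⌋₊ 0) τ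
    refine ⟨ht.trans (by exact_mod_cast time_le hτ), hv.trans ?_⟩
    rw [fraction, if_neg h1.not_ge, if_neg he.not_gt]
    simp
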